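/- Fix a coupling constant \(c>0\). For \(l>0\), let \[ F(Q_{11},Q_{12},M_1,M_2)=\int_{-1}^{1}\Big\{\tfrac l2\big[(Q_{11}')^2+(Q_{12}')^2+(M_1')^2+(M_2')^2\big]+(Q_{11}^2+Q_{12}^2-1)^2+\tfrac14(M_1^2+M_2^2-1)^2-cQ_{11}(M_1^2-M_2^2)-2cQ_{12}M_1M_2\Big\}\,dy \] be the full ferronematic energy (with \(l_1=l_2=l\), \(\xi=1\)) on the space \(\mathcal A\) of all \((Q_{11},Q_{12},M_1,M_2)\in W^{1,2}((-1,1);\mathbb R^4)\) with \(Q_{11}(-1)=M_1(-1)=1\), \(Q_{11}(1)=M_1(1)=-1\), \(Q_{12}(\pm1)=M_2(\pm1)=0\). Let \[ E(Q_{11},M_1)=\int_{-1}^{1}\Big\{\tfrac l2(Q_{11}')^2+\tfrac l2(M_1')^2+(Q_{11}^2-1)^2+\tfrac14(M_1^2-1)^2-cQ_{11}M_1^2\Big\}\,dy \] be the order reconstruction (OR) energy on the space \(\mathcal A'\) of all \((Q_{11},M_1)\in W^{1,2}((-1,1);\mathbb R^2)\) with \(Q_{11}(-1)=M_1(-1)=1\),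 \(Q_{11}(1)=M_1(1)=-1\). **Theorem (instability of the OR solution).** For every \(c>0\) there is \(l_0=l_0(c)>0\) such that for every \(l\in(0,l_0)\) and every minimiser \((Q_{11}^*,M_1^*)\) of \(E\) in \(\mathcal A'\), the profile \(p=(Q_{11}^*,0,M_1^*,0)\) is an unstable critical point of \(F\) in \(\mathcal A\). That is, \(p\in\mathcal A\), and \[ \frac{d}{dt}\Big|_{t=0}F(p+t\eta)=0\quad\text{for all }\eta\in W_0^{1,2}((-1,1);\mathbb R^4), \] while there is \(\eta\in W_0^{1,2}((-1,1);\mathbb R^4)\) with \[ \frac{d^2}{dt^2}\Big|_{t=0}F(p+t\eta)<0 . \] -/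

import Mathlib

open MeasureTheory Set

open scoped ContDiff

noncomputable section

namespace Ferronematic

/-- `v` is a weak derivative of `u` on the open interval `(-1, 1)`: integration by parts holds
against every smooth test function with compact support in `(-1, 1)`. -/
def HasWeakDeriv (u v : ℝ → ℝ) : Prop :=
  ∀ φ : ℝ → ℝ, ContDiff ℝ ∞ φ → HasCompactSupport φ → tsupport φ ⊆ Ioo (-1) 1 →
    ∫ y in Ioo (-1 : ℝ) 1, u y * deriv φ y = -∫ y in Ioo (-1 : ℝ) 1, v y * φ y

/-- `u` belongs to the Sobolev space `W^{1,2}((-1, 1))`, and is its representative that is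
continuous on `[-1, 1]`, so that boundary values are pointwise values. (Every class in
`W^{1,2}((-1, 1))` has exactly one such representative on `[-1, 1]`.) -/
structure MemW12 (u : ℝ → ℝ) : Prop where
  continuousOn : ContinuousOn u (Icc (-1) 1)
  memLp : MemLp u 2 (volume.restrict (Ioo (-1) 1))
  exists_weakDeriv : ∃ v : ℝ → ℝ, MemLp v 2 (volume.restrict (Ioo (-1) 1)) ∧ HasWeakDeriv u v

/-- `u` belongs to `W_0^{1,2}((-1, 1))`: a `W^{1,2}` function that vanishes at `-1` and `1`. -/
structure MemW12Zero (u : ℝ → ℝ) : Prop extends MemW12 u where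
  left : u (-1) = 0
  right : u 1 = 0

open Classical in
/-- The square-integrable weak derivative of a `W^{1,2}` function, which is unique up to equality
almost everywhere on `(-1, 1)`; the value is `0` by convention when there is none. -/
def weakDeriv (u : ℝ → ℝ) : ℝ → ℝ :=
  if h : ∃ v : ℝ → ℝ, MemLp v 2 (volume.restrict (Ioo (-1) 1)) ∧ HasWeakDeriv u v
  then h.choose else 0

/-- A profile `(Q₁₁, Q₁₂, M₁, M₂)`: the two independent components of the symmetric traceless
`2 × 2` matrix `Q`, and the two components of the vector `M`. -/
structure Profile where
  Q₁₁ : ℝ → ℝ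
  Q₁₂ : ℝ → ℝ
  M₁ : ℝ → ℝ
  M₂ : ℝ → ℝ

/-- The ferronematic free energy with elastic constants `l₁`, `l₂`, weight `ξ` and coupling `c`. -/
def energy (l₁ l₂ ξ c : ℝ) (p : Profile) : ℝ :=
  ∫ y in Ioo (-1 : ℝ) 1,
    (l₁ / 2 * (weakDeriv p.Q₁₁ y ^ 2 + weakDeriv p.Q₁₂ y ^ 2)
      + (p.Q₁₁ y ^ 2 + p.Q₁₂ y ^ 2 - 1) ^ 2
      + ξ * l₂ / 2 * (weakDeriv p.M₁ y ^ 2 + weakDeriv p.M₂ y ^ 2)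
      + ξ / 4 * (p.M₁ y ^ 2 + p.M₂ y ^ 2 - 1) ^ 2
      - c * p.Q₁₁ y * (p.M₁ y ^ 2 - p.M₂ y ^ 2)
      - 2 * c * p.Q₁₂ y * p.M₁ y * p.M₂ y)

/-- The free energy in the standing setting `l₁ = l₂ = l`, `ξ = 1`. -/
def fullEnergy (l c : ℝ) (p : Profile) : ℝ := energy l l 1 c p

/-- The admissible space: `W^{1,2}` profiles with the Dirichlet boundary conditions
`Q₁₁(-1) = M₁(-1) = 1`, `Q₁₁(1) = M₁(1) = -1`, `Q₁₂(±1) = M₂(±1) = 0`. -/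
structure Admissible (p : Profile) : Prop where
  memQ₁₁ : MemW12 p.Q₁₁
  memQ₁₂ : MemW12 p.Q₁₂
  memM₁ : MemW12 p.M₁
  memM₂ : MemW12 p.M₂
  Q₁₁_left : p.Q₁₁ (-1) = 1
  M₁_left : p.M₁ (-1) = 1
  Q₁₂_left : p.Q₁₂ (-1) = 0
  Q₁₂_right : p.Q₁₂ 1 = 0
  M₂_left : p.M₂ (-1) = 0
  M₂_right : p.M₂ 1 = 0
  Q₁₁_right : p.Q₁₁ 1 = -1
  M₁_right : p.M₁ 1 = -1

/-- Admissible perturbations: all four components lie in `W_0^{1,2}`. -/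
structure IsPerturbation (η : Profile) : Prop where
  memQ₁₁ : MemW12Zero η.Q₁₁
  memQ₁₂ : MemW12Zero η.Q₁₂
  memM₁ : MemW12Zero η.M₁
  memM₂ : MemW12Zero η.M₂

/-- The perturbed profile `p + t η`. -/
def perturb (p η : Profile) (t : ℝ) : Profile where
  Q₁₁ := fun y => p.Q₁₁ y + t * η.Q₁₁ y
  Q₁₂ := fun y => p.Q₁₂ y + t * η.Q₁₂ y
  M₁ := fun y => p.M₁ y + t * η.M₁ y
  M₂ := fun y => p.M₂ y + t * η.M₂ y

/-- `p` is a critical point of the full energy in the admissible space: it is admissible and the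
first variation vanishes in every direction. -/
def IsCriticalPoint (l c : ℝ) (p : Profile) : Prop :=
  Admissible p ∧
    ∀ η : Profile, IsPerturbation η → HasDerivAt (fun t => fullEnergy l c (perturb p η t)) 0 0

/-- The second variation `d²/dt² F(p + t η)` at `t = 0` of the full energy. -/
def secondVariation (l c : ℝ) (p η : Profile) : ℝ :=
  iteratedDeriv 2 (fun t => fullEnergy l c (perturb p η t)) 0

/-- `p` is an unstable critical point of the full energy: it is a critical point and the second
variation is negative in some admissible direction. -/
def IsUnstableCriticalPoint (l c : ℝ) (p : Profile) : Prop :=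
  IsCriticalPoint l c p ∧ ∃ η : Profile, IsPerturbation η ∧ secondVariation l c p η < 0

/-- The order reconstruction (OR) energy of a pair `(Q₁₁, M₁)`. -/
def orEnergy (l c : ℝ) (Q M : ℝ → ℝ) : ℝ :=
  ∫ y in Ioo (-1 : ℝ) 1,
    (l / 2 * weakDeriv Q y ^ 2 + l / 2 * weakDeriv M y ^ 2
      + (Q y ^ 2 - 1) ^ 2 + 1 / 4 * (M y ^ 2 - 1) ^ 2 - c * Q y * M y ^ 2)

/-- The admissible space of the OR problem. -/
structure ORAdmissible (Q M : ℝ → ℝ) : Prop where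
  memQ : MemW12 Q
  memM : MemW12 M
  Q_left : Q (-1) = 1
  M_left : M (-1) = 1
  Q_right : Q 1 = -1
  M_right : M 1 = -1

/-- `(Q, M)` is a (global) minimiser of the OR energy in its admissible space. -/
def IsORMinimiser (l c : ℝ) (Q M : ℝ → ℝ) : Prop :=
  ORAdmissible Q M ∧ ∀ P N : ℝ → ℝ, ORAdmissible P N → orEnergy l c Q M ≤ orEnergy l c P N

/-- The OR profile `(Q, 0, M, 0)`. -/
def orProfile (Q M : ℝ → ℝ) : Profile where
  Q₁₁ := Q
  Q₁₂ := fun _ => 0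
  M₁ := M
  M₂ := fun _ => 0

end Ferronematic

end

namespace Ferronematic

/-! ### Weak derivatives on `(-1, 1)` -/

/-! The full energy is invariant under rotating `M` by an angle and the `Q` tensor by twice that
angle. At `(Q, 0, M, 0)` the generator of this symmetry is the direction `(0, 2Q, 0, M)`: it solves
the linearised equations, so its second variation density is an exact derivative, but it does not
vanish at the walls. Instability follows once the mode is brought to zero at both walls with a net
gain. A linear ramp on `[-1, 0]` costs only `O(l)`. In a layer of width `O(√l)` at `y = 1` the mode
is replaced by `(k(1+Q), b(1+Q) M)`, which vanishes at the wall because `Q = -1` there and joins the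
rotation mode where `Q` first reaches a level `θ`. If the stretched layer contributes at most `-δ`,
with `δ > 0` depending only on `c`, the second variation is at most `A l - δ √l`, which is negative
for small `l` (`exists_isPerturbation_secondVariation_le`, `exists_threshold_of_layer_bound`).

Criticality is a parity matter: the energy is even in the pair `(Q₁₂, M₂)`, so its first variation
at an OR profile only sees OR directions.

The level `θ` is reached at distance `O(√l)` from the wall, because a competitor with linear ramps
has energy at most twice the minimum of the potential plus `O(√l)` (`exists_potential_lt`).

In the layer, the squared gradients of the new direction are dominated by `Q' (Λ(1+Q))'`, and
integration by parts with the Euler–Lagrange equation for `Q` removes the derivatives. What remains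
is an integral of `-N(v) + c M² Ψ(v)`, `v = 1 + Q`, and a boundary term. For `c ≤ 16` the energy
`X'²/2 - (1 - X²)²` of the first equation balances the loss where `Ψ > 0` against the gain from `N`
(`LayerSolution.layer_integral_le`). For `c ≥ 16` the conserved energy forces `X' > 2c/5`, and the
boundary term wins (`LayerSolution.layer_integral_le_of_sixteen_le`). Both arguments rest on maximum
principle bounds for `X` and barriers `|Y| ≤ 1 + κ(1 + X)`. -/

theorem integral_Ioo_eq_intervalIntegral (f : ℝ → ℝ) :
    ∫ y in Ioo (-1 : ℝ) 1, f y = ∫ y in (-1 : ℝ)..1, f y := by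
  rw [intervalIntegral.integral_of_le (by norm_num), integral_Ioc_eq_integral_Ioo]

theorem integrableOn_Ioo_iff_intervalIntegrable {f : ℝ → ℝ} :
    IntegrableOn f (Ioo (-1) 1) ↔ IntervalIntegrable f volume (-1) 1 := by
  rw [intervalIntegrable_iff_integrableOn_Ioo_of_le (by norm_num)]

theorem integrableOn_Ioo_of_continuousOn {f : ℝ → ℝ} (hf : ContinuousOn f (Icc (-1) 1)) :
    IntegrableOn f (Ioo (-1) 1) :=
  (hf.integrableOn_compact isCompact_Icc).mono_set Ioo_subset_Icc_self

theorem memLp_of_continuousOn {f : ℝ → ℝ} (hf : ContinuousOn f (Icc (-1) 1)) :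
    MemLp f 2 (volume.restrict (Ioo (-1) 1)) := by
  rw [memLp_two_iff_integrable_sq
    ((hf.mono Ioo_subset_Icc_self).aestronglyMeasurable measurableSet_Ioo)]
  exact integrableOn_Ioo_of_continuousOn (hf.pow 2)

theorem integrableOn_mul_continuousOn {f g : ℝ → ℝ} (hf : IntegrableOn f (Ioo (-1) 1))
    (hg : ContinuousOn g (Icc (-1) 1)) : IntegrableOn (fun y => f y * g y) (Ioo (-1) 1) := by
  have := ((integrableOn_Icc_iff_integrableOn_Ioo (μ := volume)).mpr hf).mul_continuousOn
    hg isCompact_Icc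
  exact this.mono_set Ioo_subset_Icc_self

theorem HasWeakDeriv.ae_eq {u v w : ℝ → ℝ} (hv : HasWeakDeriv u v) (hw : HasWeakDeriv u w)
    (hvi : IntegrableOn v (Ioo (-1) 1)) (hwi : IntegrableOn w (Ioo (-1) 1)) :
    v =ᵐ[volume.restrict (Ioo (-1) 1)] w := by
  have key := IsOpen.ae_eq_zero_of_integral_contDiff_smul_eq_zero
    (μ := volume.restrict (Ioo (-1 : ℝ) 1)) (f := fun x => v x - w x) (isOpen_Ioo (a := (-1:ℝ)) (b := 1))
    ((hvi.sub hwi).locallyIntegrable.locallyIntegrableOn _) (by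
      intro g hg hgc hgs
      have h1 := hv g hg hgc hgs
      have h2 := hw g hg hgc hgs
      have hgc' := hg.continuous.continuousOn (s := Icc (-1 : ℝ) 1)
      have := integral_sub (integrableOn_mul_continuousOn hvi hgc')
        (integrableOn_mul_continuousOn hwi hgc')
      calc ∫ x in Ioo (-1 : ℝ) 1, g x • (v x - w x)
          = ∫ x in Ioo (-1 : ℝ) 1, (v x * g x - w x * g x) := by
            congr 1; ext x; simp; ring
        _ = 0 := by rw [this]; linarith)
  rw [Filter.EventuallyEq, ae_restrict_iff' measurableSet_Ioo]
  rw [ae_restrict_iff' measurableSet_Ioo] at key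
  filter_upwards [key] with x hx hxI
  have := hx hxI hxI
  linarith

theorem MemW12.memLp_weakDeriv {u : ℝ → ℝ} (hu : MemW12 u) :
    MemLp (weakDeriv u) 2 (volume.restrict (Ioo (-1) 1)) := by
  rw [weakDeriv, dif_pos hu.exists_weakDeriv]
  exact hu.exists_weakDeriv.choose_spec.1

theorem MemW12.hasWeakDeriv {u : ℝ → ℝ} (hu : MemW12 u) : HasWeakDeriv u (weakDeriv u) := by
  rw [weakDeriv, dif_pos hu.exists_weakDeriv]
  exact hu.exists_weakDeriv.choose_spec.2

theorem integrableOn_of_memLp {v : ℝ → ℝ} (hv : MemLp v 2 (volume.restrict (Ioo (-1 : ℝ) 1))) :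
    IntegrableOn v (Ioo (-1) 1) := hv.integrable (by norm_num)

theorem MemW12.integrableOn_weakDeriv {u : ℝ → ℝ} (hu : MemW12 u) :
    IntegrableOn (weakDeriv u) (Ioo (-1) 1) := integrableOn_of_memLp hu.memLp_weakDeriv

theorem MemW12.weakDeriv_ae_eq {u v : ℝ → ℝ} (hu : MemW12 u) (hv : HasWeakDeriv u v)
    (hvi : IntegrableOn v (Ioo (-1) 1)) :
    weakDeriv u =ᵐ[volume.restrict (Ioo (-1) 1)] v :=
  hu.hasWeakDeriv.ae_eq hv hu.integrableOn_weakDeriv hvi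

theorem HasWeakDeriv.add_const_mul {u v u' v' : ℝ → ℝ} (hu : HasWeakDeriv u u')
    (hv : HasWeakDeriv v v') (hui : IntegrableOn u (Ioo (-1) 1))
    (hvi : IntegrableOn v (Ioo (-1) 1)) (hui' : IntegrableOn u' (Ioo (-1) 1))
    (hvi' : IntegrableOn v' (Ioo (-1) 1)) (t : ℝ) :
    HasWeakDeriv (fun y => u y + t * v y) (fun y => u' y + t * v' y) := by
  intro φ h1 h2 h3
  have hd : ContinuousOn (deriv φ) (Icc (-1) 1) :=
    (h1.continuous_deriv (by simp)).continuousOn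
  have hc : ContinuousOn φ (Icc (-1) 1) := h1.continuous.continuousOn
  have e1 := integral_add (integrableOn_mul_continuousOn hui hd)
    ((integrableOn_mul_continuousOn hvi hd).const_mul t)
  have e2 := integral_add (integrableOn_mul_continuousOn hui' hc)
    ((integrableOn_mul_continuousOn hvi' hc).const_mul t)
  rw [integral_const_mul] at e1 e2
  have a1 := hu φ h1 h2 h3
  have a2 := hv φ h1 h2 h3
  rw [show (fun y => (u y + t * v y) * deriv φ y) =
    fun y => u y * deriv φ y + t * (v y * deriv φ y) by ext y; ring,
    show (fun y => (u' y + t * v' y) * φ y) =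
    fun y => u' y * φ y + t * (v' y * φ y) by ext y; ring, e1, e2, a1, a2]
  ring

theorem MemW12.integrableOn {u : ℝ → ℝ} (hu : MemW12 u) : IntegrableOn u (Ioo (-1) 1) :=
  integrableOn_Ioo_of_continuousOn hu.continuousOn

theorem MemW12.hasWeakDeriv_add_const_mul {u v : ℝ → ℝ} (hu : MemW12 u) (hv : MemW12 v) (t : ℝ) :
    HasWeakDeriv (fun y => u y + t * v y) (fun y => weakDeriv u y + t * weakDeriv v y) :=
  hu.hasWeakDeriv.add_const_mul hv.hasWeakDeriv hu.integrableOn hv.integrableOn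
    hu.integrableOn_weakDeriv hv.integrableOn_weakDeriv t

theorem MemW12.add_const_mul {u v : ℝ → ℝ} (hu : MemW12 u) (hv : MemW12 v) (t : ℝ) :
    MemW12 (fun y => u y + t * v y) where
  continuousOn := hu.continuousOn.add (continuousOn_const.mul hv.continuousOn)
  memLp := hu.memLp.add (hv.memLp.const_mul t)
  exists_weakDeriv := ⟨_, hu.memLp_weakDeriv.add (hv.memLp_weakDeriv.const_mul t),
    hu.hasWeakDeriv_add_const_mul hv t⟩

theorem MemW12.weakDeriv_add_const_mul {u v : ℝ → ℝ} (hu : MemW12 u) (hv : MemW12 v) (t : ℝ) :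
    weakDeriv (fun y => u y + t * v y) =ᵐ[volume.restrict (Ioo (-1) 1)]
      fun y => weakDeriv u y + t * weakDeriv v y :=
  (hu.add_const_mul hv t).weakDeriv_ae_eq (hu.hasWeakDeriv_add_const_mul hv t)
    (hu.integrableOn_weakDeriv.add (hv.integrableOn_weakDeriv.const_mul t))

theorem eq_zero_of_tsupport_subset {φ : ℝ → ℝ} (h : tsupport φ ⊆ Ioo (-1) 1) {y : ℝ}
    (hy : y ∉ Ioo (-1 : ℝ) 1) : φ y = 0 := by
  by_contra h0
  exact hy (h (subset_tsupport _ h0))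

/-- The countable exceptional set admits the corners of glued functions; the fundamental theorem of
calculus for `u φ` tolerates it. -/
theorem hasWeakDeriv_of_hasDerivAt {u u' : ℝ → ℝ} {s : Set ℝ} (hs : s.Countable)
    (hu : ContinuousOn u (Icc (-1) 1)) (hd : ∀ y ∈ Ioo (-1 : ℝ) 1 \ s, HasDerivAt u (u' y) y)
    (hi : IntegrableOn u' (Ioo (-1) 1)) : HasWeakDeriv u u' := by
  intro φ h1 h2 h3
  have hdc : ContinuousOn (deriv φ) (Icc (-1) 1) :=
    (h1.continuous_deriv (by simp)).continuousOn
  have hc : ContinuousOn φ (Icc (-1) 1) := h1.continuous.continuousOn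
  have i1 := integrableOn_mul_continuousOn hi hc
  have i2 := integrableOn_mul_continuousOn (integrableOn_Ioo_of_continuousOn hu) hdc
  have := integral_eq_of_hasDerivAt_off_countable_of_le (fun y => u y * φ y)
    (fun y => u' y * φ y + u y * deriv φ y) (by norm_num : (-1 : ℝ) ≤ 1) hs (hu.mul hc)
    (fun y hy => (hd y hy).mul ((h1.differentiable (by simp)) y).hasDerivAt)
    (integrableOn_Ioo_iff_intervalIntegrable.mp (i1.add i2))
  rw [← integral_Ioo_eq_intervalIntegral, integral_add i1 i2,
    eq_zero_of_tsupport_subset h3 (by simp), eq_zero_of_tsupport_subset h3 (by simp)] at this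
  linarith

theorem memW12_of_hasDerivAt {u u' : ℝ → ℝ} {s : Set ℝ} (hs : s.Countable)
    (hu : ContinuousOn u (Icc (-1) 1)) (hd : ∀ y ∈ Ioo (-1 : ℝ) 1 \ s, HasDerivAt u (u' y) y)
    (hi : MemLp u' 2 (volume.restrict (Ioo (-1) 1))) : MemW12 u where
  continuousOn := hu
  memLp := memLp_of_continuousOn hu
  exists_weakDeriv := ⟨u', hi, hasWeakDeriv_of_hasDerivAt hs hu hd (integrableOn_of_memLp hi)⟩

theorem weakDeriv_ae_eq_of_hasDerivAt {u u' : ℝ → ℝ} {s : Set ℝ} (hs : s.Countable)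
    (hu : ContinuousOn u (Icc (-1) 1)) (hd : ∀ y ∈ Ioo (-1 : ℝ) 1 \ s, HasDerivAt u (u' y) y)
    (hi : MemLp u' 2 (volume.restrict (Ioo (-1) 1))) :
    weakDeriv u =ᵐ[volume.restrict (Ioo (-1) 1)] u' :=
  (memW12_of_hasDerivAt hs hu hd hi).weakDeriv_ae_eq
    (hasWeakDeriv_of_hasDerivAt hs hu hd (integrableOn_of_memLp hi)) (integrableOn_of_memLp hi)

theorem memW12_of_contDiff {φ : ℝ → ℝ} (h : ContDiff ℝ 1 φ) : MemW12 φ :=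
  memW12_of_hasDerivAt (s := ∅) (u' := deriv φ) countable_empty h.continuous.continuousOn
    (fun y _ => (h.differentiable (by simp) y).hasDerivAt)
    (memLp_of_continuousOn (h.continuous_deriv (by simp)).continuousOn)

theorem weakDeriv_ae_eq_deriv {φ : ℝ → ℝ} (h : ContDiff ℝ 1 φ) :
    weakDeriv φ =ᵐ[volume.restrict (Ioo (-1) 1)] deriv φ :=
  weakDeriv_ae_eq_of_hasDerivAt (s := ∅) (u' := deriv φ) countable_empty
    h.continuous.continuousOn (fun y _ => (h.differentiable (by simp) y).hasDerivAt)
    (memLp_of_continuousOn (h.continuous_deriv (by simp)).continuousOn)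

/-- The du Bois-Reymond lemma on `(-1, 1)`. -/
theorem HasWeakDeriv.ae_eq_const {u : ℝ → ℝ} (hu : HasWeakDeriv u 0)
    (hi : IntegrableOn u (Ioo (-1) 1)) :
    ∃ a : ℝ, u =ᵐ[volume.restrict (Ioo (-1) 1)] fun _ => a := by
  let b : ContDiffBump (0 : ℝ) := ⟨1/4, 1/2, by norm_num, by norm_num⟩
  set ψ : ℝ → ℝ := b.normed volume with hψ
  have ψ1 : ContDiff ℝ ∞ ψ := b.contDiff_normed
  have ψs : tsupport ψ ⊆ Icc (-1/2) (1/2) := by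
    rw [hψ, b.tsupport_normed_eq, Real.closedBall_eq_Icc]
    apply Icc_subset_Icc <;> norm_num [b]
  have ψi : ∫ y in Ioo (-1 : ℝ) 1, ψ y = 1 := by
    rw [setIntegral_eq_integral_of_forall_compl_eq_zero, b.integral_normed]
    intro y hy
    apply eq_zero_of_tsupport_subset (ψs.trans ?_) hy
    intro z hz; exact ⟨by linarith [hz.1], by linarith [hz.2]⟩
  refine ⟨∫ y in Ioo (-1 : ℝ) 1, u y * ψ y, ?_⟩
  set a := ∫ y in Ioo (-1 : ℝ) 1, u y * ψ y with ha
  have ψc : ContinuousOn ψ (Icc (-1) 1) := ψ1.continuous.continuousOn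
  have key := IsOpen.ae_eq_zero_of_integral_contDiff_smul_eq_zero
    (μ := volume.restrict (Ioo (-1 : ℝ) 1)) (f := fun x => u x - a)
    (isOpen_Ioo (a := (-1:ℝ)) (b := 1))
    ((hi.sub (integrable_const a)).locallyIntegrable.locallyIntegrableOn _) (by
      intro g hg hgc hgs
      set I := ∫ y in Ioo (-1 : ℝ) 1, g y with hI
      have gc : ContinuousOn g (Icc (-1) 1) := hg.continuous.continuousOn
      -- Subtracting `I ψ` makes the mean zero, so the primitive `φ` of `k` is again a test function
      -- with compact support in `(-1, 1)`.
      set k : ℝ → ℝ := fun y => g y - I * ψ y with hk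
      have k1 : ContDiff ℝ ∞ k := hg.sub (contDiff_const.mul ψ1)
      have kcont := k1.continuous
      set φ : ℝ → ℝ := fun y => ∫ z in (-1 : ℝ)..y, k z with hφ
      have φd : ∀ y, HasDerivAt φ (k y) y := fun y =>
        intervalIntegral.integral_hasDerivAt_right (kcont.intervalIntegrable _ _)
          (kcont.stronglyMeasurableAtFilter _ _) kcont.continuousAt
      have φdd : deriv φ = k := funext fun y => (φd y).deriv
      have φ1 : ContDiff ℝ ∞ φ := by
        rw [contDiff_infty_iff_deriv, φdd]
        exact ⟨fun y => (φd y).differentiableAt, k1⟩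
      obtain ⟨r, hr0, hr1, hgr⟩ : ∃ r : ℝ, 1/2 ≤ r ∧ r < 1 ∧ tsupport g ⊆ Icc (-r) r := by
        rcases (tsupport g).eq_empty_or_nonempty with he | hne
        · exact ⟨1/2, le_rfl, by norm_num, by rw [he]; exact empty_subset _⟩
        · obtain ⟨z, hz, hzm⟩ := hgc.isCompact.exists_isMaxOn hne
            (continuous_abs.continuousOn (s := tsupport g))
          have hz1 : |z| < 1 := abs_lt.mpr ⟨(hgs hz).1, (hgs hz).2⟩
          refine ⟨max (1/2) |z|, le_max_left _ _, max_lt (by norm_num) hz1, fun y hy => ?_⟩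
          have : |y| ≤ |z| := hzm hy
          exact abs_le.mp (this.trans (le_max_right _ _))
      have k0 : ∀ y, y ∉ Icc (-r) r → k y = 0 := by
        intro y hy
        have e1 : g y = 0 := by
          by_contra h; exact hy (hgr (subset_tsupport _ h))
        have e2 : ψ y = 0 := by
          by_contra h
          have := ψs (subset_tsupport _ h)
          exact hy ⟨by linarith [this.1], by linarith [this.2]⟩
        simp [hk, e1, e2]
      have kint : ∫ z in (-1 : ℝ)..1, k z = 0 := by
        rw [← integral_Ioo_eq_intervalIntegral, hk, integral_sub
          (integrableOn_Ioo_of_continuousOn gc)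
          ((integrableOn_Ioo_of_continuousOn ψc).const_mul _), integral_const_mul, ψi]
        simp [hI]
      have φ0 : ∀ y, y ∉ Icc (-r) r → φ y = 0 := by
        intro y hy
        by_cases hyr : y < -r
        · have : φ y = ∫ z in (-1 : ℝ)..y, (0 : ℝ) := by
            apply intervalIntegral.integral_congr
            intro z hz
            apply k0
            rintro ⟨h1, -⟩
            have : z ≤ max (-1) y := hz.2
            rcases le_max_iff.mp this with h | h <;> linarith
          simpa using this
        · have hyr' : r < y := by
            by_contra h; exact hy ⟨not_lt.mp hyr, not_lt.mp h⟩
          have e := intervalIntegral.integral_add_adjacent_intervals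
            (kcont.intervalIntegrable (μ := volume) (-1) 1)
            (kcont.intervalIntegrable (μ := volume) 1 y)
          have : ∫ z in (1 : ℝ)..y, k z = ∫ z in (1 : ℝ)..y, (0 : ℝ) := by
            apply intervalIntegral.integral_congr
            intro z hz
            apply k0
            rintro ⟨-, h1⟩
            have : min 1 y ≤ z := hz.1
            rcases min_le_iff.mp this with h | h <;> linarith
          simp only [hφ]
          rw [← e, kint, this]; simp
      have φs : tsupport φ ⊆ Icc (-r) r :=
        closure_minimal (fun y hy => by by_contra h; exact hy (φ0 y h)) isClosed_Icc
      have := hu φ φ1 (HasCompactSupport.of_support_subset_isCompact isCompact_Icc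
        ((subset_tsupport _).trans φs))
        (φs.trans fun y hy => ⟨by linarith [hy.1], by linarith [hy.2]⟩)
      rw [φdd] at this
      have i1 := integrableOn_mul_continuousOn hi gc
      have i2 := integrableOn_mul_continuousOn hi ψc
      have e : ∫ y in Ioo (-1 : ℝ) 1, u y * k y = (∫ y in Ioo (-1 : ℝ) 1, u y * g y) - I * a := by
        rw [ha, ← integral_const_mul, ← integral_sub i1 (i2.const_mul I)]
        congr 1; ext y; simp [hk]; ring
      have e' : ∫ x in Ioo (-1 : ℝ) 1, g x • (u x - a) =
          (∫ y in Ioo (-1 : ℝ) 1, u y * g y) - I * a := by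
        rw [hI, ← integral_mul_const,
          ← integral_sub i1 ((integrableOn_Ioo_of_continuousOn gc).mul_const a)]
        congr 1; ext y; simp; ring
      rw [e', ← e, this]; simp)
  rw [Filter.EventuallyEq, ae_restrict_iff' measurableSet_Ioo] at *
  filter_upwards [key] with x hx hxI
  linarith [hx hxI hxI]

theorem eqOn_Icc_of_ae_eq {f g : ℝ → ℝ} (hf : ContinuousOn f (Icc (-1) 1))
    (hg : ContinuousOn g (Icc (-1) 1)) (h : f =ᵐ[volume.restrict (Ioo (-1) 1)] g) :
    EqOn f g (Icc (-1) 1) := by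
  have h1 : EqOn f g (Ioo (-1) 1) :=
    Measure.eqOn_open_of_ae_eq h isOpen_Ioo (hf.mono Ioo_subset_Icc_self)
      (hg.mono Ioo_subset_Icc_self)
  have := h1.of_subset_closure hf hg Ioo_subset_Icc_self
    (by rw [closure_Ioo (by norm_num)])
  exact this

/-! ### The energy along a line through an order reconstruction profile -/

theorem memW12_const (a : ℝ) : MemW12 (fun _ => a) := memW12_of_contDiff contDiff_const

theorem weakDeriv_zero_ae_eq :
    weakDeriv (fun _ => (0 : ℝ)) =ᵐ[volume.restrict (Ioo (-1) 1)] fun _ => 0 := by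
  simpa using weakDeriv_ae_eq_deriv (φ := fun _ => (0 : ℝ)) contDiff_const

/-- The zeroth order density of the energy at `(Q, 0, M, 0)`. -/
noncomputable def density₀ (l c : ℝ) (Q M : ℝ → ℝ) (y : ℝ) : ℝ :=
  l / 2 * weakDeriv Q y ^ 2 + l / 2 * weakDeriv M y ^ 2
    + (Q y ^ 2 - 1) ^ 2 + 1 / 4 * (M y ^ 2 - 1) ^ 2 - c * Q y * M y ^ 2

/-- The density of the first variation of the energy at `(Q, 0, M, 0)`; only the components
`a = η.Q₁₁` and `b = η.M₁` of the direction enter. -/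
noncomputable def density₁ (l c : ℝ) (Q M a b : ℝ → ℝ) (y : ℝ) : ℝ :=
  l * (weakDeriv Q y * weakDeriv a y) + l * (weakDeriv M y * weakDeriv b y)
    + (4 * (Q y ^ 2 - 1) * Q y * a y + (M y ^ 2 - 1) * M y * b y
      - c * a y * M y ^ 2 - 2 * c * Q y * M y * b y)

/-- The second order density of the energy at `(Q, 0, M, 0)` in direction `η`. -/
noncomputable def density₂ (l c : ℝ) (Q M : ℝ → ℝ) (η : Profile) (y : ℝ) : ℝ :=
  l / 2 * weakDeriv η.Q₁₁ y ^ 2 + l / 2 * weakDeriv η.M₁ y ^ 2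
    + l / 2 * weakDeriv η.Q₁₂ y ^ 2 + l / 2 * weakDeriv η.M₂ y ^ 2
    + ((6 * Q y ^ 2 - 2) * η.Q₁₁ y ^ 2 + (3 * M y ^ 2 - 1) / 2 * η.M₁ y ^ 2
      - 2 * c * η.Q₁₁ y * M y * η.M₁ y - c * Q y * η.M₁ y ^ 2
      + 2 * (Q y ^ 2 - 1) * η.Q₁₂ y ^ 2 + (M y ^ 2 - 1) / 2 * η.M₂ y ^ 2
      + c * Q y * η.M₂ y ^ 2 - 2 * c * M y * η.Q₁₂ y * η.M₂ y)

/-- The third order density of the energy at `(Q, 0, M, 0)` in direction `η`. -/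
noncomputable def density₃ (c : ℝ) (Q M : ℝ → ℝ) (η : Profile) (y : ℝ) : ℝ :=
  4 * Q y * η.Q₁₁ y ^ 3 + M y * η.M₁ y ^ 3 - c * η.Q₁₁ y * η.M₁ y ^ 2
    + 4 * Q y * η.Q₁₁ y * η.Q₁₂ y ^ 2 + M y * η.M₁ y * η.M₂ y ^ 2
    + c * η.Q₁₁ y * η.M₂ y ^ 2 - 2 * c * η.Q₁₂ y * η.M₁ y * η.M₂ y

/-- The fourth order density of the energy in direction `η`. -/
noncomputable def density₄ (η : Profile) (y : ℝ) : ℝ :=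
  (η.Q₁₁ y ^ 2 + η.Q₁₂ y ^ 2) ^ 2 + 1 / 4 * (η.M₁ y ^ 2 + η.M₂ y ^ 2) ^ 2

section Expansion

variable {l c : ℝ} {Q M : ℝ → ℝ} {η : Profile}

theorem integrableOn_density₀ (hQ : MemW12 Q) (hM : MemW12 M) :
    IntegrableOn (density₀ l c Q M) (Ioo (-1) 1) := by
  have h1 := hQ.memLp_weakDeriv.integrable_sq
  have h2 := hM.memLp_weakDeriv.integrable_sq
  have c1 := hQ.continuousOn
  have c2 := hM.continuousOn
  have h3 : IntegrableOn (fun y => (Q y ^ 2 - 1) ^ 2 + 1 / 4 * (M y ^ 2 - 1) ^ 2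
      - c * Q y * M y ^ 2) (Ioo (-1) 1) := integrableOn_Ioo_of_continuousOn (by fun_prop)
  refine (((h1.const_mul (l / 2)).add (h2.const_mul (l / 2))).add h3).congr
    (Filter.Eventually.of_forall fun y => ?_)
  simp only [density₀, Pi.add_apply]; ring

theorem integrableOn_density₁ {a b : ℝ → ℝ} (hQ : MemW12 Q) (hM : MemW12 M) (ha : MemW12 a)
    (hb : MemW12 b) : IntegrableOn (density₁ l c Q M a b) (Ioo (-1) 1) := by
  have h1 := hQ.memLp_weakDeriv.integrable_mul ha.memLp_weakDeriv
  have h2 := hM.memLp_weakDeriv.integrable_mul hb.memLp_weakDeriv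
  have c1 := hQ.continuousOn
  have c2 := hM.continuousOn
  have c3 := ha.continuousOn
  have c4 := hb.continuousOn
  have h3 : IntegrableOn (fun y => 4 * (Q y ^ 2 - 1) * Q y * a y + (M y ^ 2 - 1) * M y * b y
      - c * a y * M y ^ 2 - 2 * c * Q y * M y * b y) (Ioo (-1) 1) :=
    integrableOn_Ioo_of_continuousOn (by fun_prop)
  refine (((h1.const_mul l).add (h2.const_mul l)).add h3).congr
    (Filter.Eventually.of_forall fun y => ?_)
  simp only [density₁, Pi.add_apply, Pi.mul_apply]

theorem integrableOn_density₂ (hQ : MemW12 Q) (hM : MemW12 M) (hη : IsPerturbation η) :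
    IntegrableOn (density₂ l c Q M η) (Ioo (-1) 1) := by
  have h1 := hη.memQ₁₁.memLp_weakDeriv.integrable_sq
  have h2 := hη.memM₁.memLp_weakDeriv.integrable_sq
  have h3 := hη.memQ₁₂.memLp_weakDeriv.integrable_sq
  have h4 := hη.memM₂.memLp_weakDeriv.integrable_sq
  have c1 := hQ.continuousOn
  have c2 := hM.continuousOn
  have c3 := hη.memQ₁₁.continuousOn
  have c4 := hη.memM₁.continuousOn
  have c5 := hη.memQ₁₂.continuousOn
  have c6 := hη.memM₂.continuousOn
  have h5 : IntegrableOn (fun y => (6 * Q y ^ 2 - 2) * η.Q₁₁ y ^ 2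
      + (3 * M y ^ 2 - 1) / 2 * η.M₁ y ^ 2
      - 2 * c * η.Q₁₁ y * M y * η.M₁ y - c * Q y * η.M₁ y ^ 2
      + 2 * (Q y ^ 2 - 1) * η.Q₁₂ y ^ 2 + (M y ^ 2 - 1) / 2 * η.M₂ y ^ 2
      + c * Q y * η.M₂ y ^ 2 - 2 * c * M y * η.Q₁₂ y * η.M₂ y) (Ioo (-1) 1) :=
    integrableOn_Ioo_of_continuousOn (by fun_prop)
  exact ((((h1.const_mul (l / 2)).add (h2.const_mul (l / 2))).add
    (h3.const_mul (l / 2))).add (h4.const_mul (l / 2))).add h5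

theorem integrableOn_density₃ (hQ : MemW12 Q) (hM : MemW12 M) (hη : IsPerturbation η) :
    IntegrableOn (density₃ c Q M η) (Ioo (-1) 1) := by
  have c1 := hQ.continuousOn
  have c2 := hM.continuousOn
  have c3 := hη.memQ₁₁.continuousOn
  have c4 := hη.memM₁.continuousOn
  have c5 := hη.memQ₁₂.continuousOn
  have c6 := hη.memM₂.continuousOn
  unfold density₃
  exact integrableOn_Ioo_of_continuousOn (by fun_prop)

theorem integrableOn_density₄ (hη : IsPerturbation η) :
    IntegrableOn (density₄ η) (Ioo (-1) 1) := by
  have c3 := hη.memQ₁₁.continuousOn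
  have c4 := hη.memM₁.continuousOn
  have c5 := hη.memQ₁₂.continuousOn
  have c6 := hη.memM₂.continuousOn
  unfold density₄
  exact integrableOn_Ioo_of_continuousOn (by fun_prop)

theorem integral_quartic {f₀ f₁ f₂ f₃ f₄ : ℝ → ℝ} {μ : Measure ℝ} (h₀ : Integrable f₀ μ)
    (h₁ : Integrable f₁ μ) (h₂ : Integrable f₂ μ) (h₃ : Integrable f₃ μ) (h₄ : Integrable f₄ μ)
    (t : ℝ) : ∫ y, (f₀ y + t * f₁ y + t ^ 2 * f₂ y + t ^ 3 * f₃ y + t ^ 4 * f₄ y) ∂μ =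
      (∫ y, f₀ y ∂μ) + t * (∫ y, f₁ y ∂μ) + t ^ 2 * (∫ y, f₂ y ∂μ) + t ^ 3 * (∫ y, f₃ y ∂μ)
        + t ^ 4 * (∫ y, f₄ y ∂μ) := by
  have k₁ := h₁.const_mul t
  have k₂ := h₂.const_mul (t ^ 2)
  have k₃ := h₃.const_mul (t ^ 3)
  have k₄ := h₄.const_mul (t ^ 4)
  have e₁ : Integrable (fun y => f₀ y + t * f₁ y) μ := h₀.add k₁
  have e₂ : Integrable (fun y => f₀ y + t * f₁ y + t ^ 2 * f₂ y) μ := e₁.add k₂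
  have e₃ : Integrable (fun y => f₀ y + t * f₁ y + t ^ 2 * f₂ y + t ^ 3 * f₃ y) μ := e₂.add k₃
  rw [integral_add e₃ k₄, integral_add e₂ k₃, integral_add e₁ k₂, integral_add h₀ k₁,
    integral_const_mul, integral_const_mul, integral_const_mul, integral_const_mul]

/-- The integrand is a polynomial of degree four in the profile and its derivative, so the expansion
in `t` is exact and both variations are read off from its coefficients. -/
theorem fullEnergy_perturb_orProfile (hQ : MemW12 Q) (hM : MemW12 M) (hη : IsPerturbation η)
    (t : ℝ) :
    fullEnergy l c (perturb (orProfile Q M) η t) =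
      (∫ y in Ioo (-1 : ℝ) 1, density₀ l c Q M y)
      + t * (∫ y in Ioo (-1 : ℝ) 1, density₁ l c Q M η.Q₁₁ η.M₁ y)
      + t ^ 2 * (∫ y in Ioo (-1 : ℝ) 1, density₂ l c Q M η y)
      + t ^ 3 * (∫ y in Ioo (-1 : ℝ) 1, density₃ c Q M η y)
      + t ^ 4 * (∫ y in Ioo (-1 : ℝ) 1, density₄ η y) := by
  have i0 := integrableOn_density₀ (l := l) (c := c) hQ hM
  have i1 := integrableOn_density₁ (l := l) (c := c) hQ hM hη.memQ₁₁.toMemW12 hη.memM₁.toMemW12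
  have i2 := integrableOn_density₂ (l := l) (c := c) hQ hM hη
  have i3 := integrableOn_density₃ (c := c) hQ hM hη
  have i4 := integrableOn_density₄ hη
  rw [← integral_quartic i0 i1 i2 i3 i4]
  apply integral_congr_ae
  filter_upwards [hQ.weakDeriv_add_const_mul hη.memQ₁₁.toMemW12 t,
    (memW12_const 0).weakDeriv_add_const_mul hη.memQ₁₂.toMemW12 t,
    hM.weakDeriv_add_const_mul hη.memM₁.toMemW12 t,
    (memW12_const 0).weakDeriv_add_const_mul hη.memM₂.toMemW12 t,
    weakDeriv_zero_ae_eq] with y e1 e2 e3 e4 e5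
  simp only [perturb, orProfile, e1, e2, e3, e4, e5, density₀, density₁, density₂, density₃,
    density₄]
  ring

theorem orEnergy_eq_integral_density₀ :
    orEnergy l c Q M = ∫ y in Ioo (-1 : ℝ) 1, density₀ l c Q M y := rfl

theorem fullEnergy_orProfile : fullEnergy l c (orProfile Q M) = orEnergy l c Q M := by
  rw [fullEnergy, energy, orEnergy]
  apply integral_congr_ae
  filter_upwards [weakDeriv_zero_ae_eq] with y e
  simp only [orProfile, e]
  ring

theorem hasDerivAt_quartic (e₀ e₁ e₂ e₃ e₄ t : ℝ) :
    HasDerivAt (fun t : ℝ => e₀ + t * e₁ + t ^ 2 * e₂ + t ^ 3 * e₃ + t ^ 4 * e₄)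
      (e₁ + 2 * t * e₂ + 3 * t ^ 2 * e₃ + 4 * t ^ 3 * e₄) t := by
  have h1 := (hasDerivAt_id t).mul_const e₁
  have h2 := ((hasDerivAt_id t).pow 2).mul_const e₂
  have h3 := ((hasDerivAt_id t).pow 3).mul_const e₃
  have h4 := ((hasDerivAt_id t).pow 4).mul_const e₄
  refine ((((h1.const_add e₀).add h2).add h3).add h4).congr_deriv ?_
  simp

theorem secondVariation_orProfile (hQ : MemW12 Q) (hM : MemW12 M) (hη : IsPerturbation η) :
    secondVariation l c (orProfile Q M) η = 2 * ∫ y in Ioo (-1 : ℝ) 1, density₂ l c Q M η y := by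
  rw [secondVariation, funext (fullEnergy_perturb_orProfile (l := l) (c := c) hQ hM hη),
    iteratedDeriv_succ, iteratedDeriv_one]
  refine HasDerivAt.deriv ?_
  rw [show deriv _ = _ from funext fun t => (hasDerivAt_quartic _ _ _ _ _ t).deriv]
  have := hasDerivAt_quartic (∫ y in Ioo (-1 : ℝ) 1, density₁ l c Q M η.Q₁₁ η.M₁ y)
    (2 * ∫ y in Ioo (-1 : ℝ) 1, density₂ l c Q M η y)
    (3 * ∫ y in Ioo (-1 : ℝ) 1, density₃ c Q M η y)
    (4 * ∫ y in Ioo (-1 : ℝ) 1, density₄ η y) 0 0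
  refine (this.congr_of_eventuallyEq (Filter.Eventually.of_forall fun t => ?_)).congr_deriv ?_
  · simp only; ring
  · ring

end Expansion

/-! ### Criticality of OR minimisers -/

theorem memW12Zero_zero : MemW12Zero (fun _ => (0 : ℝ)) where
  toMemW12 := memW12_const 0
  left := rfl
  right := rfl

section Minimiser

variable {l c : ℝ} {Q M : ℝ → ℝ}

theorem ORAdmissible.add_const_mul {a b : ℝ → ℝ} (h : ORAdmissible Q M) (ha : MemW12Zero a)
    (hb : MemW12Zero b) (t : ℝ) :
    ORAdmissible (fun y => Q y + t * a y) (fun y => M y + t * b y) where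
  memQ := h.memQ.add_const_mul ha.toMemW12 t
  memM := h.memM.add_const_mul hb.toMemW12 t
  Q_left := by simp [h.Q_left, ha.left]
  M_left := by simp [h.M_left, hb.left]
  Q_right := by simp [h.Q_right, ha.right]
  M_right := by simp [h.M_right, hb.right]

theorem IsORMinimiser.firstVariation_eq_zero (h : IsORMinimiser l c Q M) {a b : ℝ → ℝ}
    (ha : MemW12Zero a) (hb : MemW12Zero b) :
    ∫ y in Ioo (-1 : ℝ) 1, density₁ l c Q M a b y = 0 := by
  have hη : IsPerturbation (orProfile a b) := ⟨ha, memW12Zero_zero, hb, memW12Zero_zero⟩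
  have hE := fullEnergy_perturb_orProfile (l := l) (c := c) h.1.memQ h.1.memM hη
  have hd := hasDerivAt_quartic (∫ y in Ioo (-1 : ℝ) 1, density₀ l c Q M y)
    (∫ y in Ioo (-1 : ℝ) 1, density₁ l c Q M a b y)
    (∫ y in Ioo (-1 : ℝ) 1, density₂ l c Q M (orProfile a b) y)
    (∫ y in Ioo (-1 : ℝ) 1, density₃ c Q M (orProfile a b) y)
    (∫ y in Ioo (-1 : ℝ) 1, density₄ (orProfile a b) y) 0
  have hmin : ∀ t, fullEnergy l c (perturb (orProfile Q M) (orProfile a b) 0) ≤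
      fullEnergy l c (perturb (orProfile Q M) (orProfile a b) t) := by
    intro t
    have e : ∀ t, perturb (orProfile Q M) (orProfile a b) t =
        orProfile (fun y => Q y + t * a y) (fun y => M y + t * b y) := by
      intro t; simp [perturb, orProfile]
    rw [e, e, fullEnergy_orProfile, fullEnergy_orProfile]
    simpa using h.2 _ _ (h.1.add_const_mul ha hb t)
  have hd' := hd.congr_of_eventuallyEq (Filter.Eventually.of_forall hE)
  have := IsLocalMin.hasDerivAt_eq_zero (Filter.Eventually.of_forall hmin) hd'
  simpa using this

/-- The linear coefficient of the energy involves only `η.Q₁₁` and `η.M₁`, and in these directions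
the profile stays in the OR class, where it is minimal. -/
theorem IsORMinimiser.isCriticalPoint (h : IsORMinimiser l c Q M) :
    IsCriticalPoint l c (orProfile Q M) := by
  refine ⟨⟨h.1.memQ, memW12_const 0, h.1.memM, memW12_const 0, h.1.Q_left, h.1.M_left, rfl, rfl,
    rfl, rfl, h.1.Q_right, h.1.M_right⟩, fun η hη => ?_⟩
  rw [funext (fullEnergy_perturb_orProfile (l := l) (c := c) h.1.memQ h.1.memM hη),
    h.firstVariation_eq_zero hη.memQ₁₁ hη.memM₁]
  have := hasDerivAt_quartic (∫ y in Ioo (-1 : ℝ) 1, density₀ l c Q M y) 0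
    (∫ y in Ioo (-1 : ℝ) 1, density₂ l c Q M η y) (∫ y in Ioo (-1 : ℝ) 1, density₃ c Q M η y)
    (∫ y in Ioo (-1 : ℝ) 1, density₄ η y) 0
  simpa using this

/-! ### Euler–Lagrange equations -/

theorem memW12Zero_of_test {φ : ℝ → ℝ} (h1 : ContDiff ℝ ∞ φ) (h3 : tsupport φ ⊆ Ioo (-1) 1) :
    MemW12Zero φ where
  toMemW12 := memW12_of_contDiff (h1.of_le (by simp))
  left := eq_zero_of_tsupport_subset h3 (by simp)
  right := eq_zero_of_tsupport_subset h3 (by simp)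

theorem IsORMinimiser.hasWeakDeriv_weakDeriv_Q (hl : 0 < l) (h : IsORMinimiser l c Q M) :
    HasWeakDeriv (weakDeriv Q) (fun y => (4 * Q y * (Q y ^ 2 - 1) - c * M y ^ 2) / l) := by
  intro φ h1 h2 h3
  have h0 := h.firstVariation_eq_zero (memW12Zero_of_test h1 h3) memW12Zero_zero
  have c1 := h.1.memQ.continuousOn
  have c2 := h.1.memM.continuousOn
  have c3 : ContinuousOn φ (Icc (-1) 1) := h1.continuous.continuousOn
  have hd : ContinuousOn (deriv φ) (Icc (-1) 1) :=
    (h1.continuous_deriv (by simp)).continuousOn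
  have i1 := integrableOn_mul_continuousOn h.1.memQ.integrableOn_weakDeriv hd
  have i2 : IntegrableOn (fun y => (4 * Q y * (Q y ^ 2 - 1) - c * M y ^ 2) / l * φ y)
    (Ioo (-1) 1) := integrableOn_Ioo_of_continuousOn (by fun_prop)
  have e : ∫ y in Ioo (-1 : ℝ) 1, density₁ l c Q M φ (fun _ => 0) y =
      ∫ y in Ioo (-1 : ℝ) 1, (l * (weakDeriv Q y * deriv φ y)
        + l * ((4 * Q y * (Q y ^ 2 - 1) - c * M y ^ 2) / l * φ y)) := by
    apply integral_congr_ae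
    filter_upwards [weakDeriv_zero_ae_eq,
      weakDeriv_ae_eq_deriv (h1.of_le (by simp) : ContDiff ℝ 1 φ)] with y e1 e2
    simp only [density₁, e1, e2]
    field_simp
    ring
  rw [e, integral_add (i1.const_mul l) (i2.const_mul l), integral_const_mul,
    integral_const_mul, ← mul_add] at h0
  have := (mul_eq_zero.mp h0).resolve_left hl.ne'
  linarith

theorem IsORMinimiser.hasWeakDeriv_weakDeriv_M (hl : 0 < l) (h : IsORMinimiser l c Q M) :
    HasWeakDeriv (weakDeriv M) (fun y => (M y * (M y ^ 2 - 1) - 2 * c * Q y * M y) / l) := by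
  intro φ h1 h2 h3
  have h0 := h.firstVariation_eq_zero memW12Zero_zero (memW12Zero_of_test h1 h3)
  have c1 := h.1.memQ.continuousOn
  have c2 := h.1.memM.continuousOn
  have c3 : ContinuousOn φ (Icc (-1) 1) := h1.continuous.continuousOn
  have hd : ContinuousOn (deriv φ) (Icc (-1) 1) :=
    (h1.continuous_deriv (by simp)).continuousOn
  have i1 := integrableOn_mul_continuousOn h.1.memM.integrableOn_weakDeriv hd
  have i2 : IntegrableOn (fun y => (M y * (M y ^ 2 - 1) - 2 * c * Q y * M y) / l * φ y)
    (Ioo (-1) 1) := integrableOn_Ioo_of_continuousOn (by fun_prop)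
  have e : ∫ y in Ioo (-1 : ℝ) 1, density₁ l c Q M (fun _ => 0) φ y =
      ∫ y in Ioo (-1 : ℝ) 1, (l * (weakDeriv M y * deriv φ y)
        + l * ((M y * (M y ^ 2 - 1) - 2 * c * Q y * M y) / l * φ y)) := by
    apply integral_congr_ae
    filter_upwards [weakDeriv_zero_ae_eq,
      weakDeriv_ae_eq_deriv (h1.of_le (by simp) : ContDiff ℝ 1 φ)] with y e1 e2
    simp only [density₁, e1, e2]
    field_simp
    ring
  rw [e, integral_add (i1.const_mul l) (i2.const_mul l), integral_const_mul,
    integral_const_mul, ← mul_add] at h0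
  have := (mul_eq_zero.mp h0).resolve_left hl.ne'
  linarith

/-- A `W^{1,2}` function whose weak second derivative is continuous is twice differentiable. -/
theorem exists_hasDerivAt_of_hasWeakDeriv_weakDeriv {u g : ℝ → ℝ} (hu : MemW12 u)
    (hg : ContinuousOn g (Icc (-1) 1)) (h : HasWeakDeriv (weakDeriv u) g) :
    ∃ U U' : ℝ → ℝ, EqOn u U (Icc (-1) 1) ∧ (∀ y, HasDerivAt U (U' y) y) ∧
      (∀ y ∈ Icc (-1 : ℝ) 1, HasDerivAt U' (g y) y) ∧
      weakDeriv u =ᵐ[volume.restrict (Ioo (-1) 1)] U' ∧ Continuous U' := by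
  have h11 : (-1 : ℝ) ≤ 1 := by norm_num
  -- A continuous extension of `g` to the line gives two-sided derivatives at the endpoints too.
  -- Integrating it twice recovers `u`, the constants `a` and `b` coming from the du Bois-Reymond
  -- lemma.
  set G : ℝ → ℝ := IccExtend h11 ((Icc (-1 : ℝ) 1).domRestrict g) with hG
  have Gc : Continuous G := (continuousOn_iff_continuous_domRestrict.mp hg).Icc_extend'
  have Gg : ∀ y ∈ Icc (-1 : ℝ) 1, G y = g y := fun y hy => by
    rw [hG, IccExtend_of_mem _ _ hy]; rfl
  set P : ℝ → ℝ := fun y => ∫ z in (-1 : ℝ)..y, G z with hP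
  have Pd : ∀ y, HasDerivAt P (G y) y := fun y =>
    intervalIntegral.integral_hasDerivAt_right (Gc.intervalIntegrable _ _)
      (Gc.stronglyMeasurableAtFilter _ _) Gc.continuousAt
  have Pc : Continuous P := continuous_iff_continuousAt.mpr fun y => (Pd y).continuousAt
  have Pw : HasWeakDeriv P g := hasWeakDeriv_of_hasDerivAt (s := ∅) countable_empty
    Pc.continuousOn (fun y hy => by
      rw [← Gg y (Ioo_subset_Icc_self hy.1)]; exact Pd y) (integrableOn_Ioo_of_continuousOn hg)
  have Pi := integrableOn_Ioo_of_continuousOn (Pc.continuousOn (s := Icc (-1) 1))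
  have gi := integrableOn_Ioo_of_continuousOn hg
  have w0 : HasWeakDeriv (fun y => weakDeriv u y + (-1) * P y) 0 := by
    have := h.add_const_mul Pw hu.integrableOn_weakDeriv Pi gi gi (-1)
    convert this using 1
    ext y; simp
  obtain ⟨a, ha⟩ := w0.ae_eq_const (hu.integrableOn_weakDeriv.add (Pi.const_mul _))
  set U' : ℝ → ℝ := fun y => P y + a with hU'
  have U'c : Continuous U' := Pc.add continuous_const
  have ha' : weakDeriv u =ᵐ[volume.restrict (Ioo (-1) 1)] U' := by
    filter_upwards [ha] with y hy
    simp only [hU']; linarith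
  set R : ℝ → ℝ := fun y => ∫ z in (-1 : ℝ)..y, U' z with hR
  have Rd : ∀ y, HasDerivAt R (U' y) y := fun y =>
    intervalIntegral.integral_hasDerivAt_right (U'c.intervalIntegrable _ _)
      (U'c.stronglyMeasurableAtFilter _ _) U'c.continuousAt
  have Rc : Continuous R := continuous_iff_continuousAt.mpr fun y => (Rd y).continuousAt
  have Ui := integrableOn_Ioo_of_continuousOn (U'c.continuousOn (s := Icc (-1) 1))
  have Rw : HasWeakDeriv R U' := hasWeakDeriv_of_hasDerivAt (s := ∅) countable_empty
    Rc.continuousOn (fun y _ => Rd y) Ui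
  have Ri := integrableOn_Ioo_of_continuousOn (Rc.continuousOn (s := Icc (-1) 1))
  have w1 : HasWeakDeriv (fun y => u y + (-1) * R y) 0 := by
    have := hu.hasWeakDeriv.add_const_mul Rw hu.integrableOn Ri hu.integrableOn_weakDeriv Ui (-1)
    intro φ h1 h2 h3
    rw [this φ h1 h2 h3]
    congr 1
    apply integral_congr_ae
    filter_upwards [ha'] with y hy
    simp [hy]
  obtain ⟨b, hb⟩ := w1.ae_eq_const (hu.integrableOn.add (Ri.const_mul _))
  refine ⟨fun y => R y + b, U', ?_, fun y => (Rd y).add_const b, fun y hy => ?_, ha', U'c⟩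
  · apply eqOn_Icc_of_ae_eq hu.continuousOn (Rc.add continuous_const).continuousOn
    filter_upwards [hb] with y hy
    change u y = R y + b
    linarith
  · rw [← Gg y hy]; exact (Pd y).add_const a

/-- The classical form of the Euler–Lagrange equations of an OR minimiser. -/
theorem IsORMinimiser.exists_classical (hl : 0 < l) (h : IsORMinimiser l c Q M) :
    ∃ U U' V V' : ℝ → ℝ, EqOn Q U (Icc (-1) 1) ∧ EqOn M V (Icc (-1) 1) ∧
      (∀ y, HasDerivAt U (U' y) y) ∧ (∀ y, HasDerivAt V (V' y) y) ∧
      (∀ y ∈ Icc (-1 : ℝ) 1, HasDerivAt U' ((4 * U y * (U y ^ 2 - 1) - c * V y ^ 2) / l) y) ∧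
      (∀ y ∈ Icc (-1 : ℝ) 1, HasDerivAt V' ((V y * (V y ^ 2 - 1) - 2 * c * U y * V y) / l) y) ∧
      weakDeriv Q =ᵐ[volume.restrict (Ioo (-1) 1)] U' ∧
      weakDeriv M =ᵐ[volume.restrict (Ioo (-1) 1)] V' ∧ Continuous U' ∧ Continuous V' := by
  have c1 := h.1.memQ.continuousOn
  have c2 := h.1.memM.continuousOn
  obtain ⟨U, U', hU, hUd, hUdd, hUw, hUc⟩ := exists_hasDerivAt_of_hasWeakDeriv_weakDeriv h.1.memQ
    (by fun_prop) (h.hasWeakDeriv_weakDeriv_Q hl)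
  obtain ⟨V, V', hV, hVd, hVdd, hVw, hVc⟩ := exists_hasDerivAt_of_hasWeakDeriv_weakDeriv h.1.memM
    (by fun_prop) (h.hasWeakDeriv_weakDeriv_M hl)
  refine ⟨U, U', V, V', hU, hV, hUd, hVd, fun y hy => ?_, fun y hy => ?_, hUw, hVw, hUc, hVc⟩
  · rw [← hU hy, ← hV hy]; exact hUdd y hy
  · rw [← hU hy, ← hV hy]; exact hVdd y hy

end Minimiser

/-! ### The maximum principle for the rescaled equations -/

/-- If `k > 0`, then `g'` vanishes at `s₀` and is positive just to its right, so `g` exceeds its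
maximum there. Differentiability of `g'` at the single point `s₀` is enough. -/
theorem second_deriv_nonpos_of_isMaxOn {g g' : ℝ → ℝ} {L s₀ k : ℝ} (hs : s₀ ∈ Ioo 0 L)
    (hg : ∀ s, HasDerivAt g (g' s) s) (hk : HasDerivAt g' k s₀)
    (hmax : ∀ s ∈ Icc 0 L, g s ≤ g s₀) : k ≤ 0 := by
  by_contra! hk0
  have hloc : IsLocalMax g s₀ := by
    filter_upwards [Ioo_mem_nhds hs.1 hs.2] with s h using hmax s (Ioo_subset_Icc_self h)
  have h0 : g' s₀ = 0 := hloc.hasDerivAt_eq_zero (hg s₀)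
  have hev : ∀ᶠ s in nhdsWithin s₀ (Ioi s₀), 0 < slope g' s₀ s :=
    ((hasDerivAt_iff_tendsto_slope.mp hk).eventually (lt_mem_nhds hk0)).filter_mono
      (nhdsWithin_mono _ fun x hx => ne_of_gt hx)
  obtain ⟨d, hd, hsub⟩ := (mem_nhdsGT_iff_exists_Ioo_subset' hs.2).mp
    (Filter.inter_mem hev (Ioo_mem_nhdsGT hs.2))
  have hd' : s₀ < d := hd
  have hmono : StrictMonoOn g (Icc s₀ ((s₀ + d) / 2)) := by
    apply strictMonoOn_of_deriv_pos (convex_Icc _ _)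
    · exact fun s _ => (hg s).continuousAt.continuousWithinAt
    · intro s h
      rw [interior_Icc] at h
      have h1 : 0 < slope g' s₀ s := (hsub ⟨h.1, by linarith [h.2]⟩).1
      rw [slope_def_field, h0, sub_zero] at h1
      rw [(hg s).deriv]
      exact (div_pos_iff_of_pos_right (sub_pos.mpr h.1)).mp h1
  have hm : (s₀ + (s₀ + d) / 2) / 2 ∈ Ioo s₀ d := ⟨by linarith, by linarith⟩
  have h2 := (hsub hm).2
  have := hmono ⟨le_rfl, by linarith⟩ (b := (s₀ + (s₀ + d) / 2) / 2)
    ⟨by linarith, by linarith⟩ (by linarith)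
  exact absurd (hmax _ ⟨by linarith [h2.1, hs.1], h2.2.le⟩) (not_le.mpr this)

/-- A positive maximum would be interior, where the second derivative cannot be positive. All
pointwise bounds on `X` and `Y` except the upper bound on `X` are instances of this principle. -/
theorem nonpos_of_second_deriv_pos {D D' D'' : ℝ → ℝ} {L : ℝ} (hL : 0 < L)
    (hD : ∀ s, HasDerivAt D (D' s) s) (hD' : ∀ s ∈ Icc 0 L, HasDerivAt D' (D'' s) s)
    (h0 : D 0 ≤ 0) (h1 : D L ≤ 0) (hpos : ∀ s ∈ Icc 0 L, 0 < D s → 0 < D'' s) :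
    ∀ s ∈ Icc 0 L, D s ≤ 0 := by
  obtain ⟨m, hm, hmax⟩ := isCompact_Icc.exists_isMaxOn (nonempty_Icc.mpr hL.le)
    (fun s _ => (hD s).continuousAt.continuousWithinAt : ContinuousOn D (Icc 0 L))
  by_contra! h
  obtain ⟨s, hs, hs0⟩ := h
  have hDm : 0 < D m := hs0.trans_le (hmax hs)
  have hmI : m ∈ Ioo 0 L := by
    refine ⟨lt_of_le_of_ne hm.1 ?_, lt_of_le_of_ne hm.2 ?_⟩
    · rintro rfl; linarith
    · rintro rfl; linarith
  exact absurd (second_deriv_nonpos_of_isMaxOn hmI hD (hD' m hm) fun s hs => hmax hs)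
    (not_le.mpr (hpos m hm hDm))

/-- The order reconstruction equations in the stretched variable `s = (1 - y) / √l`. -/
structure LayerSolution (c L : ℝ) (X X' Y Y' : ℝ → ℝ) : Prop where
  L_pos : 0 < L
  hX : ∀ s, HasDerivAt X (X' s) s
  hY : ∀ s, HasDerivAt Y (Y' s) s
  hX' : ∀ s ∈ Icc 0 L, HasDerivAt X' (4 * X s * (X s ^ 2 - 1) - c * Y s ^ 2) s
  hY' : ∀ s ∈ Icc 0 L, HasDerivAt Y' (Y s * (Y s ^ 2 - 1) - 2 * c * X s * Y s) s
  X_zero : X 0 = -1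
  Y_zero : Y 0 = -1
  X_L : X L = 1
  Y_L : Y L = 1

/-! ### A priori bounds in the stretched layer -/

namespace LayerSolution

variable {c L : ℝ} {X X' Y Y' : ℝ → ℝ}

theorem continuous_X (h : LayerSolution c L X X' Y Y') : Continuous X :=
  continuous_iff_continuousAt.mpr fun s => (h.hX s).continuousAt

theorem continuous_Y (h : LayerSolution c L X X' Y Y') : Continuous Y :=
  continuous_iff_continuousAt.mpr fun s => (h.hY s).continuousAt

theorem neg_one_le_X (h : LayerSolution c L X X' Y Y') (hc : 0 < c) :
    ∀ s ∈ Icc 0 L, -1 ≤ X s := by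
  have := nonpos_of_second_deriv_pos (D := fun s => -1 - X s) (D' := fun s => -X' s)
    (D'' := fun s => -(4 * X s * (X s ^ 2 - 1) - c * Y s ^ 2)) h.L_pos
    (fun s => (h.hX s).const_sub _) (fun s hs => (h.hX' s hs).neg)
    (by simp [h.X_zero]) (by norm_num [h.X_L]) (by
      intro s _ hs
      have h1 : 0 ≤ c * Y s ^ 2 := by positivity
      have h2 : 0 < (-X s) * ((-1 - X s) * (1 - X s)) := by
        apply mul_pos (by linarith) (mul_pos hs (by linarith))
      nlinarith)
  intro s hs
  have := this s hs
  linarith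

/-- `(Y²)'' = 2 Y'² + 2 Y² (Y² - 1 - 2cX)` is positive wherever `Y²` exceeds the bound. -/
theorem sq_Y_le_of_X_le (h : LayerSolution c L X X' Y Y') (hc : 0 < c) {ρ : ℝ} (hρ : 0 ≤ ρ)
    (hX : ∀ s ∈ Icc 0 L, X s ≤ ρ) : ∀ s ∈ Icc 0 L, Y s ^ 2 ≤ 1 + 2 * c * ρ := by
  have h0 : 0 ≤ c * ρ := by positivity
  have := nonpos_of_second_deriv_pos (D := fun s => Y s ^ 2 - (1 + 2 * c * ρ))
    (D' := fun s => 2 * (Y s * Y' s))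
    (D'' := fun s => 2 * (Y' s * Y' s + Y s * (Y s * (Y s ^ 2 - 1) - 2 * c * X s * Y s)))
    h.L_pos (fun s => (((h.hY s).pow 2).sub_const _).congr_deriv (by simp; ring))
    (fun s hs => ((h.hY s).mul (h.hY' s hs)).const_mul 2)
    (by simp [h.Y_zero]; linarith) (by simp [h.Y_L]; linarith) (by
      intro s hs hpos
      have h1 : c * X s ≤ c * ρ := mul_le_mul_of_nonneg_left (hX s hs) hc.le
      have h2 : 0 < Y s ^ 2 * (Y s ^ 2 - 1 - 2 * c * X s) :=
        mul_pos (by linarith) (by linarith)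
      nlinarith [mul_self_nonneg (Y' s)])
  intro s hs
  have := this s hs
  linarith

/-- At an interior maximum `ρ` of `X`, the sign of `X''` and the bound `Y² ≤ 1 + 2cρ` give `4ρ(ρ² -
1) ≤ c(1 + 2cρ)`. With `ρ = 1 + w` this fails once `w > 18c/25`, since `4w² > 2c²` then; `18/25` is
slightly more than `1/√2`. -/
theorem X_le (h : LayerSolution c L X X' Y Y') (hc : 0 < c) :
    ∀ s ∈ Icc 0 L, X s ≤ 1 + 18 / 25 * c := by
  obtain ⟨m, hm, hmax⟩ := isCompact_Icc.exists_isMaxOn (nonempty_Icc.mpr h.L_pos.le)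
    (h.continuous_X.continuousOn (s := Icc 0 L))
  by_contra! hcon
  obtain ⟨s, hs, hs1⟩ := hcon
  have hXm : 1 + 18 / 25 * c < X m := hs1.trans_le (hmax hs)
  have hmI : m ∈ Ioo 0 L := by
    refine ⟨lt_of_le_of_ne hm.1 ?_, lt_of_le_of_ne hm.2 ?_⟩
    · rintro rfl; linarith [h.X_zero]
    · rintro rfl; linarith [h.X_L]
  have hk := second_deriv_nonpos_of_isMaxOn hmI h.hX (h.hX' m hm) fun s hs => hmax hs
  have hY := h.sq_Y_le_of_X_le hc (ρ := X m) (by linarith) (fun s hs => hmax hs) m hm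
  have h1 : c * Y m ^ 2 ≤ c * (1 + 2 * c * X m) := mul_le_mul_of_nonneg_left hY hc.le
  obtain ⟨w, hw⟩ : ∃ w, w = X m - 1 := ⟨_, rfl⟩
  have hXw : X m = 1 + w := by linarith
  rw [hXw] at hk h1 hXm
  have h2 : 18 / 25 * c < w := by linarith
  have h3 : (18 / 25 * c) ^ 2 ≤ w ^ 2 := by gcongr
  have h4 : 0 ≤ (1 + w) * (4 * w ^ 2 - 2 * c ^ 2) :=
    mul_nonneg (by nlinarith) (by nlinarith [sq_nonneg c])
  nlinarith [mul_pos hc (show 0 < w by nlinarith), sq_nonneg w]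

theorem sq_Y_le (h : LayerSolution c L X X' Y Y') (hc : 0 < c) :
    ∀ s ∈ Icc 0 L, Y s ^ 2 ≤ 1 + 2 * c * (1 + 18 / 25 * c) :=
  h.sq_Y_le_of_X_le hc (by positivity) (h.X_le hc)

/-- The maximum principle for `σY - (1 + κ(1 + X))`, `σ = ±1`: the polynomial in `hpoly` is its
second derivative with `N = σY`. The barrier is exact at the wall, where `X = Y = -1`. -/
theorem barrier_of_polynomial (h : LayerSolution c L X X' Y Y') {κ : ℝ} (hκ : 0 ≤ κ)
    (hpoly : ∀ s ∈ Icc 0 L, ∀ N : ℝ, 1 + κ * (1 + X s) < N → 0 <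
      N * (N ^ 2 - 1) - 2 * c * X s * N - κ * (4 * X s * (X s ^ 2 - 1) - c * N ^ 2)) :
    ∀ s ∈ Icc 0 L, |Y s| ≤ 1 + κ * (1 + X s) := by
  have key : ∀ σ : ℝ, σ = 1 ∨ σ = -1 → ∀ s ∈ Icc 0 L, σ * Y s - (1 + κ * (1 + X s)) ≤ 0 := by
    intro σ hσ
    have hσ2 : σ ^ 2 = 1 := by rcases hσ with rfl | rfl <;> norm_num
    apply nonpos_of_second_deriv_pos (D' := fun s => σ * Y' s - κ * X' s)
      (D'' := fun s => σ * (Y s * (Y s ^ 2 - 1) - 2 * c * X s * Y s) -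
        κ * (4 * X s * (X s ^ 2 - 1) - c * Y s ^ 2)) h.L_pos
    · exact fun s => ((h.hY s).const_mul σ).sub ((((h.hX s).const_add 1).const_mul κ).const_add 1)
    · exact fun s hs => ((h.hY' s hs).const_mul σ).sub ((h.hX' s hs).const_mul κ)
    · rw [h.X_zero, h.Y_zero]; rcases hσ with rfl | rfl <;> norm_num
    · rw [h.X_L, h.Y_L]; rcases hσ with rfl | rfl <;> linarith
    · intro s hs hpos
      have := hpoly s hs (σ * Y s) (by linarith)
      have e : (σ * Y s) ^ 2 = Y s ^ 2 := by rw [mul_pow, hσ2, one_mul]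
      rw [e] at this
      linarith
  intro s hs
  rw [abs_le]
  have h1 := key 1 (Or.inl rfl) s hs
  have h2 := key (-1) (Or.inr rfl) s hs
  constructor <;> linarith

/-- With `w = 1 + X` and `N = 1 + 3w/2 + d`, the polynomial is positive on the barrier `d = 0` (this
is `base`) and does not decrease with `d`. The cubic term `-21w³/8` is controlled through `w ≤ 2 +
18c/25 ≤ 338/25`, which is where `c ≤ 16` enters. -/
theorem barrier_three_halves (h : LayerSolution c L X X' Y Y') (hc : 1 / 4 ≤ c) (hc' : c ≤ 16) :
    ∀ s ∈ Icc 0 L, |Y s| ≤ 1 + 3 / 2 * (1 + X s) := by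
  apply h.barrier_of_polynomial (by norm_num)
  intro s hs N hN
  have hc0 : 0 < c := by linarith
  have h1 := h.neg_one_le_X hc0 s hs
  have h2 := h.X_le hc0 s hs
  obtain ⟨w, hw⟩ : ∃ w, w = 1 + X s := ⟨_, rfl⟩
  have hXw : X s = w - 1 := by linarith
  rw [hXw] at h1 h2 hN ⊢
  have hw0 : 0 ≤ w := by linarith
  obtain ⟨d, hd⟩ : ∃ d, d = N - (1 + 3 / 2 * w) := ⟨_, rfl⟩
  have hd0 : 0 < d := by linarith
  rw [show N = 1 + 3 / 2 * w + d by linarith]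
  have base : 0 < c * (7 / 2 + 11 / 2 * w + 3 / 8 * w ^ 2) - 9 * w + 99 / 4 * w ^ 2
      - 21 / 8 * w ^ 3 := by
    rcases le_total w 2 with h3 | h3
    · have e1 : 0 ≤ w ^ 2 * (2 - w) := mul_nonneg (sq_nonneg w) (by linarith)
      have e2 : 0 ≤ (c - 1 / 4) * (7 / 2 + 11 / 2 * w + 3 / 8 * w ^ 2) :=
        mul_nonneg (by linarith) (by positivity)
      nlinarith [sq_nonneg (w - 1 / 5)]
    · have e1 : 0 ≤ (c - 25 / 18 * (w - 2)) * (11 / 2 * w + 3 / 8 * w ^ 2) :=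
        mul_nonneg (by linarith) (by positivity)
      have e2 : 0 ≤ w ^ 2 * (338 / 25 - w) := mul_nonneg (sq_nonneg w) (by linarith)
      nlinarith [mul_nonneg hw0 (sub_nonneg.mpr h3)]
  have hcw : 0 ≤ c * w := by positivity
  have hcd : 0 ≤ c * d := by positivity
  have hinc : 0 ≤ (1 + 3 / 2 * w + d) * ((1 + 3 / 2 * w + d) ^ 2 - 1)
      - (1 + 3 / 2 * w) * ((1 + 3 / 2 * w) ^ 2 - 1) := by
    rw [show (1 + 3 / 2 * w + d) * ((1 + 3 / 2 * w + d) ^ 2 - 1)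
      - (1 + 3 / 2 * w) * ((1 + 3 / 2 * w) ^ 2 - 1) = d * (2 + 9 * w + 27 / 4 * w ^ 2
        + 3 * d + 9 / 2 * w * d + d ^ 2) by ring]
    positivity
  have hinc2 : 0 ≤ c * d * (5 + 5 / 2 * w + 3 / 2 * d) := by positivity
  nlinarith

/-- The steeper slope makes the coefficient of `c w²` large enough to absorb the negative cubic term
through `c ≥ 25(w - 2)/18` alone, so no upper bound on `c` is needed. -/
theorem barrier_seventeen_tenths (h : LayerSolution c L X X' Y Y') (hc : 16 ≤ c) :
    ∀ s ∈ Icc 0 L, |Y s| ≤ 1 + 17 / 10 * (1 + X s) := by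
  apply h.barrier_of_polynomial (by norm_num)
  intro s hs N hN
  have hc0 : 0 < c := by linarith
  have h1 := h.neg_one_le_X hc0 s hs
  have h2 := h.X_le hc0 s hs
  obtain ⟨w, hw⟩ : ∃ w, w = 1 + X s := ⟨_, rfl⟩
  have hXw : X s = w - 1 := by linarith
  rw [hXw] at h1 h2 hN ⊢
  have hw0 : 0 ≤ w := by linarith
  obtain ⟨d, hd⟩ : ∃ d, d = N - (1 + 17 / 10 * w) := ⟨_, rfl⟩
  have hd0 : 0 < d := by linarith
  rw [show N = 1 + 17 / 10 * w + d by linarith]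
  have base : 0 < c * (37 / 10 + 359 / 50 * w + 1513 / 1000 * w ^ 2) - 51 / 5 * w
      + 2907 / 100 * w ^ 2 - 1887 / 1000 * w ^ 3 := by
    have e1 : 0 ≤ (c - 25 / 18 * (w - 2)) * w ^ 2 :=
      mul_nonneg (by linarith) (by positivity)
    have e2 : 0 ≤ (c - 16) * w := mul_nonneg (by linarith) hw0
    have e3 : 0 ≤ w ^ 3 := by positivity
    nlinarith [sq_nonneg w]
  have hcw : 0 ≤ c * w := by positivity
  have hcd : 0 ≤ c * d := by positivity
  have hinc : 0 ≤ (1 + 17 / 10 * w + d) * ((1 + 17 / 10 * w + d) ^ 2 - 1)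
      - (1 + 17 / 10 * w) * ((1 + 17 / 10 * w) ^ 2 - 1) := by
    rw [show (1 + 17 / 10 * w + d) * ((1 + 17 / 10 * w + d) ^ 2 - 1)
      - (1 + 17 / 10 * w) * ((1 + 17 / 10 * w) ^ 2 - 1) = d * (2 + 51 / 5 * w
        + 867 / 100 * w ^ 2 + 3 * d + 51 / 10 * w * d + d ^ 2) by ring]
    positivity
  have hinc2 : 0 ≤ c * d * (27 / 5 + 189 / 50 * w + 17 / 10 * d) := by positivity
  nlinarith

/-- A bound for `|X'(0)|` that depends only on the coupling constant. -/
theorem abs_deriv_zero_le (h : LayerSolution c L X X' Y Y') (hc : 0 < c) (hL : 1 ≤ L) :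
    |X' 0| ≤ 2 + 18 / 25 * c + (4 * (1 + 18 / 25 * c) * (1 + (1 + 18 / 25 * c) ^ 2)
      + c * (1 + 2 * c * (1 + 18 / 25 * c))) := by
  -- On `[0, 1]` the bounds on `X` make `X'` bounded at some point `ξ`, and the equation bounds
  -- `X''` between `0` and `ξ`.
  obtain ⟨ξ, hξ, hξ'⟩ := exists_hasDerivAt_eq_slope X X' (by norm_num : (0 : ℝ) < 1)
    h.continuous_X.continuousOn (fun s _ => h.hX s)
  have hξL : ξ ∈ Icc 0 L := ⟨hξ.1.le, by linarith [hξ.2]⟩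
  set ρ := 1 + 18 / 25 * c with hρ
  set B := 4 * ρ * (1 + ρ ^ 2) + c * (1 + 2 * c * ρ) with hB
  have hρ1 : 1 ≤ ρ := by rw [hρ]; linarith
  have hbound : ∀ s ∈ Icc 0 ξ, ‖4 * X s * (X s ^ 2 - 1) - c * Y s ^ 2‖ ≤ B := by
    intro s hs
    have hsL : s ∈ Icc 0 L := ⟨hs.1, hs.2.trans hξL.2⟩
    have h1 : |X s| ≤ ρ := abs_le.mpr ⟨by linarith [h.neg_one_le_X hc s hsL], h.X_le hc s hsL⟩
    have h2 : X s ^ 2 ≤ ρ ^ 2 := sq_le_sq' (abs_le.mp h1).1 (abs_le.mp h1).2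
    have h3 : |X s ^ 2 - 1| ≤ 1 + ρ ^ 2 :=
      abs_le.mpr ⟨by nlinarith [sq_nonneg (X s), sq_nonneg ρ], by linarith⟩
    rw [Real.norm_eq_abs]
    refine (abs_sub _ _).trans (add_le_add ?_ ?_)
    · rw [abs_mul, abs_mul, abs_of_pos (by norm_num : (0 : ℝ) < 4)]
      gcongr
    · rw [abs_of_nonneg (by positivity)]
      gcongr
      exact h.sq_Y_le hc s hsL
  have hmv := (convex_Icc (0 : ℝ) ξ).norm_image_sub_le_of_norm_hasDerivWithin_le
    (fun s hs => (h.hX' s ⟨hs.1, hs.2.trans hξL.2⟩).hasDerivWithinAt) hbound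
    (right_mem_Icc.mpr hξ.1.le) (left_mem_Icc.mpr hξ.1.le)
  have hB0 : 0 ≤ B := by rw [hB]; positivity
  have hslope : |X' ξ| ≤ 2 + 18 / 25 * c := by
    rw [hξ', h.X_zero]
    have h1L : (1 : ℝ) ∈ Icc 0 L := ⟨by norm_num, hL⟩
    have := h.neg_one_le_X hc 1 h1L
    have := h.X_le hc 1 h1L
    rw [abs_le]; constructor <;> linarith
  have h3 : |X' 0 - X' ξ| ≤ B := by
    have : ‖(0 : ℝ) - ξ‖ ≤ 1 := by
      rw [Real.norm_eq_abs, abs_le]; constructor <;> linarith [hξ.1, hξ.2]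
    calc |X' 0 - X' ξ| ≤ B * ‖(0 : ℝ) - ξ‖ := hmv
      _ ≤ B * 1 := by gcongr
      _ = B := mul_one B
  have := abs_sub_abs_le_abs_sub (X' 0) (X' ξ)
  linarith

theorem energy_conserved (h : LayerSolution c L X X' Y Y') {s t : ℝ} (hs : s ∈ Icc 0 L)
    (ht : t ∈ Icc 0 L) :
    (X' s ^ 2 + Y' s ^ 2) / 2 - ((X s ^ 2 - 1) ^ 2 + (Y s ^ 2 - 1) ^ 2 / 4 - c * X s * Y s ^ 2) =
      (X' t ^ 2 + Y' t ^ 2) / 2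
        - ((X t ^ 2 - 1) ^ 2 + (Y t ^ 2 - 1) ^ 2 / 4 - c * X t * Y t ^ 2) := by
  have hd : ∀ r ∈ Icc 0 L, HasDerivWithinAt (fun r => (X' r ^ 2 + Y' r ^ 2) / 2
      - ((X r ^ 2 - 1) ^ 2 + (Y r ^ 2 - 1) ^ 2 / 4 - c * X r * Y r ^ 2)) 0 (Icc 0 L) r := by
    intro r hr
    have h1 := ((h.hX' r hr).pow 2).add ((h.hY' r hr).pow 2)
    have h2 := (((h.hX r).pow 2).sub_const 1).pow 2
    have h3 := ((((h.hY r).pow 2).sub_const 1).pow 2).div_const 4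
    have h4 := ((h.hX r).const_mul c).mul ((h.hY r).pow 2)
    refine HasDerivAt.hasDerivWithinAt (((h1.div_const 2).sub ((h2.add h3).sub h4)).congr_deriv ?_)
    simp
    ring
  have := (convex_Icc (0 : ℝ) L).norm_image_sub_le_of_norm_hasDerivWithin_le (C := 0) hd
    (fun _ _ => by simp) ht hs
  have := norm_le_zero_iff.mp (this.trans_eq (zero_mul _))
  linarith

end LayerSolution

/-! ### The layer integral for coupling up to 16 -/

theorem integral_le_sub_of_le_deriv {φ g g' : ℝ → ℝ} {a b : ℝ} (hab : a ≤ b)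
    (hφ : ContinuousOn φ (Icc a b)) (hg : ContinuousOn g (Icc a b))
    (hg' : ∀ s ∈ Ioo a b, HasDerivAt g (g' s) s) (hle : ∀ s ∈ Ioo a b, φ s ≤ g' s) :
    ∫ s in a..b, φ s ≤ g b - g a :=
  intervalIntegral.integral_le_sub_of_hasDeriv_right_of_le hab hg
    (fun s hs => (hg' s hs).hasDerivWithinAt) hφ.integrableOn_Icc hle

/-- The elementary inequality that balances the gain and the loss in the layer. -/
theorem sqrt_sub_mul_le {x z a : ℝ} (hx : 0 ≤ x) (hz : x ≤ z) (ha : 8 ≤ a)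
    (hza : z ^ 2 ≤ x ^ 2 + 2 * a) : (z - x) * Real.sqrt (x ^ 2 + 2) ≤ a := by
  set w := Real.sqrt (x ^ 2 + 2)
  have hw0 : 0 ≤ w := Real.sqrt_nonneg _
  have hw2 : w ^ 2 = x ^ 2 + 2 := Real.sq_sqrt (by positivity)
  by_contra! hcon
  have hzx : 0 < z - x := by
    -- If `z + x ≥ 2w`, then `(z - x)(z + x) ≤ 2a` already gives the claim. Otherwise `z - x < 2(w -
    -- x)`, and `(w - x) w ≤ 2` leaves `(z - x) w ≤ 4`, below `a`.
    by_contra! h0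
    nlinarith
  have h1 : (z - x) * (z + x) ≤ 2 * a := by nlinarith
  have h2 : z + x < 2 * w := by
    by_contra! h
    nlinarith
  have h3 : (z - x) ^ 2 * w ^ 2 > a ^ 2 := by
    rw [← mul_pow]; exact pow_lt_pow_left₀ hcon (by linarith) two_ne_zero
  have h4 : z - x ≤ 2 * (w - x) := by linarith
  have h5 : (w - x) * w ≤ 2 := by nlinarith
  nlinarith

namespace LayerSolution

variable {c L : ℝ} {X X' Y Y' : ℝ → ℝ}

/-- The energy of the first equation alone. It decreases as long as `X` increases. -/
theorem hasDerivAt_energy (h : LayerSolution c L X X' Y Y') {s : ℝ} (hs : s ∈ Icc 0 L) :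
    HasDerivAt (fun s => X' s ^ 2 / 2 - (1 - X s ^ 2) ^ 2) (-(c * Y s ^ 2 * X' s)) s := by
  have h1 := ((h.hX' s hs).pow 2).div_const 2
  have h2 := (((h.hX s).pow 2).const_sub 1).pow 2
  refine (h1.sub h2).congr_deriv ?_
  simp
  ring

/-- The energy of the first equation decreases to a nonnegative value at `S`. If it were not
positive at `a`, it would vanish on `[a, S]`, forcing `Y = 0` there. The conserved total energy
would then be `-1/4`, while at `L`, where `X = Y = 1`, it is at least `c`. -/
theorem energy_pos_of_deriv_pos (h : LayerSolution c L X X' Y Y') (hc : 0 < c) {a S : ℝ}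
    (ha : 0 ≤ a) (haS : a < S) (hSL : S ≤ L) (hXS : X S = 1) (hpos : ∀ s ∈ Ioo a S, 0 < X' s) :
    0 < X' a ^ 2 / 2 - (1 - X a ^ 2) ^ 2 := by
  set e : ℝ → ℝ := fun s => X' s ^ 2 / 2 - (1 - X s ^ 2) ^ 2 with he
  have hsub : ∀ s ∈ Icc a S, s ∈ Icc 0 L := fun s hs => ⟨ha.trans hs.1, hs.2.trans hSL⟩
  have hd : ∀ s ∈ Icc a S, HasDerivAt e (-(c * Y s ^ 2 * X' s)) s := fun s hs =>
    h.hasDerivAt_energy (hsub s hs)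
  have hanti : AntitoneOn e (Icc a S) := by
    apply antitoneOn_of_deriv_nonpos (convex_Icc _ _)
    · exact fun s hs => (hd s hs).continuousAt.continuousWithinAt
    · exact fun s hs => (hd s (interior_subset hs)).differentiableAt.differentiableWithinAt
    · intro s hs
      rw [(hd s (interior_subset hs)).deriv]
      rw [interior_Icc] at hs
      have := hpos s hs
      have : 0 ≤ c * Y s ^ 2 * X' s := by positivity
      linarith
  have heS : 0 ≤ e S := by simp only [he, hXS]; norm_num; positivity
  by_contra! hcon
  change e a ≤ 0 at hcon
  have hzero : ∀ s ∈ Icc a S, e s = 0 := fun s hs => le_antisymm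
    ((hanti (left_mem_Icc.mpr haS.le) hs hs.1).trans hcon)
    (heS.trans (hanti hs (right_mem_Icc.mpr haS.le) hs.2))
  have hY0 : ∀ s ∈ Ioo a S, Y s = 0 := by
    intro s hs
    have h1 : HasDerivAt e 0 s := (hasDerivAt_const s (0 : ℝ)).congr_of_eventuallyEq (by
      filter_upwards [Ioo_mem_nhds hs.1 hs.2] with r hr using hzero r (Ioo_subset_Icc_self hr))
    have h2 := (hd s (Ioo_subset_Icc_self hs)).unique h1
    have h3 := hpos s hs
    have h4 : c * Y s ^ 2 * X' s = 0 := by linarith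
    simpa [hc.ne', h3.ne'] using h4
  set m := (a + S) / 2
  have hm : m ∈ Ioo a S := ⟨by simp only [m]; linarith, by simp only [m]; linarith⟩
  have hY'0 : Y' m = 0 := (h.hY m).unique <| (hasDerivAt_const m (0 : ℝ)).congr_of_eventuallyEq (by
      filter_upwards [Ioo_mem_nhds hm.1 hm.2] with r hr using hY0 r hr)
  have hcons := h.energy_conserved (hsub m (Ioo_subset_Icc_self hm))
    (right_mem_Icc.mpr h.L_pos.le)
  have hem : X' m ^ 2 / 2 - (1 - X m ^ 2) ^ 2 = 0 := hzero m (Ioo_subset_Icc_self hm)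
  rw [hY'0, hY0 m hm, h.X_L, h.Y_L] at hcons
  nlinarith [sq_nonneg (X' L), sq_nonneg (Y' L)]

/-- Just before `S` the function `X` is concave, so `X' > 0` there. At the last earlier point with
`X' ≤ 0` one would have `X' = 0`, hence a nonpositive energy of the first equation, against
`energy_pos_of_deriv_pos`. -/
theorem deriv_pos_of_lt_one (h : LayerSolution c L X X' Y Y') (hc : 0 < c) {S : ℝ}
    (hS : 0 < S) (hSL : S ≤ L) (hXS : X S = 1) (hlt : ∀ s ∈ Ico 0 S, X s < 1) :
    ∀ s ∈ Ico 0 S, 0 < X' s := by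
  have hX'c : ContinuousOn X' (Icc 0 L) := fun s hs =>
    (h.hX' s hs).continuousAt.continuousWithinAt
  have hX'S : 0 ≤ X' S := by
    by_contra! hneg
    have hev : ∀ᶠ s in nhdsWithin S (Iio S), slope X S s < 0 :=
      ((hasDerivAt_iff_tendsto_slope.mp (h.hX S)).eventually (gt_mem_nhds hneg)).filter_mono
        (nhdsWithin_mono _ fun x hx => ne_of_lt hx)
    obtain ⟨s, hs1, hs2, hs3⟩ := (hev.and (Ioo_mem_nhdsLT hS)).exists
    rw [slope_def_field, hXS] at hs1
    have h1 := hlt s ⟨hs2.le, hs3⟩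
    have := div_pos_of_neg_of_neg (sub_neg.mpr h1) (sub_neg.mpr hs3)
    linarith
  obtain ⟨r, hr, hrsub⟩ : ∃ r ∈ Ioo 0 S, ∀ s ∈ Icc r S, 0 < X s := by
    have hev : ∀ᶠ s in nhdsWithin S (Iio S), 0 < X s :=
      (h.continuous_X.continuousAt.eventually (lt_mem_nhds (by rw [hXS]; norm_num))).filter_mono
        nhdsWithin_le_nhds
    obtain ⟨d, hd, hsub⟩ := (mem_nhdsLT_iff_exists_Ioo_subset' hS).mp
      (Filter.inter_mem hev (Ioo_mem_nhdsLT hS))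
    have hd' : d < S := hd
    refine ⟨(d + S) / 2, ?_, fun s hs => ?_⟩
    · exact (hsub (a := (d + S) / 2) ⟨by linarith, by linarith⟩).2
    · rcases hs.2.eq_or_lt with rfl | h2
      · rw [hXS]; norm_num
      · exact (hsub (a := s) ⟨by linarith [hs.1], h2⟩).1
  have hanti : StrictAntiOn X' (Icc r S) := by
    apply strictAntiOn_of_deriv_neg (convex_Icc _ _)
    · exact hX'c.mono (Icc_subset_Icc hr.1.le hSL)
    · intro s hs
      rw [interior_Icc] at hs
      rw [(h.hX' s ⟨hr.1.le.trans hs.1.le, hs.2.le.trans hSL⟩).deriv]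
      have h1 := hlt s ⟨hr.1.le.trans hs.1.le, hs.2⟩
      have h2 := hrsub s (Ioo_subset_Icc_self hs)
      have h3 : 0 < X s * ((1 - X s) * (1 + X s)) :=
        mul_pos h2 (mul_pos (by linarith) (by linarith))
      have h4 : 0 ≤ c * Y s ^ 2 := by positivity
      nlinarith
  have hnear : ∀ s ∈ Ico r S, 0 < X' s := fun s hs =>
    hX'S.trans_lt (hanti ⟨hs.1, hs.2.le⟩ (right_mem_Icc.mpr hr.2.le) hs.2)
  by_contra! hcon
  obtain ⟨s₁, hs₁, hs₁'⟩ := hcon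
  have hs₁r : s₁ < r := by
    by_contra! h1
    exact absurd (hnear s₁ ⟨h1, hs₁.2⟩) (not_lt.mpr hs₁')
  have hcomp : IsCompact (Icc s₁ r ∩ X' ⁻¹' Iic 0) := by
    apply IsCompact.of_isClosed_subset isCompact_Icc _ inter_subset_left
    exact (hX'c.mono (Icc_subset_Icc hs₁.1 (hr.2.le.trans hSL))).preimage_isClosed_of_isClosed
      isClosed_Icc isClosed_Iic
  obtain ⟨a, ⟨haI, ha0⟩, hamax⟩ := hcomp.exists_isGreatest ⟨s₁, ⟨le_rfl, hs₁r.le⟩, hs₁'⟩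
  have har : a < r := lt_of_le_of_ne haI.2 (by
    rintro rfl
    exact absurd (hnear a ⟨le_rfl, hr.2⟩) (not_lt.mpr ha0))
  have haS : a < S := har.trans hr.2
  have hpos : ∀ s ∈ Ioo a S, 0 < X' s := by
    intro s hs
    rcases lt_or_ge s r with h1 | h1
    · by_contra! h2
      exact absurd (hamax ⟨⟨haI.1.trans hs.1.le, h1.le⟩, h2⟩) (not_le.mpr hs.1)
    · exact hnear s ⟨h1, hs.2⟩
  have hX'a : X' a = 0 := by
    refine le_antisymm ha0 ?_
    have hcw : ContinuousWithinAt X' (Ioi a) a :=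
      (h.hX' a ⟨hs₁.1.trans haI.1, haS.le.trans hSL⟩).continuousAt.continuousWithinAt
    exact ge_of_tendsto hcw (by
      filter_upwards [Ioo_mem_nhdsGT haS] with s hs using (hpos s hs).le)
  have := h.energy_pos_of_deriv_pos hc (hs₁.1.trans haI.1) haS hSL hXS hpos
  rw [hX'a] at this
  nlinarith [sq_nonneg (1 - X a ^ 2)]

/-- The layer integral is bounded away from zero, in terms of one-variable data. Here `vs` is the
level of `1 + X` at which the coupling term changes its sign. -/
theorem layer_integral_le (h : LayerSolution c L X X' Y Y') (hc : 0 < c) {S : ℝ}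
    (hS : 0 < S) (hSL : S ≤ L) (hXS : X S = 1) (hlt : ∀ s ∈ Ico 0 S, X s < 1)
    {Ψ N n nn g G : ℝ → ℝ} {p vs a I : ℝ} (hvs : vs ∈ Ioo (0 : ℝ) 2) (hp : 0 ≤ p) (ha : 8 ≤ a)
    (hΨc : ContinuousOn Ψ (Icc 0 2)) (hNc : ContinuousOn N (Icc 0 2))
    (hN : ∀ v ∈ Icc (0 : ℝ) 2, 0 ≤ N v) (hΨp : ∀ v ∈ Icc 0 vs, Ψ v ≤ p)
    (hΨ0 : ∀ v ∈ Icc vs 2, Ψ v ≤ 0) (hn0 : ∀ v ∈ Icc vs 2, 0 ≤ n v)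
    (hnN : ∀ v ∈ Icc vs 2, n v ≤ N v) (hnn : ∀ v, HasDerivAt nn (n v) v)
    (hI : I ≤ nn 2 - nn vs) (hG : ∀ v, HasDerivAt G (g v) v) (hGa : G vs - G 0 ≤ a)
    (hYg : ∀ s ∈ Icc 0 L, c * Y s ^ 2 ≤ g (1 + X s)) (hpI : p * a ≤ I) :
    ∫ s in (0 : ℝ)..S, (-N (1 + X s) + c * Y s ^ 2 * Ψ (1 + X s)) ≤
      -(I - p * a) / Real.sqrt (X' 0 ^ 2 + 2) := by
  have hX'pos := h.deriv_pos_of_lt_one hc hS hSL hXS hlt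
  set e : ℝ → ℝ := fun s => X' s ^ 2 / 2 - (1 - X s ^ 2) ^ 2 with he
  have hsub : ∀ s ∈ Icc 0 S, s ∈ Icc 0 L := fun s hs => ⟨hs.1, hs.2.trans hSL⟩
  have hd : ∀ s ∈ Icc 0 S, HasDerivAt e (-(c * Y s ^ 2 * X' s)) s := fun s hs =>
    h.hasDerivAt_energy (hsub s hs)
  have hec : ContinuousOn e (Icc 0 S) := fun s hs => (hd s hs).continuousAt.continuousWithinAt
  have hepos : ∀ s ∈ Ico 0 S, 0 < e s := fun s hs =>
    h.energy_pos_of_deriv_pos hc hs.1 hs.2 hSL hXS fun r hr => hX'pos r ⟨hs.1.trans hr.1.le, hr.2⟩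
  have hanti : AntitoneOn e (Icc 0 S) := by
    apply antitoneOn_of_deriv_nonpos (convex_Icc _ _) hec
    · exact fun s hs => (hd s (interior_subset hs)).differentiableAt.differentiableWithinAt
    · intro s hs
      rw [(hd s (interior_subset hs)).deriv]
      rw [interior_Icc] at hs
      have := hX'pos s ⟨hs.1.le, hs.2⟩
      have : 0 ≤ c * Y s ^ 2 * X' s := by positivity
      linarith
  have hXmono : StrictMonoOn X (Icc 0 S) := by
    apply strictMonoOn_of_deriv_pos (convex_Icc _ _) h.continuous_X.continuousOn
    intro s hs
    rw [interior_Icc] at hs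
    rw [(h.hX s).deriv]
    exact hX'pos s ⟨hs.1.le, hs.2⟩
  have hX1 : ∀ s ∈ Icc 0 S, 1 + X s ∈ Icc (0 : ℝ) 2 := by
    intro s hs
    have h1 := h.neg_one_le_X hc s (hsub s hs)
    have h2 := hXmono.monotoneOn hs (right_mem_Icc.mpr hS.le) hs.2
    rw [hXS] at h2
    exact ⟨by linarith, by linarith⟩
  obtain ⟨t, ht, htv⟩ : ∃ t ∈ Ioo 0 S, 1 + X t = vs := by
    have := intermediate_value_Ioo hS.le (f := fun s => 1 + X s)
      (continuous_const.add h.continuous_X).continuousOn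
    obtain ⟨t, ht, htv⟩ := this (show vs ∈ Ioo (1 + X 0) (1 + X S) by
      rw [h.X_zero, hXS]; exact ⟨by linarith [hvs.1], by linarith [hvs.2]⟩)
    exact ⟨t, ht, htv⟩
  have htI : t ∈ Icc 0 S := Ioo_subset_Icc_self ht
  have hφc : ContinuousOn (fun s => -N (1 + X s) + c * Y s ^ 2 * Ψ (1 + X s)) (Icc 0 S) := by
    have h1 : ContinuousOn (fun s => 1 + X s) (Icc 0 S) :=
      (continuous_const.add h.continuous_X).continuousOn
    have h2 : ContinuousOn Y (Icc 0 S) := h.continuous_Y.continuousOn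
    exact (hNc.comp h1 hX1).neg.add ((continuousOn_const.mul (h2.pow 2)).mul (hΨc.comp h1 hX1))
  have hlow : ∀ s ∈ Icc 0 t, 1 + X s ∈ Icc 0 vs := by
    intro s hs
    have hsS : s ∈ Icc 0 S := ⟨hs.1, hs.2.trans htI.2⟩
    exact ⟨(hX1 s hsS).1, by
      have := hXmono.monotoneOn hsS htI hs.2
      linarith⟩
  have hhigh : ∀ s ∈ Icc t S, 1 + X s ∈ Icc vs 2 := by
    intro s hs
    have hsS : s ∈ Icc 0 S := ⟨htI.1.trans hs.1, hs.2⟩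
    exact ⟨by
      have := hXmono.monotoneOn htI hsS hs.1
      linarith, (hX1 s hsS).2⟩
  -- the part of the layer below the level `vs`
  have hpart1 : ∫ s in (0 : ℝ)..t, (-N (1 + X s) + c * Y s ^ 2 * Ψ (1 + X s)) ≤
      p * (Real.sqrt (2 * e 0) - Real.sqrt (2 * e t)) := by
    -- Since `√(2e) ≤ X'` and `e' = -cY²X'`, the coupling term satisfies `cY² ≤ -(√(2e))'`. The term
    -- `-N` is dropped here.
    have := integral_le_sub_of_le_deriv htI.1 (hφc.mono (Icc_subset_Icc_right htI.2))
      (g := fun s => -(p * Real.sqrt (2 * e s)))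
      (g' := fun s => -(p * ((2 * -(c * Y s ^ 2 * X' s)) / (2 * Real.sqrt (2 * e s)))))
      (continuousOn_const.mul ((continuousOn_const.mul
        (hec.mono (Icc_subset_Icc_right htI.2))).sqrt)).neg
      (fun s hs => by
        have hsS : s ∈ Ico 0 S := ⟨hs.1.le, hs.2.trans ht.2⟩
        have h1 := ((hd s ⟨hsS.1, hsS.2.le⟩).const_mul 2).sqrt (by
          have := hepos s hsS; positivity)
        exact (h1.const_mul p).neg)
      (fun s hs => by
        have hsS : s ∈ Ico 0 S := ⟨hs.1.le, hs.2.trans ht.2⟩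
        have h1 := hepos s hsS
        have h2 := hX'pos s hsS
        have h3 := hN _ (hX1 s ⟨hsS.1, hsS.2.le⟩)
        have h4 := hΨp _ (hlow s (Ioo_subset_Icc_self hs))
        have h5 : 0 ≤ c * Y s ^ 2 := by positivity
        have h6 : 0 < Real.sqrt (2 * e s) := Real.sqrt_pos.mpr (by positivity)
        have h7 : Real.sqrt (2 * e s) ≤ X' s := by
          rw [Real.sqrt_le_left h2.le]
          simp only [he]
          nlinarith [sq_nonneg (1 - X s ^ 2)]
        have h8 : 1 ≤ X' s / Real.sqrt (2 * e s) := (one_le_div h6).mpr h7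
        have h9 : -(p * ((2 * -(c * Y s ^ 2 * X' s)) / (2 * Real.sqrt (2 * e s)))) =
            p * (c * Y s ^ 2) * (X' s / Real.sqrt (2 * e s)) := by
          field_simp
        rw [h9]
        have h10 : p * (c * Y s ^ 2) * 1 ≤ p * (c * Y s ^ 2) * (X' s / Real.sqrt (2 * e s)) :=
          mul_le_mul_of_nonneg_left h8 (by positivity)
        nlinarith [mul_le_mul_of_nonneg_left h4 h5])
    linarith
  -- the part above the level `vs`
  set D := Real.sqrt (2 * e t + 2) with hD
  have het : 0 < e t := hepos t ⟨htI.1, ht.2⟩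
  have hDpos : 0 < D := Real.sqrt_pos.mpr (by linarith)
  have hpart2 : ∫ s in t..S, (-N (1 + X s) + c * Y s ^ 2 * Ψ (1 + X s)) ≤ -I / D := by
    have hnnc : Continuous nn := continuous_iff_continuousAt.mpr fun v => (hnn v).continuousAt
    -- Now the coupling term is dropped. As `e` decreases and `(1 - X²)² ≤ 1`, the speed `X'` is at
    -- most `D`, so `ds ≥ dX / D`.
    have := integral_le_sub_of_le_deriv htI.2 (hφc.mono (Icc_subset_Icc_left htI.1))
      (g := fun s => -(nn (1 + X s) / D)) (g' := fun s => -(n (1 + X s) * X' s / D))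
      ((hnnc.comp (continuous_const.add h.continuous_X)).div_const D).neg.continuousOn
      (fun s hs => (((hnn _).comp s ((h.hX s).const_add 1)).div_const D).neg)
      (fun s hs => by
        have hsS : s ∈ Ico 0 S := ⟨htI.1.trans hs.1.le, hs.2⟩
        have hv := hhigh s (Ioo_subset_Icc_self hs)
        have h2 := hX'pos s hsS
        have h5 : 0 ≤ c * Y s ^ 2 := by positivity
        have h6 : c * Y s ^ 2 * Ψ (1 + X s) ≤ 0 := mul_nonpos_of_nonneg_of_nonpos h5 (hΨ0 _ hv)
        have h7 : X' s ≤ D := by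
          apply Real.le_sqrt_of_sq_le
          have h8 := hanti htI ⟨hsS.1, hsS.2.le⟩ hs.1.le
          have h9 : (1 - X s ^ 2) ^ 2 ≤ 1 := by
            have hb := hX1 s ⟨hsS.1, hsS.2.le⟩
            have : X s ^ 2 ≤ 1 := by nlinarith [hb.1, hb.2]
            nlinarith [sq_nonneg (X s)]
          simp only [he] at h8 ⊢
          linarith
        have h10 : n (1 + X s) * X' s / D ≤ n (1 + X s) := by
          rw [div_le_iff₀ hDpos]
          exact mul_le_mul_of_nonneg_left h7 (hn0 _ hv)
        have := hnN _ hv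
        linarith)
    rw [htv, hXS, show (1 : ℝ) + 1 = 2 by norm_num] at this
    refine this.trans ?_
    rw [show -(nn 2 / D) - -(nn vs / D) = -(nn 2 - nn vs) / D by ring]
    gcongr
  -- the total loss of `e` below the level `vs`
  have hloss : e 0 - e t ≤ a := by
    -- The loss of `e` is the integral of `cY² dX`, which `g` dominates as a function of `v = 1 +
    -- X`.
    have hmono : MonotoneOn (fun s => e s + G (1 + X s)) (Icc 0 t) := by
      have hdd : ∀ s ∈ Icc 0 t, HasDerivAt (fun s => e s + G (1 + X s))
          (-(c * Y s ^ 2 * X' s) + g (1 + X s) * X' s) s := fun s hs =>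
        (hd s ⟨hs.1, hs.2.trans htI.2⟩).add ((hG _).comp s ((h.hX s).const_add 1))
      apply monotoneOn_of_deriv_nonneg (convex_Icc _ _)
      · exact fun s hs => (hdd s hs).continuousAt.continuousWithinAt
      · exact fun s hs => (hdd s (interior_subset hs)).differentiableAt.differentiableWithinAt
      · intro s hs
        rw [(hdd s (interior_subset hs)).deriv]
        rw [interior_Icc] at hs
        have hsS : s ∈ Ico 0 S := ⟨hs.1.le, hs.2.trans ht.2⟩
        have := mul_le_mul_of_nonneg_right (hYg s (hsub s ⟨hsS.1, hsS.2.le⟩)) (hX'pos s hsS).le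
        linarith
    have := hmono (left_mem_Icc.mpr htI.1) (right_mem_Icc.mpr htI.1) htI.1
    simp only [h.X_zero, htv] at this
    norm_num at this
    linarith
  have he0 : 2 * e 0 = X' 0 ^ 2 := by simp only [he, h.X_zero]; ring
  have hmonoe : e t ≤ e 0 := hanti (left_mem_Icc.mpr hS.le) htI htI.1
  have hx2 : Real.sqrt (2 * e t) ^ 2 = 2 * e t := Real.sq_sqrt (by linarith)
  have hz2 : Real.sqrt (2 * e 0) ^ 2 = 2 * e 0 := Real.sq_sqrt (by linarith)
  -- Loss and gain now carry the same factor `1/D`, so only the sign of `I - p a` matters.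
  have hbal := sqrt_sub_mul_le (Real.sqrt_nonneg (2 * e t))
    (Real.sqrt_le_sqrt (show 2 * e t ≤ 2 * e 0 by linarith)) ha (by rw [hx2, hz2]; linarith)
  rw [hx2, ← hD] at hbal
  have hbal' : Real.sqrt (2 * e 0) - Real.sqrt (2 * e t) ≤ a / D := (le_div_iff₀ hDpos).mpr hbal
  have hφi : ∀ x ∈ Icc 0 S, ∀ y ∈ Icc 0 S, IntervalIntegrable
      (fun s => -N (1 + X s) + c * Y s ^ 2 * Ψ (1 + X s)) volume x y := fun x hx y hy =>
    (hφc.mono (uIcc_subset_Icc hx hy)).intervalIntegrable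
  rw [← intervalIntegral.integral_add_adjacent_intervals
    (hφi 0 (left_mem_Icc.mpr hS.le) t htI) (hφi t htI S (right_mem_Icc.mpr hS.le))]
  have hDle : D ≤ Real.sqrt (X' 0 ^ 2 + 2) := Real.sqrt_le_sqrt (by linarith)
  calc _ ≤ p * (a / D) + -I / D :=
        add_le_add (hpart1.trans (mul_le_mul_of_nonneg_left hbal' hp)) hpart2
    _ = -((I - p * a) / D) := by ring
    _ ≤ -((I - p * a) / Real.sqrt (X' 0 ^ 2 + 2)) := by
        apply neg_le_neg
        exact div_le_div_of_nonneg_left (by linarith) hDpos hDle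
    _ = _ := by ring

/-- Small coupling: the layer integral for the profile `b(v) = v / 2`. -/
theorem layer_integral_le_of_le_quarter (h : LayerSolution c L X X' Y Y') (hc : 0 < c)
    (hc4 : c ≤ 1 / 4) {S : ℝ} (hS : 0 < S) (hSL : S ≤ L) (hXS : X S = 1)
    (hlt : ∀ s ∈ Ico 0 S, X s < 1) :
    ∫ s in (0 : ℝ)..S, (-((1 + X s) ^ 2 * (2 - (1 + X s)) * (28 / 5 - 8 / 5 * (1 + X s)))
      + c * Y s ^ 2 * ((1 + X s) * (7 / 5 - 3 * (1 + X s) + (1 + X s) ^ 2))) ≤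
      -(3 / 5) / Real.sqrt (X' 0 ^ 2 + 2) := by
  -- Here `cY² ≤ 2/5`, so the energy loss is at most `6/25`; `a` is far larger because it must be at
  -- least 8. The factor `28/5 - 8v/5` of `N` is replaced by its minimum `12/5`.
  have := h.layer_integral_le hc hS hSL hXS hlt
    (Ψ := fun v => v * (7 / 5 - 3 * v + v ^ 2))
    (N := fun v => v ^ 2 * (2 - v) * (28 / 5 - 8 / 5 * v)) (n := fun v => 12 / 5 * (v ^ 2 * (2 - v)))
    (nn := fun v => 12 / 5 * (2 / 3 * v ^ 3 - 1 / 4 * v ^ 4)) (g := fun _ => 2 / 5)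
    (G := fun v => 2 / 5 * v) (p := 1 / 5) (vs := 3 / 5) (a := 1376 / 125)
    (I := 3 / 5 + 1376 / 625)
    ⟨by norm_num, by norm_num⟩ (by norm_num) (by norm_num) (by fun_prop) (by fun_prop)
    (fun v hv => mul_nonneg (mul_nonneg (sq_nonneg v) (by linarith [hv.2])) (by linarith [hv.2]))
    (fun v hv => by
      nlinarith [mul_nonneg hv.1 (sq_nonneg (v - 1 / 4)), hv.1, hv.2, sq_nonneg (v - 1 / 4),
        mul_nonneg hv.1 (sub_nonneg.mpr hv.2)])
    (fun v hv => mul_nonpos_of_nonneg_of_nonpos (by linarith [hv.1])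
      (by nlinarith [mul_nonneg (sub_nonneg.mpr hv.1) (sub_nonneg.mpr hv.2)]))
    (fun v hv => mul_nonneg (by norm_num) (mul_nonneg (sq_nonneg v) (by linarith [hv.2])))
    (fun v hv => by
      have : 0 ≤ v ^ 2 * (2 - v) := mul_nonneg (sq_nonneg v) (by linarith [hv.2])
      nlinarith [mul_nonneg this (sub_nonneg.mpr hv.2)])
    (fun v => by
      have h3 := ((hasDerivAt_id v).pow 3).const_mul (2 / 3 : ℝ)
      have h4 := ((hasDerivAt_id v).pow 4).const_mul (1 / 4 : ℝ)
      refine ((h3.sub h4).const_mul (12 / 5)).congr_deriv ?_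
      simp; ring)
    (by norm_num) (fun v => by simpa using (hasDerivAt_id v).const_mul (2 / 5 : ℝ)) (by norm_num)
    (fun s hs => by
      have h1 := h.sq_Y_le hc s hs
      have h2 : Y s ^ 2 ≤ 8 / 5 := by nlinarith
      nlinarith [sq_nonneg (Y s)])
    (by norm_num)
  refine this.trans (le_of_eq ?_)
  norm_num

/-- Moderate coupling: the layer integral for the profile `b(v) = 4v / (2 + 3v)`. -/
theorem layer_integral_le_of_le_sixteen (h : LayerSolution c L X X' Y Y') (hc : 1 / 4 ≤ c)
    (hc16 : c ≤ 16) {S : ℝ} (hS : 0 < S) (hSL : S ≤ L) (hXS : X S = 1)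
    (hlt : ∀ s ∈ Ico 0 S, X s < 1) :
    ∫ s in (0 : ℝ)..S, (-(20 * (1 + X s) ^ 2 * (2 - (1 + X s)) ^ 2 / (2 + 3 * (1 + X s)))
      + c * Y s ^ 2 * (5 * (1 + X s) * (5 * (1 + X s) - 2) * ((1 + X s) - 2)
        / (2 + 3 * (1 + X s)) ^ 2)) ≤
      -(3 / 5) / Real.sqrt (X' 0 ^ 2 + 2) := by
  have hc0 : 0 < c := by linarith
  -- The bound `g` is the squared barrier at `c = 16`, and `a = G(2/5)`. In `n`, the factor `25/(2 +
  -- 3v)` of `N` is replaced by its tangent `8 - 3v` at `v = 1`, which lies below it by convexity.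
  have := h.layer_integral_le hc0 hS hSL hXS hlt
    (Ψ := fun v => 5 * v * (5 * v - 2) * (v - 2) / (2 + 3 * v) ^ 2)
    (N := fun v => 20 * v ^ 2 * (2 - v) ^ 2 / (2 + 3 * v))
    (n := fun v => 4 / 5 * (v ^ 2 * (2 - v) ^ 2 * (8 - 3 * v)))
    (nn := fun v => 4 / 5 * (32 / 3 * v ^ 3 - 11 * v ^ 4 + 4 * v ^ 5 - 1 / 2 * v ^ 6))
    (g := fun v => 16 * (1 + 3 / 2 * v) ^ 2)
    (G := fun v => 16 * (v + 3 / 2 * v ^ 2 + 3 / 4 * v ^ 3)) (p := 3 / 10) (vs := 2 / 5)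
    (a := 1376 / 125) (I := 3 / 5 + 3 / 10 * (1376 / 125))
    ⟨by norm_num, by norm_num⟩ (by norm_num) (by norm_num)
    (ContinuousOn.div (by fun_prop) (by fun_prop) fun v hv => by
      have : 0 < 2 + 3 * v := by linarith [hv.1]
      positivity)
    (ContinuousOn.div (by fun_prop) (by fun_prop) fun v hv => by
      have : 0 < 2 + 3 * v := by linarith [hv.1]
      positivity)
    (fun v hv => by have := hv.1; positivity)
    (fun v hv => by
      have h1 := hv.1
      rw [div_le_iff₀ (by positivity)]
      nlinarith [mul_nonneg (sub_nonneg.mpr hv.2) (sq_nonneg (v - 7 / 50)),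
        sq_nonneg (v - 1 / 7)])
    (fun v hv => by
      have h1 : 0 ≤ v := by linarith [hv.1]
      apply div_nonpos_of_nonpos_of_nonneg _ (by positivity)
      exact mul_nonpos_of_nonneg_of_nonpos (mul_nonneg (by positivity) (by linarith [hv.1]))
        (by linarith [hv.2]))
    (fun v hv => mul_nonneg (by norm_num) (mul_nonneg (by positivity) (by linarith [hv.2])))
    (fun v hv => by
      have h1 : 0 ≤ v := by linarith [hv.1]
      rw [le_div_iff₀ (by positivity)]
      have : 0 ≤ v ^ 2 * (2 - v) ^ 2 * (3 * v - 3) ^ 2 := by positivity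
      nlinarith)
    (fun v => by
      have h3 := ((hasDerivAt_id v).pow 3).const_mul (32 / 3 : ℝ)
      have h4 := ((hasDerivAt_id v).pow 4).const_mul (11 : ℝ)
      have h5 := ((hasDerivAt_id v).pow 5).const_mul (4 : ℝ)
      have h6 := ((hasDerivAt_id v).pow 6).const_mul (1 / 2 : ℝ)
      refine ((((h3.sub h4).add h5).sub h6).const_mul (4 / 5)).congr_deriv ?_
      simp; ring)
    (by norm_num)
    (fun v => by
      have h2 := ((hasDerivAt_id v).pow 2).const_mul (3 / 2 : ℝ)
      have h3 := ((hasDerivAt_id v).pow 3).const_mul (3 / 4 : ℝ)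
      refine ((((hasDerivAt_id v).add h2).add h3).const_mul 16).congr_deriv ?_
      simp; ring)
    (by norm_num)
    (fun s hs => by
      have h1 := h.barrier_three_halves hc hc16 s hs
      have h2 : Y s ^ 2 ≤ (1 + 3 / 2 * (1 + X s)) ^ 2 := sq_le_sq' (abs_le.mp h1).1 (abs_le.mp h1).2
      exact mul_le_mul hc16 h2 (sq_nonneg _) (by norm_num))
    (by norm_num)
  refine this.trans (le_of_eq ?_)
  norm_num

/-! ### Large coupling: a lower bound for the speed in the layer -/

variable {c L : ℝ} {X X' Y Y' : ℝ → ℝ}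

theorem sub_le_mul_of_deriv_le {g g' : ℝ → ℝ} {a b C : ℝ} (hab : a ≤ b)
    (hg : ∀ s ∈ Icc a b, HasDerivAt g (g' s) s) (hC : ∀ s ∈ Icc a b, g' s ≤ C) :
    g b - g a ≤ C * (b - a) := by
  apply (convex_Icc a b).image_sub_le_mul_sub_of_deriv_le (C := C)
  · exact fun s hs => (hg s hs).continuousAt.continuousWithinAt
  · exact fun s hs => (hg s (interior_subset hs)).differentiableAt.differentiableWithinAt
  · intro s hs
    rw [(hg s (interior_subset hs)).deriv]
    exact hC s (interior_subset hs)
  · exact left_mem_Icc.mpr hab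
  · exact right_mem_Icc.mpr hab
  · exact hab

/-- While `X ≤ 5 / 2`, a slow start keeps `X` and `X'` small for a time of order `c⁻²`. -/
theorem X_le_of_slow (h : LayerSolution c L X X' Y Y') (hc : 16 ≤ c) {a t : ℝ} (ha : 0 ≤ a)
    (hat : a ≤ t) (htL : t ≤ L) (hta : c ^ 2 * (t - a) ≤ 19) (hXa : X a ≤ 3 / 2)
    (hX'a : X' a ≤ 2 / 5 * c) (hX : ∀ s ∈ Icc a t, X s ≤ 5 / 2) : X t ≤ 453 / 200 := by
  have hc0 : 0 < c := by linarith
  have hc3 : 16 ^ 3 ≤ c ^ 3 := by gcongr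
  have h1 : ∀ s ∈ Icc a t, X' s ≤ 161 / 250 * c := by
    intro s hs
    have hd : ∀ r ∈ Icc a s, r ∈ Icc 0 L := fun r hr =>
      ⟨ha.trans hr.1, hr.2.trans (hs.2.trans htL)⟩
    -- For `X ≤ 5/2`, `X'' ≤ 4 · (5/2) · (21/4) = 105/2`. Over a time `19/c²` with `c ≥ 16` this
    -- adds at most `61c/250` to `X'`.
    have := sub_le_mul_of_deriv_le hs.1 (fun r hr => h.hX' r (hd r hr)) (C := 105 / 2) (by
      intro r hr
      have e1 := h.neg_one_le_X hc0 r (hd r hr)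
      have e2 := hX r ⟨hr.1, hr.2.trans hs.2⟩
      have e3 : 0 ≤ c * Y r ^ 2 := by positivity
      have e4 : 0 ≤ (5 / 2 - X r) * ((X r + 5 / 4) ^ 2 + 59 / 16) := by
        apply mul_nonneg (by linarith); positivity
      nlinarith)
    have e5 : c ^ 2 * (s - a) ≤ 19 := by nlinarith [hs.2, sq_nonneg c]
    have e6 : 105 / 2 * (s - a) ≤ 61 / 250 * c := by
      have : c ^ 2 * (105 / 2 * (s - a)) ≤ c ^ 2 * (61 / 250 * c) := by nlinarith
      exact le_of_mul_le_mul_left this (by positivity)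
    linarith
  have h2 := sub_le_mul_of_deriv_le hat (fun r _ => h.hX r) h1
  have h3 : 161 / 250 * c * (t - a) ≤ 153 / 200 := by
    have : c * (161 / 250 * c * (t - a)) ≤ c * (153 / 200) := by nlinarith
    exact le_of_mul_le_mul_left this hc0
  linarith

/-- Continuation: at a first time with `X = 5/2`, the previous lemma would give `X ≤ 453/200 < 5/2`.
-/
theorem X_le_of_slow' (h : LayerSolution c L X X' Y Y') (hc : 16 ≤ c) {a t : ℝ} (ha : 0 ≤ a)
    (htL : t ≤ L) (hta : c ^ 2 * (t - a) ≤ 19) (hXa : X a ≤ 3 / 2)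
    (hX'a : X' a ≤ 2 / 5 * c) : ∀ s ∈ Icc a t, X s ≤ 453 / 200 := by
  have key : ∀ s ∈ Icc a t, X s ≤ 5 / 2 := by
    by_contra! hcon
    obtain ⟨s, hs, hXs⟩ := hcon
    have hcomp : IsCompact (Icc a t ∩ X ⁻¹' Ici (5 / 2)) :=
      isCompact_Icc.inter_right (isClosed_Ici.preimage h.continuous_X)
    obtain ⟨r, ⟨hr, hXr⟩, hrmin⟩ := hcomp.exists_isLeast ⟨s, hs, hXs.le⟩
    have hXr' : 5 / 2 ≤ X r := hXr
    have har : a < r := lt_of_le_of_ne hr.1 (by rintro rfl; linarith)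
    have hlt : ∀ q ∈ Ico a r, X q < 5 / 2 := by
      intro q hq
      by_contra! h1
      exact absurd (hrmin ⟨⟨hq.1, hq.2.le.trans hr.2⟩, h1⟩) (not_le.mpr hq.2)
    have hXr2 : X r ≤ 5 / 2 := by
      have hcw : ContinuousWithinAt X (Iio r) r := h.continuous_X.continuousWithinAt
      exact le_of_tendsto hcw (by
        filter_upwards [Ioo_mem_nhdsLT har] with q hq using (hlt q ⟨hq.1.le, hq.2⟩).le)
    have := h.X_le_of_slow hc ha hr.1 (hr.2.trans htL)
      (by nlinarith [hr.2, sq_nonneg c]) hXa hX'a (fun q hq => by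
        rcases hq.2.eq_or_lt with rfl | h1
        · exact hXr2
        · exact (hlt q ⟨hq.1, h1⟩).le)
    linarith
  intro s hs
  exact h.X_le_of_slow hc ha hs.1 (hs.2.trans htL) (by nlinarith [hs.2, sq_nonneg c]) hXa hX'a
    fun q hq => key q ⟨hq.1, hq.2.trans hs.2⟩

set_option maxHeartbeats 400000 in
/-- For large coupling, `X` cannot be slow before it reaches the level `3 / 2`: otherwise the
conserved energy would drive `Y` through its barrier. -/
theorem deriv_ge_of_energy (h : LayerSolution c L X X' Y Y') (hc : 16 ≤ c) {a : ℝ} (ha : 0 ≤ a)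
    (haL : a + 1 ≤ L) (hXa : X a ≤ 3 / 2) (hX'0 : 0 ≤ X' a) {r : ℝ} (hr : r ∈ Icc 0 L)
    (hfr : (X r ^ 2 - 1) ^ 2 + (Y r ^ 2 - 1) ^ 2 / 4 - c * X r * Y r ^ 2 ≤
      -(2499 / 10000 * c ^ 4) - 42 / 25 * c ^ 2 + 2) : 2 / 5 * c < X' a := by
  by_contra! hX'a
  have hc0 : 0 < c := by linarith
  -- On this time span `X` stays below `453/200`, so the barrier confines `Y`, while energy
  -- conservation makes `Y'` of order `c²`; the factor 19 is large enough for a contradiction.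
  set t := a + 19 / c ^ 2 with ht
  have hta : c ^ 2 * (t - a) = 19 := by rw [ht]; field_simp; ring
  have hat : a < t := by rw [ht]; linarith [show 0 < 19 / c ^ 2 by positivity]
  have hc2 : (16 : ℝ) ^ 2 ≤ c ^ 2 := by gcongr
  have htL : t ≤ L := by
    have : c ^ 2 * (t - a) ≤ c ^ 2 * 1 := by rw [hta]; linarith
    have := le_of_mul_le_mul_left this (by positivity)
    linarith
  have hsub : ∀ s ∈ Icc a t, s ∈ Icc 0 L := fun s hs => ⟨ha.trans hs.1, hs.2.trans htL⟩
  have hX := h.X_le_of_slow' hc ha htL hta.le hXa hX'a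
  have hY : ∀ s ∈ Icc a t, Y s ^ 2 ≤ 431 / 10 := by
    intro s hs
    have h1 := h.barrier_seventeen_tenths hc s (hsub s hs)
    have h2 := hX s hs
    have h3 : |Y s| ≤ 656 / 100 := by linarith
    rw [abs_le] at h3
    nlinarith
  have hX1 := fun s hs => h.neg_one_le_X hc0 s (hsub s hs)
  have hdelta : ∀ s ∈ Icc a t, c ^ 2 * (s - a) ≤ 19 := fun s hs => by
    rw [← hta]; exact mul_le_mul_of_nonneg_left (by linarith [hs.2]) (sq_nonneg c)
  -- bounds for `X'`
  have hX'lo : ∀ s ∈ Icc a t, -(321 / 100 * c) ≤ X' s := by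
    intro s hs
    have := sub_le_mul_of_deriv_le hs.1
      (fun q hq => (h.hX' q (hsub q ⟨hq.1, hq.2.trans hs.2⟩)).neg) (C := 173 / 4 * c) (by
      intro q hq
      have hq' : q ∈ Icc a t := ⟨hq.1, hq.2.trans hs.2⟩
      have e1 := hX1 q hq'
      have e2 := mul_le_mul_of_nonneg_left (hY q hq') hc0.le
      have e3 : 0 ≤ (X q + 1) * (X q - 1 / 2) ^ 2 := mul_nonneg (by linarith) (sq_nonneg _)
      nlinarith)
    simp only [Pi.neg_apply] at this
    have e5 := hdelta s hs
    have e6 : 173 / 4 * c * (s - a) ≤ 321 / 100 * c := by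
      have : c ^ 2 * (173 / 4 * c * (s - a)) ≤ c ^ 2 * (321 / 100 * c) := by nlinarith
      exact le_of_mul_le_mul_left this (by positivity)
    linarith
  have hX'hi : ∀ s ∈ Icc a t, X' s ≤ 321 / 100 * c := by
    intro s hs
    have := sub_le_mul_of_deriv_le hs.1
      (fun q hq => h.hX' q (hsub q ⟨hq.1, hq.2.trans hs.2⟩)) (C := 105 / 2) (by
      intro q hq
      have hq' : q ∈ Icc a t := ⟨hq.1, hq.2.trans hs.2⟩
      have e1 := hX1 q hq'
      have e2 := hX q hq'
      have e3 : 0 ≤ c * Y q ^ 2 := by positivity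
      have e4 : 0 ≤ (5 / 2 - X q) * ((X q + 5 / 4) ^ 2 + 59 / 16) := by
        apply mul_nonneg (by linarith); positivity
      nlinarith)
    have e5 := hdelta s hs
    have e6 : 105 / 2 * (s - a) ≤ c := by
      have : c ^ 2 * (105 / 2 * (s - a)) ≤ c ^ 2 * c := by nlinarith
      exact le_of_mul_le_mul_left this (by positivity)
    linarith
  obtain ⟨ξ, hξ, hξ'⟩ := exists_hasDerivAt_eq_slope Y Y' hat h.continuous_Y.continuousOn
    (fun s _ => h.hY s)
  have hξI : ξ ∈ Icc a t := Ioo_subset_Icc_self hξ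
  have hcons := h.energy_conserved hr (hsub ξ hξI)
  have hX'2 : X' ξ ^ 2 ≤ 1031 / 100 * c ^ 2 := by
    have := sq_le_sq' (hX'lo ξ hξI) (hX'hi ξ hξI)
    nlinarith [sq_nonneg c]
  have hflow : -(5 / 2 * c) - 25 / 4 * c ^ 2 ≤
      (X ξ ^ 2 - 1) ^ 2 + (Y ξ ^ 2 - 1) ^ 2 / 4 - c * X ξ * Y ξ ^ 2 := by
    have e1 := hX1 ξ hξI
    have e2 := hX ξ hξI
    have e3 : (Y ξ ^ 2 - 1) ^ 2 / 4 - c * X ξ * Y ξ ^ 2 =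
        (Y ξ ^ 2 - 1 - 2 * c * X ξ) ^ 2 / 4 - c * X ξ - c ^ 2 * X ξ ^ 2 := by ring
    have e4 : c * X ξ ≤ c * (5 / 2) := mul_le_mul_of_nonneg_left (by linarith) hc0.le
    have e5 : X ξ ^ 2 ≤ 25 / 4 := by nlinarith
    have e6 := mul_le_mul_of_nonneg_left e5 (sq_nonneg c)
    linarith [sq_nonneg (X ξ ^ 2 - 1), sq_nonneg (Y ξ ^ 2 - 1 - 2 * c * X ξ)]
  -- By conservation `Y'²` at `ξ` is at least twice the difference of the potentials at `ξ` and `r`,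
  -- minus `X'²`; the lower order terms are absorbed using `c ≥ 16`.
  have hY'2 : 416 / 1000 * c ^ 4 ≤ Y' ξ ^ 2 := by
    have e1 : c ^ 4 = c ^ 2 * c ^ 2 := by ring
    have e2 : 256 * c ^ 2 ≤ c ^ 4 := by nlinarith
    have e3 : 16 * c ≤ c ^ 2 := by nlinarith
    linarith [sq_nonneg (X' r), sq_nonneg (Y' r)]
  have hYt : Y t - Y a = Y' ξ * (t - a) := by
    rw [hξ']; field_simp [sub_ne_zero.mpr hat.ne']
  have hsq : 150 ≤ (Y t - Y a) ^ 2 := by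
    have e1 : (Y t - Y a) ^ 2 = Y' ξ ^ 2 * (t - a) ^ 2 := by rw [hYt]; ring
    have e2 : 416 / 1000 * c ^ 4 * (t - a) ^ 2 ≤ Y' ξ ^ 2 * (t - a) ^ 2 :=
      mul_le_mul_of_nonneg_right hY'2 (sq_nonneg _)
    have e3 : c ^ 4 * (t - a) ^ 2 = 361 := by
      rw [show c ^ 4 * (t - a) ^ 2 = (c ^ 2 * (t - a)) ^ 2 by ring, hta]; norm_num
    nlinarith
  have hYa := h.barrier_seventeen_tenths hc a (hsub a (left_mem_Icc.mpr hat.le))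
  have hYt' := h.barrier_seventeen_tenths hc t (hsub t (right_mem_Icc.mpr hat.le))
  have hXt := hX t (right_mem_Icc.mpr hat.le)
  -- The barriers at `X ≤ 453/200` and `X ≤ 3/2` sum to less than `11.81`, whose square is below
  -- 150.
  have habs : |Y t - Y a| ≤ 1181 / 100 := by
    have := abs_sub (Y t) (Y a)
    linarith
  rw [abs_le] at habs
  nlinarith

/-- Large coupling: the layer integral for the profile `b(v) = 21v / (10 + 17v)`. -/
theorem layer_integral_le_of_sixteen_le (h : LayerSolution c L X X' Y Y') (hc : 16 ≤ c) {S : ℝ}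
    (hS : 0 < S) (hSL : S + 1 ≤ L) (hXS : X S = 3 / 2) (hlt : ∀ s ∈ Ico 0 S, X s < 3 / 2)
    {r : ℝ} (hr : r ∈ Icc 0 L)
    (hfr : (X r ^ 2 - 1) ^ 2 + (Y r ^ 2 - 1) ^ 2 / 4 - c * X r * Y r ^ 2 ≤
      -(2499 / 10000 * c ^ 4) - 42 / 25 * c ^ 2 + 2) :
    -(3 / 10 * X' S) + ∫ s in (0 : ℝ)..S,
      (-((1 + X s) ^ 2 * (2 - (1 + X s)) * (117 / 5 - 981 / 125 * (1 + X s))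
          / (1 + 17 / 10 * (1 + X s)))
        + c * Y s ^ 2 * ((1 + X s) * (117 / 20 - 15327 / 1000 * (1 + X s)
          + 2916 / 625 * (1 + X s) ^ 2) / (1 + 17 / 10 * (1 + X s)) ^ 2)) ≤ -(1 / 2) := by
  have hc0 : 0 < c := by linarith
  have hX'c : ContinuousOn X' (Icc 0 L) := fun s hs =>
    (h.hX' s hs).continuousAt.continuousWithinAt
  have hle : ∀ s ∈ Icc 0 S, X s ≤ 3 / 2 := by
    intro s hs
    rcases hs.2.eq_or_lt with rfl | h1
    · exact hXS.le
    · exact (hlt s ⟨hs.1, h1⟩).le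
  have hpos : ∀ s ∈ Ico 0 S, 2 / 5 * c < X' s := by
    intro s hs
    by_contra! hcon
    -- `deriv_ge_of_energy` requires `X' ≥ 0`. If `X'` is negative at `s`, it must vanish later,
    -- since `X` still has to rise to `3/2`.
    obtain ⟨q, hq, hq0, hqc⟩ : ∃ q ∈ Icc 0 S, 0 ≤ X' q ∧ X' q ≤ 2 / 5 * c := by
      by_cases h0 : 0 ≤ X' s
      · exact ⟨s, ⟨hs.1, hs.2.le⟩, h0, hcon⟩
      · push Not at h0
        obtain ⟨ξ, hξ, hξ'⟩ := exists_hasDerivAt_eq_slope X X' hs.2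
          h.continuous_X.continuousOn (fun s _ => h.hX s)
        have hξpos : 0 < X' ξ := by
          rw [hξ', hXS]
          exact div_pos (by linarith [hlt s hs]) (by linarith [hs.2])
        obtain ⟨q, hq, hq0⟩ := intermediate_value_Icc hξ.1.le
          (hX'c.mono (Icc_subset_Icc hs.1 (by linarith [hξ.2]))) ⟨h0.le, hξpos.le⟩
        exact ⟨q, ⟨hs.1.trans hq.1, hq.2.trans hξ.2.le⟩, hq0.ge, by rw [hq0]; positivity⟩
    have := h.deriv_ge_of_energy hc hq.1 (by linarith [hq.2]) (hle q hq) hq0 hr hfr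
    linarith
  have hposS : 2 / 5 * c ≤ X' S := by
    have hcw : ContinuousWithinAt X' (Iio S) S :=
      (h.hX' S ⟨hS.le, by linarith⟩).continuousAt.continuousWithinAt
    exact ge_of_tendsto hcw (by
      filter_upwards [Ioo_mem_nhdsLT hS] with q hq using (hpos q ⟨hq.1.le, hq.2⟩).le)
  have hv : ∀ s ∈ Icc 0 S, 0 ≤ 1 + X s := fun s hs => by
    linarith [h.neg_one_le_X hc0 s ⟨hs.1, by linarith [hs.2]⟩]
  have hXc : ContinuousOn X (Icc 0 S) := h.continuous_X.continuousOn
  have hYc : ContinuousOn Y (Icc 0 S) := h.continuous_Y.continuousOn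
  -- The integrand is at most `3(2v/5)⁴ + (9c/10)(1 - 2v/5)⁴`: the first term covers `-N`, which is
  -- positive for `2 < v ≤ 5/2`, the second the coupling. Then `1 ≤ 5X'/(2c)` turns it into an exact
  -- derivative.
  have hint := integral_le_sub_of_le_deriv hS.le
    (φ := fun s => -((1 + X s) ^ 2 * (2 - (1 + X s)) * (117 / 5 - 981 / 125 * (1 + X s))
          / (1 + 17 / 10 * (1 + X s)))
        + c * Y s ^ 2 * ((1 + X s) * (117 / 20 - 15327 / 1000 * (1 + X s)
          + 2916 / 625 * (1 + X s) ^ 2) / (1 + 17 / 10 * (1 + X s)) ^ 2))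
    (g := fun s => 5 / (2 * c) * (3 / 2 * (2 / 5 * (1 + X s)) ^ 5
      - 9 / 20 * c * (1 - 2 / 5 * (1 + X s)) ^ 5))
    (g' := fun s => 5 / (2 * c) * (3 * (2 / 5 * (1 + X s)) ^ 4
      + 9 / 10 * c * (1 - 2 / 5 * (1 + X s)) ^ 4) * X' s)
    (by
      apply ContinuousOn.add
      · apply ContinuousOn.neg
        exact ContinuousOn.div (by fun_prop) (by fun_prop) fun s hs => by
          have := hv s hs
          positivity
      · apply ContinuousOn.mul (by fun_prop)
        exact ContinuousOn.div (by fun_prop) (by fun_prop) fun s hs => by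
          have := hv s hs
          positivity)
    (by fun_prop)
    (fun s hs => by
      have h1 := (((h.hX s).const_add 1).const_mul (2 / 5))
      have h2 := (h1.pow 5).const_mul (3 / 2)
      have h3 := ((h1.const_sub 1).pow 5).const_mul (9 / 20 * c)
      refine ((h2.sub h3).const_mul (5 / (2 * c))).congr_deriv ?_
      simp
      ring)
    (fun s hs => by
      have hsS : s ∈ Ico 0 S := ⟨hs.1.le, hs.2⟩
      have hsI : s ∈ Icc 0 S := Ioo_subset_Icc_self hs
      have h1 := hpos s hsS
      have hv0 := hv s hsI
      have hv1 := hle s hsI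
      have hY2 : Y s ^ 2 ≤ (1 + 17 / 10 * (1 + X s)) ^ 2 := by
        have := h.barrier_seventeen_tenths hc s ⟨hsS.1, by linarith [hs.2]⟩
        exact sq_le_sq' (abs_le.mp this).1 (abs_le.mp this).2
      obtain ⟨v, hvdef⟩ : ∃ v, v = 1 + X s := ⟨_, rfl⟩
      simp only [← hvdef] at hv0 hY2 ⊢
      have hv2 : v ≤ 5 / 2 := by linarith
      have hw : 0 < 1 + 17 / 10 * v := by positivity
      have e1 : -(v ^ 2 * (2 - v) * (117 / 5 - 981 / 125 * v) / (1 + 17 / 10 * v)) ≤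
          3 * (2 / 5 * v) ^ 4 := by
        rw [← neg_div, div_le_iff₀ hw]
        have : 0 ≤ v ^ 2 * (48 / 625 * v ^ 2 * (1 + 17 / 10 * v)
            - (v - 2) * (117 / 5 - 981 / 125 * v)) := by
          apply mul_nonneg (sq_nonneg v)
          nlinarith [mul_nonneg hv0 (sq_nonneg (v - 12 / 5)), sq_nonneg (v - 12 / 5)]
        nlinarith
      have e2 : v * (117 / 20 - 15327 / 1000 * v + 2916 / 625 * v ^ 2) ≤
          9 / 10 * (1 - 2 / 5 * v) ^ 4 := by
        nlinarith [mul_nonneg hv0 (sq_nonneg (v - 1 / 4)), sq_nonneg (v - 1 / 4),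
          mul_nonneg hv0 (sub_nonneg.mpr hv2), sq_nonneg (v ^ 2 - 1 / 4 * v)]
      have e3 : Y s ^ 2 * (v * (117 / 20 - 15327 / 1000 * v + 2916 / 625 * v ^ 2)
          / (1 + 17 / 10 * v) ^ 2) ≤ 9 / 10 * (1 - 2 / 5 * v) ^ 4 := by
        have f1 : v * (117 / 20 - 15327 / 1000 * v + 2916 / 625 * v ^ 2)
          / (1 + 17 / 10 * v) ^ 2 ≤ 9 / 10 * (1 - 2 / 5 * v) ^ 4 / (1 + 17 / 10 * v) ^ 2 := by
          gcongr
        calc _ ≤ Y s ^ 2 * (9 / 10 * (1 - 2 / 5 * v) ^ 4 / (1 + 17 / 10 * v) ^ 2) := by gcongr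
          _ ≤ (1 + 17 / 10 * v) ^ 2 *
              (9 / 10 * (1 - 2 / 5 * v) ^ 4 / (1 + 17 / 10 * v) ^ 2) := by gcongr
          _ = _ := by field_simp
      have e4 : 0 ≤ 3 * (2 / 5 * v) ^ 4 + 9 / 10 * c * (1 - 2 / 5 * v) ^ 4 := by
        have : 0 ≤ (1 - 2 / 5 * v) ^ 4 := by positivity
        positivity
      have e5 : 1 ≤ 5 / (2 * c) * X' s := by
        rw [div_mul_eq_mul_div, le_div_iff₀ (by positivity)]
        linarith
      have e6 := mul_le_mul_of_nonneg_left e5 e4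
      have e7 := mul_le_mul_of_nonneg_left e3 hc0.le
      linarith)
  rw [hXS, h.X_zero] at hint
  have hfin : 5 / (2 * c) * (3 / 2 * (2 / 5 * (1 + 3 / 2 : ℝ)) ^ 5
      - 9 / 20 * c * (1 - 2 / 5 * (1 + 3 / 2)) ^ 5)
      - 5 / (2 * c) * (3 / 2 * (2 / 5 * (1 + -1)) ^ 5 - 9 / 20 * c * (1 - 2 / 5 * (1 + -1)) ^ 5)
      = 15 / 4 / c + 9 / 8 := by
    field_simp
    ring
  rw [hfin] at hint
  -- The total `15/64 + 9/8` is beaten by the boundary term `-(3/10)(2c/5) ≤ -1.92`.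
  have : 15 / 4 / c ≤ 15 / 64 := by
    rw [div_le_iff₀ hc0]; linarith
  linarith

end LayerSolution

/-! ### Functions glued from three pieces -/

/-- The function that agrees with `f₁` up to `a`, with `f₂` up to `b` and with `f₃` afterwards. -/
noncomputable def glue (a b : ℝ) (f₁ f₂ f₃ : ℝ → ℝ) (y : ℝ) : ℝ :=
  if y ≤ a then f₁ y else if y ≤ b then f₂ y else f₃ y

section Glue

variable {a b : ℝ} {f₁ f₂ f₃ f₁' f₂' f₃' : ℝ → ℝ}

theorem continuousOn_ite_le {f g : ℝ → ℝ} {s : Set ℝ} (hf : ContinuousOn f s)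
    (hg : ContinuousOn g s) (h : f a = g a) :
    ContinuousOn (fun y => if y ≤ a then f y else g y) s := by
  apply ContinuousOn.if
  · rintro y ⟨-, hy⟩
    have : y = a := by simpa [Iic_def, frontier_Iic] using hy
    rw [this, h]
  · exact hf.mono inter_subset_left
  · exact hg.mono inter_subset_left

theorem memLp_ite_le {f g : ℝ → ℝ} {μ : Measure ℝ} (hf : MemLp f 2 μ) (hg : MemLp g 2 μ) :
    MemLp (fun y => if y ≤ a then f y else g y) 2 μ := by
  have h := (hf.indicator (measurableSet_Iic (a := a))).add
    (hg.indicator (measurableSet_Iic (a := a)).compl)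
  refine h.ae_eq (Filter.Eventually.of_forall fun y => ?_)
  by_cases hy : y ≤ a
  · simp [hy]
  · simp [hy, not_le.mp hy]

theorem hasDerivAt_glue {y : ℝ} (hab : a ≤ b) (hya : y ≠ a) (hyb : y ≠ b)
    (h₁ : HasDerivAt f₁ (f₁' y) y) (h₂ : HasDerivAt f₂ (f₂' y) y) (h₃ : HasDerivAt f₃ (f₃' y) y) :
    HasDerivAt (glue a b f₁ f₂ f₃) (glue a b f₁' f₂' f₃' y) y := by
  rcases lt_or_gt_of_ne hya with h | h
  · have e : glue a b f₁' f₂' f₃' y = f₁' y := by simp [glue, h.le]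
    rw [e]
    refine h₁.congr_of_eventuallyEq ?_
    filter_upwards [Iio_mem_nhds h] with z hz
    simp [glue, (show z < a from hz).le]
  rcases lt_or_gt_of_ne hyb with h' | h'
  · have e : glue a b f₁' f₂' f₃' y = f₂' y := by simp [glue, h.not_ge, h'.le]
    rw [e]
    refine h₂.congr_of_eventuallyEq ?_
    filter_upwards [Ioo_mem_nhds h h'] with z hz
    simp [glue, hz.1.not_ge, hz.2.le]
  · have e : glue a b f₁' f₂' f₃' y = f₃' y := by simp [glue, h.not_ge, h'.not_ge]
    rw [e]
    refine h₃.congr_of_eventuallyEq ?_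
    filter_upwards [Ioi_mem_nhds h'] with z hz
    have hz' : b < z := hz
    simp [glue, hz'.not_ge, (hab.trans_lt hz').not_ge]

theorem memW12_glue (hab : a ≤ b) (h₁ : ∀ y ∈ Icc (-1 : ℝ) 1, HasDerivAt f₁ (f₁' y) y)
    (h₂ : ∀ y ∈ Icc (-1 : ℝ) 1, HasDerivAt f₂ (f₂' y) y)
    (h₃ : ∀ y ∈ Icc (-1 : ℝ) 1, HasDerivAt f₃ (f₃' y) y)
    (c₁ : ContinuousOn f₁' (Icc (-1) 1)) (c₂ : ContinuousOn f₂' (Icc (-1) 1))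
    (c₃ : ContinuousOn f₃' (Icc (-1) 1)) (ha : f₁ a = f₂ a) (hb : f₂ b = f₃ b) :
    MemW12 (glue a b f₁ f₂ f₃) ∧
      weakDeriv (glue a b f₁ f₂ f₃) =ᵐ[volume.restrict (Ioo (-1) 1)] glue a b f₁' f₂' f₃' := by
  have hc : ContinuousOn (glue a b f₁ f₂ f₃) (Icc (-1) 1) := by
    refine continuousOn_ite_le (fun y hy => (h₁ y hy).continuousAt.continuousWithinAt)
      (continuousOn_ite_le (fun y hy => (h₂ y hy).continuousAt.continuousWithinAt)
        (fun y hy => (h₃ y hy).continuousAt.continuousWithinAt) hb) ?_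
    simp [hab, ha]
  have hd : ∀ y ∈ Ioo (-1 : ℝ) 1 \ {a, b},
      HasDerivAt (glue a b f₁ f₂ f₃) (glue a b f₁' f₂' f₃' y) y := by
    rintro y ⟨hy, hyab⟩
    simp only [mem_insert_iff, mem_singleton_iff, not_or] at hyab
    have hy' := Ioo_subset_Icc_self hy
    exact hasDerivAt_glue hab hyab.1 hyab.2 (h₁ y hy') (h₂ y hy') (h₃ y hy')
  have hm : MemLp (glue a b f₁' f₂' f₃') 2 (volume.restrict (Ioo (-1) 1)) :=
    memLp_ite_le (memLp_of_continuousOn c₁)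
      (memLp_ite_le (memLp_of_continuousOn c₂) (memLp_of_continuousOn c₃))
  have hs : ({a, b} : Set ℝ).Countable := (Set.toFinite _).countable
  exact ⟨memW12_of_hasDerivAt hs hc hd hm, weakDeriv_ae_eq_of_hasDerivAt hs hc hd hm⟩

theorem integral_glue (ha : -1 ≤ a) (hab : a ≤ b) (hb : b ≤ 1)
    (c₁ : ContinuousOn f₁ (Icc (-1) 1)) (c₂ : ContinuousOn f₂ (Icc (-1) 1))
    (c₃ : ContinuousOn f₃ (Icc (-1) 1)) :
    ∫ y in Ioo (-1 : ℝ) 1, glue a b f₁ f₂ f₃ y =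
      (∫ y in (-1 : ℝ)..a, f₁ y) + (∫ y in a..b, f₂ y) + ∫ y in b..(1 : ℝ), f₃ y := by
  have e₁ : EqOn (glue a b f₁ f₂ f₃) f₁ (uIoc (-1) a) := by
    intro y hy
    rw [uIoc_of_le ha] at hy
    simp [glue, hy.2]
  have e₂ : EqOn (glue a b f₁ f₂ f₃) f₂ (uIoc a b) := by
    intro y hy
    rw [uIoc_of_le hab] at hy
    simp [glue, hy.1.not_ge, hy.2]
  have e₃ : EqOn (glue a b f₁ f₂ f₃) f₃ (uIoc b 1) := by
    intro y hy
    rw [uIoc_of_le hb] at hy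
    simp [glue, hy.1.not_ge, (hab.trans_lt hy.1).not_ge]
  have i₁ : IntervalIntegrable (glue a b f₁ f₂ f₃) volume (-1) a :=
    (ContinuousOn.intervalIntegrable_of_Icc ha
      (c₁.mono (Icc_subset_Icc_right (hab.trans hb)))).congr e₁.symm
  have i₂ : IntervalIntegrable (glue a b f₁ f₂ f₃) volume a b :=
    (ContinuousOn.intervalIntegrable_of_Icc hab (c₂.mono (Icc_subset_Icc ha hb))).congr e₂.symm
  have i₃ : IntervalIntegrable (glue a b f₁ f₂ f₃) volume b 1 :=
    (ContinuousOn.intervalIntegrable_of_Icc hb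
      (c₃.mono (Icc_subset_Icc_left (ha.trans hab)))).congr e₃.symm
  rw [integral_Ioo_eq_intervalIntegral,
    ← intervalIntegral.integral_add_adjacent_intervals (i₁.trans i₂) i₃,
    ← intervalIntegral.integral_add_adjacent_intervals i₁ i₂]
  congr 1
  · congr 1
    · exact intervalIntegral.integral_congr_ae (Filter.Eventually.of_forall fun y hy => e₁ hy)
    · exact intervalIntegral.integral_congr_ae (Filter.Eventually.of_forall fun y hy => e₂ hy)
  · exact intervalIntegral.integral_congr_ae (Filter.Eventually.of_forall fun y hy => e₃ hy)

end Glue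

/-! ### The destabilising direction -/

theorem integral_le_of_le_deriv_add {φ ρ g g' : ℝ → ℝ} {a b : ℝ} (hab : a ≤ b)
    (hφ : ContinuousOn φ (Icc a b)) (hρ : ContinuousOn ρ (Icc a b))
    (hg : ∀ s ∈ Icc a b, HasDerivAt g (g' s) s) (hle : ∀ s ∈ Icc a b, φ s ≤ g' s + ρ s) :
    ∫ s in a..b, φ s ≤ g b - g a + ∫ s in a..b, ρ s := by
  have h := integral_le_sub_of_le_deriv hab (φ := fun s => φ s - ρ s) (hφ.sub hρ) (g := g)
    (g' := g')
    (fun s hs => (hg s hs).continuousAt.continuousWithinAt)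
    (fun s hs => hg s (Ioo_subset_Icc_self hs))
    (fun s hs => by
      have := hle s (Ioo_subset_Icc_self hs)
      linarith)
  rw [intervalIntegral.integral_sub (hφ.intervalIntegrable_of_Icc hab)
    (hρ.intervalIntegrable_of_Icc hab)] at h
  linarith

/-- The second variation density in a direction `(0, q, 0, m)`. -/
def transverseDensity (l c u v q q' m m' : ℝ) : ℝ :=
  l * (q' ^ 2 + m' ^ 2) - 4 * (1 - u ^ 2) * q ^ 2 - (1 - v ^ 2 - 2 * c * u) * m ^ 2
    - 4 * c * v * q * m

/-- The second variation at an order reconstruction profile that solves the Euler–Lagrange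
equations, bounded from above along a direction built from the rotation mode `(2Q, M)` away from
the wall `y = 1` and from `(k (1 + Q), β M)` in the layer next to the wall. -/
theorem exists_isPerturbation_secondVariation_le {l c k θ ζ : ℝ}
    {Q M U U' V V' β β' Λ Λ' : ℝ → ℝ}
    (hl : 0 < l) (hQ : MemW12 Q) (hM : MemW12 M) (hQU : EqOn Q U (Icc (-1) 1))
    (hMV : EqOn M V (Icc (-1) 1))
    (hU : ∀ y, HasDerivAt U (U' y) y) (hV : ∀ y, HasDerivAt V (V' y) y)
    (hU' : ∀ y ∈ Icc (-1 : ℝ) 1, HasDerivAt U' ((4 * U y * (U y ^ 2 - 1) - c * V y ^ 2) / l) y)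
    (hV' : ∀ y ∈ Icc (-1 : ℝ) 1,
      HasDerivAt V' ((V y * (V y ^ 2 - 1) - 2 * c * U y * V y) / l) y)
    (hU'c : Continuous U') (hV'c : Continuous V')
    (hζ : ζ ∈ Ioo (0 : ℝ) 1) (hUζ : U ζ = θ) (hU1 : U 1 = -1) (hkθ : k * (1 + θ) = 2 * θ)
    (hβ : ∀ y ∈ Icc (-1 : ℝ) 1, HasDerivAt β (β' y) y) (hβ'c : ContinuousOn β' (Icc (-1) 1))
    (hΛ : ∀ y ∈ Icc (-1 : ℝ) 1, HasDerivAt Λ (Λ' y) y)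
    (hβ1 : β 1 = 0) (hβζ : β ζ = 1) (hΛ1 : Λ 1 = 0)
    (hslope : ∀ y ∈ Icc ζ 1, k ^ 2 * U' y ^ 2 + V y ^ 2 * β' y ^ 2 ≤ U' y * Λ' y) :
    ∃ η : Profile, IsPerturbation η ∧ secondVariation l c (orProfile Q M) η ≤
      l * (∫ y in (-1 : ℝ)..0, (4 * U y ^ 2 + V y ^ 2)) + l * (4 * θ - Λ ζ) * U' ζ
        + ∫ y in ζ..1, (-((1 - U y ^ 2) * (4 * k ^ 2 * (1 + U y) ^ 2 - 4 * U y * Λ y))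
          + c * V y ^ 2 * (Λ y + 4 * U y * β y ^ 2 - 4 * k * (1 + U y) * β y)) := by
  have Uc : Continuous U := continuous_iff_continuousAt.mpr fun y => (hU y).continuousAt
  have Vc : Continuous V := continuous_iff_continuousAt.mpr fun y => (hV y).continuousAt
  have hβc : ContinuousOn β (Icc (-1) 1) := fun y hy =>
    (hβ y hy).continuousAt.continuousWithinAt
  have hΛc : ContinuousOn Λ (Icc (-1) 1) := fun y hy =>
    (hΛ y hy).continuousAt.continuousWithinAt
  have Uco : ContinuousOn U (Icc (-1) 1) := Uc.continuousOn
  have Vco : ContinuousOn V (Icc (-1) 1) := Vc.continuousOn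
  have U'co : ContinuousOn U' (Icc (-1) 1) := hU'c.continuousOn
  have V'co : ContinuousOn V' (Icc (-1) 1) := hV'c.continuousOn
  have hI : Icc ζ 1 ⊆ Icc (-1 : ℝ) 1 := Icc_subset_Icc_left (by linarith [hζ.1])
  obtain ⟨memq, dq⟩ := memW12_glue (a := 0) (b := ζ) (f₁ := fun y => 2 * ((1 + y) * U y))
    (f₂ := fun y => 2 * U y) (f₃ := fun y => k * (1 + U y))
    (f₁' := fun y => 2 * (U y + (1 + y) * U' y))
    (f₂' := fun y => 2 * U' y) (f₃' := fun y => k * U' y) hζ.1.le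
    (fun y _ => (((((hasDerivAt_id y).const_add 1).mul (hU y)).const_mul 2).congr_deriv
      (by simp)))
    (fun y _ => (hU y).const_mul 2) (fun y _ => ((hU y).const_add 1).const_mul k)
    (by fun_prop) (by fun_prop) (by fun_prop) (by simp)
    (by simp only [hUζ]; linarith)
  obtain ⟨memm, dm⟩ := memW12_glue (a := 0) (b := ζ) (f₁ := fun y => (1 + y) * V y)
    (f₂ := V) (f₃ := fun y => V y * β y) (f₁' := fun y => V y + (1 + y) * V' y)
    (f₂' := V') (f₃' := fun y => V' y * β y + V y * β' y) hζ.1.le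
    (fun y _ => ((((hasDerivAt_id y).const_add 1).mul (hV y)).congr_deriv
      (by simp)))
    (fun y _ => hV y) (fun y hy => (hV y).mul (hβ y hy))
    (by fun_prop) V'co (by fun_prop) (by simp)
    (by simp [hβζ])
  have hend : ∀ f₁ f₂ f₃ : ℝ → ℝ, glue 0 ζ f₁ f₂ f₃ (-1) = f₁ (-1) ∧
      glue 0 ζ f₁ f₂ f₃ 1 = f₃ 1 := by
    intro f₁ f₂ f₃
    constructor
    · simp [glue]
    · simp only [glue]
      rw [if_neg (by norm_num), if_neg (by linarith [hζ.2])]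
  have q0 := (hend (fun y => 2 * ((1 + y) * U y)) (fun y => 2 * U y) (fun y => k * (1 + U y))).1
  have q1 := (hend (fun y => 2 * ((1 + y) * U y)) (fun y => 2 * U y) (fun y => k * (1 + U y))).2
  have m0 := (hend (fun y => (1 + y) * V y) V (fun y => V y * β y)).1
  have m1 := (hend (fun y => (1 + y) * V y) V (fun y => V y * β y)).2
  set q := glue 0 ζ (fun y => 2 * ((1 + y) * U y)) (fun y => 2 * U y) (fun y => k * (1 + U y))
    with hq
  set m := glue 0 ζ (fun y => (1 + y) * V y) V (fun y => V y * β y) with hm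
  set η : Profile := ⟨fun _ => 0, q, fun _ => 0, m⟩ with hη
  have hpert : IsPerturbation η :=
    ⟨memW12Zero_zero, ⟨memq, q0.trans (by simp), q1.trans (by simp [hU1])⟩,
      memW12Zero_zero, ⟨memm, m0.trans (by simp), m1.trans (by simp [hβ1])⟩⟩
  refine ⟨η, hpert, ?_⟩
  rw [secondVariation_orProfile hQ hM hpert, ← integral_const_mul]
  set F₁ : ℝ → ℝ := fun y => transverseDensity l c (U y) (V y) (2 * ((1 + y) * U y))
    (2 * (U y + (1 + y) * U' y)) ((1 + y) * V y) (V y + (1 + y) * V' y) with hF₁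
  set F₂ : ℝ → ℝ := fun y => transverseDensity l c (U y) (V y) (2 * U y) (2 * U' y) (V y) (V' y)
    with hF₂
  set F₃ : ℝ → ℝ := fun y => transverseDensity l c (U y) (V y) (k * (1 + U y)) (k * U' y)
    (V y * β y) (V' y * β y + V y * β' y) with hF₃
  have hF : ∫ y in Ioo (-1 : ℝ) 1, 2 * density₂ l c Q M η y =
      ∫ y in Ioo (-1 : ℝ) 1, glue 0 ζ F₁ F₂ F₃ y := by
    apply integral_congr_ae
    filter_upwards [dq, dm, weakDeriv_zero_ae_eq, ae_restrict_mem measurableSet_Ioo]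
      with y e1 e2 e3 hy
    have hy' := Ioo_subset_Icc_self hy
    simp only [density₂, hη, e1, e2, e3, hQU hy', hMV hy']
    simp only [hq, hm, glue, F₁, F₂, F₃, transverseDensity]
    split_ifs <;> ring
  have cF₁ : ContinuousOn F₁ (Icc (-1) 1) := by simp only [F₁, transverseDensity]; fun_prop
  have cF₂ : ContinuousOn F₂ (Icc (-1) 1) := by simp only [F₂, transverseDensity]; fun_prop
  have cF₃ : ContinuousOn F₃ (Icc (-1) 1) := by simp only [F₃, transverseDensity]; fun_prop
  rw [hF, integral_glue (by norm_num) hζ.1.le hζ.2.le cF₁ cF₂ cF₃]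
  have hUU : ∀ y ∈ Icc (-1 : ℝ) 1, HasDerivAt (fun y => 4 * (U y * U' y) + V y * V' y)
      (4 * (U' y * U' y + U y * ((4 * U y * (U y ^ 2 - 1) - c * V y ^ 2) / l))
        + (V' y * V' y + V y * ((V y * (V y ^ 2 - 1) - 2 * c * U y * V y) / l))) y := fun y hy =>
    (((hU y).mul (hU' y hy)).const_mul 4).add ((hV y).mul (hV' y hy))
  -- For a solution `w` of the linearised equations and a cutoff `χ`, the density of `χ w` is an
  -- exact derivative plus `l χ'² |w|²`; here `χ = 1 + y`.
  have piece₁ := integral_le_of_le_deriv_add (a := -1) (b := 0) (by norm_num) (φ := F₁)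
    (ρ := fun y => l * (4 * U y ^ 2 + V y ^ 2))
    (g := fun y => l * ((1 + y) ^ 2 * (4 * (U y * U' y) + V y * V' y)))
    (cF₁.mono (Icc_subset_Icc_right (by norm_num))) (by fun_prop)
    (fun y hy => ((((hasDerivAt_id y).const_add 1).pow 2).mul
      (hUU y (Icc_subset_Icc_right (by norm_num) hy))).const_mul l)
    (fun y hy => by
      simp only [F₁, transverseDensity]
      apply le_of_eq
      simp
      field_simp
      ring)
  have piece₂ := integral_le_of_le_deriv_add (a := 0) (b := ζ) hζ.1.le (φ := F₂)
    (ρ := fun _ => 0)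
    (g := fun y => l * (4 * (U y * U' y) + V y * V' y))
    (cF₂.mono (Icc_subset_Icc (by norm_num) hζ.2.le)) (by fun_prop)
    (fun y hy => (hUU y (Icc_subset_Icc (by norm_num) hζ.2.le hy)).const_mul l)
    (fun y hy => by
      simp only [F₂, transverseDensity]
      apply le_of_eq
      field_simp
      ring)
  -- `hslope` replaces the squares of `U'` and `β'` by `U' Λ'`, which is `(U'Λ)' - U''Λ`; the
  -- Euler–Lagrange equation then eliminates `U''`.
  have piece₃ := integral_le_of_le_deriv_add (a := ζ) (b := 1) hζ.2.le (φ := F₃)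
    (ρ := fun y => -((1 - U y ^ 2) * (4 * k ^ 2 * (1 + U y) ^ 2 - 4 * U y * Λ y))
          + c * V y ^ 2 * (Λ y + 4 * U y * β y ^ 2 - 4 * k * (1 + U y) * β y))
    (g := fun y => l * (V y * V' y * β y ^ 2 + U' y * Λ y))
    (g' := fun y => l * ((V' y * V' y + V y * ((V y * (V y ^ 2 - 1) - 2 * c * U y * V y) / l))
        * β y ^ 2 + V y * V' y * (2 * β y * β' y)
        + ((4 * U y * (U y ^ 2 - 1) - c * V y ^ 2) / l * Λ y + U' y * Λ' y)))
    (cF₃.mono hI)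
    (ContinuousOn.mono (by fun_prop) hI)
    (fun y hy => (((((hV y).mul (hV' y (hI hy))).mul ((hβ y (hI hy)).pow 2)).add
      ((hU' y (hI hy)).mul (hΛ y (hI hy)))).const_mul l).congr_deriv (by simp))
    (fun y hy => by
      have hs := mul_le_mul_of_nonneg_left (hslope y hy) hl.le
      have e : F₃ y = l * ((V' y * V' y + V y * ((V y * (V y ^ 2 - 1) - 2 * c * U y * V y) / l))
        * β y ^ 2 + V y * V' y * (2 * β y * β' y)
        + ((4 * U y * (U y ^ 2 - 1) - c * V y ^ 2) / l * Λ y + U' y * Λ' y))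
        + (-((1 - U y ^ 2) * (4 * k ^ 2 * (1 + U y) ^ 2 - 4 * U y * Λ y))
          + c * V y ^ 2 * (Λ y + 4 * U y * β y ^ 2 - 4 * k * (1 + U y) * β y))
        - (l * (U' y * Λ' y) - l * (k ^ 2 * U' y ^ 2 + V y ^ 2 * β' y ^ 2)) := by
        simp only [F₃, transverseDensity]
        field_simp
        ring
      linarith)
  rw [intervalIntegral.integral_const_mul] at piece₁
  simp only [intervalIntegral.integral_zero] at piece₂
  -- The boundary terms cancel at `0`, and at `ζ` up to `l (4θ - Λ ζ) U' ζ`.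
  simp only [hUζ, hβζ, hβ1, hΛ1] at piece₃ piece₂
  norm_num at piece₁ piece₂ piece₃
  linarith

/-! ### The energy of a minimiser -/

/-- The bulk potential of the order reconstruction problem. -/
noncomputable def potential (c Q M : ℝ) : ℝ :=
  (Q ^ 2 - 1) ^ 2 + 1 / 4 * (M ^ 2 - 1) ^ 2 - c * Q * M ^ 2

/-- The bulk potential, minimised over `M` (for `1 + 2cQ ≥ 0`). -/
def reducedPotential (c Q : ℝ) : ℝ := (Q ^ 2 - 1) ^ 2 - c * Q - c ^ 2 * Q ^ 2

theorem reducedPotential_le_potential (c Q M : ℝ) : reducedPotential c Q ≤ potential c Q M := by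
  have : potential c Q M = reducedPotential c Q + 1 / 4 * (M ^ 2 - 1 - 2 * c * Q) ^ 2 := by
    rw [potential, reducedPotential]; ring
  rw [this]
  linarith [sq_nonneg (M ^ 2 - 1 - 2 * c * Q)]

theorem potential_sqrt {c Q : ℝ} (hc : 0 < c) (hQ : 0 ≤ Q) :
    potential c Q (Real.sqrt (1 + 2 * c * Q)) = reducedPotential c Q := by
  rw [potential, reducedPotential, Real.sq_sqrt (by positivity)]
  ring

/-- The reduced potential is coercive, hence has a minimiser. Replacing it by its absolute value
does not raise the value and makes `1 + 2cQ` positive, so the optimal `M` is real. -/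
theorem exists_potential_min {c : ℝ} (hc : 0 < c) :
    ∃ ρ μ : ℝ, ∀ Q M, potential c ρ μ ≤ potential c Q M := by
  have hcont : Continuous (reducedPotential c) := by unfold reducedPotential; fun_prop
  obtain ⟨ρ, -, hmin⟩ := (isCompact_Icc (a := -(2 + c)) (b := 2 + c)).exists_isMinOn
    (nonempty_Icc.mpr (by linarith)) hcont.continuousOn
  have hglob : ∀ Q, reducedPotential c ρ ≤ reducedPotential c Q := by
    intro Q
    by_cases hQ : Q ∈ Icc (-(2 + c)) (2 + c)
    · exact hmin hQ
    · have h0 : reducedPotential c ρ ≤ reducedPotential c 0 :=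
        hmin ⟨by linarith, by linarith⟩
      refine h0.trans ?_
      have h1 : 2 + c < |Q| := by
        by_contra! h
        exact hQ (abs_le.mp h)
      have h2 : (2 + c) ^ 2 ≤ |Q| ^ 2 := by gcongr
      rw [sq_abs] at h2
      have h3 : Q ^ 2 = |Q| ^ 2 := (sq_abs Q).symm
      have h4 : Q ≤ |Q| := le_abs_self Q
      have h5 : |Q| ≤ Q ^ 2 := by rw [h3]; nlinarith
      have h6 : 0 ≤ Q ^ 2 * (Q ^ 2 - (2 + c ^ 2 + c)) :=
        mul_nonneg (sq_nonneg Q) (by nlinarith)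
      simp only [reducedPotential]
      nlinarith [mul_le_mul_of_nonneg_left (h4.trans h5) hc.le]
  have habs : reducedPotential c |ρ| ≤ reducedPotential c ρ := by
    simp only [reducedPotential, sq_abs]
    linarith [mul_le_mul_of_nonneg_left (le_abs_self ρ) hc.le]
  refine ⟨|ρ|, Real.sqrt (1 + 2 * c * |ρ|), fun Q M => ?_⟩
  rw [potential_sqrt hc (abs_nonneg ρ)]
  exact (habs.trans (hglob Q)).trans (reducedPotential_le_potential c Q M)

theorem intervalIntegral_le_mul {φ : ℝ → ℝ} {a b C : ℝ} (hab : a ≤ b)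
    (hφ : ContinuousOn φ (Icc a b)) (hC : ∀ s ∈ Icc a b, φ s ≤ C) :
    ∫ s in a..b, φ s ≤ C * (b - a) := by
  have := integral_le_sub_of_le_deriv hab hφ (g := fun s => C * s) (g' := fun _ => C)
    (by fun_prop) (fun s _ => by simpa using (hasDerivAt_id s).const_mul C)
    (fun s hs => hC s (Ioo_subset_Icc_self hs))
  linarith

/-- The competitor sits at `(ρ, μ)` except for linear ramps of width `√l` at the walls, where
gradient and potential both cost `O(√l)`. -/
theorem orEnergy_glue_le {l c ε ρ μ B : ℝ} (hε : 0 < ε) (hε1 : ε < 1) (hl : l = ε ^ 2)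
    (hB : ∀ t ∈ Icc (0 : ℝ) 1, potential c (1 + (ρ - 1) * t) (1 + (μ - 1) * t) ≤ B ∧
      potential c (-1 + (ρ + 1) * t) (-1 + (μ + 1) * t) ≤ B) :
    ∃ P N : ℝ → ℝ, ORAdmissible P N ∧ orEnergy l c P N ≤ 2 * potential c ρ μ +
      (((ρ - 1) ^ 2 + (μ - 1) ^ 2 + (ρ + 1) ^ 2 + (μ + 1) ^ 2) / 2 + 2 * B
        - 2 * potential c ρ μ) * ε := by
  have hab : -1 + ε ≤ 1 - ε := by linarith
  have hlin : ∀ u w : ℝ, ∀ y, HasDerivAt (fun y => u + w * ((y + 1) / ε)) (w / ε) y := by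
    intro u w y
    refine (((((hasDerivAt_id y).add_const 1).div_const ε).const_mul w).const_add u).congr_deriv ?_
    ring
  have hlin' : ∀ u w : ℝ, ∀ y, HasDerivAt (fun y => u + w * ((1 - y) / ε)) (-(w / ε)) y := by
    intro u w y
    refine (((((hasDerivAt_id y).const_sub 1).div_const ε).const_mul w).const_add u).congr_deriv ?_
    ring
  have hglue : ∀ ρ : ℝ, MemW12 (glue (-1 + ε) (1 - ε) (fun y => 1 + (ρ - 1) * ((y + 1) / ε))
      (fun _ => ρ) (fun y => -1 + (ρ + 1) * ((1 - y) / ε))) ∧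
      weakDeriv (glue (-1 + ε) (1 - ε) (fun y => 1 + (ρ - 1) * ((y + 1) / ε))
      (fun _ => ρ) (fun y => -1 + (ρ + 1) * ((1 - y) / ε))) =ᵐ[volume.restrict (Ioo (-1) 1)]
      glue (-1 + ε) (1 - ε) (fun _ => (ρ - 1) / ε) (fun _ => 0) (fun _ => -((ρ + 1) / ε)) := by
    intro ρ
    exact memW12_glue hab (fun y _ => hlin 1 (ρ - 1) y) (fun y _ => hasDerivAt_const y ρ)
      (fun y _ => hlin' (-1) (ρ + 1) y) continuousOn_const continuousOn_const continuousOn_const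
      (by field_simp; ring) (by field_simp; ring)
  have hleft : ∀ ρ : ℝ, glue (-1 + ε) (1 - ε) (fun y => 1 + (ρ - 1) * ((y + 1) / ε))
      (fun _ => ρ) (fun y => -1 + (ρ + 1) * ((1 - y) / ε)) (-1) = 1 := by
    intro ρ
    simp only [glue]
    rw [if_pos (by linarith)]
    simp
  have hright : ∀ ρ : ℝ, glue (-1 + ε) (1 - ε) (fun y => 1 + (ρ - 1) * ((y + 1) / ε))
      (fun _ => ρ) (fun y => -1 + (ρ + 1) * ((1 - y) / ε)) 1 = -1 := by
    intro ρ
    simp only [glue]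
    rw [if_neg (by linarith), if_neg (by linarith)]
    simp
  refine ⟨_, _, ⟨(hglue ρ).1, (hglue μ).1, hleft ρ, hleft μ, hright ρ, hright μ⟩, ?_⟩
  set G₁ : ℝ → ℝ := fun y => l / 2 * ((ρ - 1) / ε) ^ 2 + l / 2 * ((μ - 1) / ε) ^ 2
    + potential c (1 + (ρ - 1) * ((y + 1) / ε)) (1 + (μ - 1) * ((y + 1) / ε)) with hG₁
  set G₃ : ℝ → ℝ := fun y => l / 2 * (-((ρ + 1) / ε)) ^ 2 + l / 2 * (-((μ + 1) / ε)) ^ 2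
    + potential c (-1 + (ρ + 1) * ((1 - y) / ε)) (-1 + (μ + 1) * ((1 - y) / ε)) with hG₃
  have hE : ∀ P N : ℝ → ℝ, P = glue (-1 + ε) (1 - ε) (fun y => 1 + (ρ - 1) * ((y + 1) / ε))
      (fun _ => ρ) (fun y => -1 + (ρ + 1) * ((1 - y) / ε)) →
      N = glue (-1 + ε) (1 - ε) (fun y => 1 + (μ - 1) * ((y + 1) / ε))
      (fun _ => μ) (fun y => -1 + (μ + 1) * ((1 - y) / ε)) →
      orEnergy l c P N =
      ∫ y in Ioo (-1 : ℝ) 1, glue (-1 + ε) (1 - ε) G₁ (fun _ => potential c ρ μ) G₃ y := by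
    intro P N hP hN
    have h1 := (hglue ρ).2
    have h2 := (hglue μ).2
    rw [← hP] at h1
    rw [← hN] at h2
    rw [orEnergy]
    apply integral_congr_ae
    filter_upwards [h1, h2] with y e1 e2
    rw [e1, e2, hP, hN]
    simp only [glue, G₁, G₃, potential]
    split_ifs <;> ring
  rw [hE _ _ rfl rfl]
  have cG₁ : Continuous G₁ := by simp only [G₁, potential]; fun_prop
  have cG₃ : Continuous G₃ := by simp only [G₃, potential]; fun_prop
  rw [integral_glue (by linarith) hab (by linarith) cG₁.continuousOn continuousOn_const
    cG₃.continuousOn]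
  have b₁ := intervalIntegral_le_mul (show -1 ≤ -1 + ε by linarith) cG₁.continuousOn
    (C := ((ρ - 1) ^ 2 + (μ - 1) ^ 2) / 2 + B) (fun y hy => by
      have := (hB ((y + 1) / ε) ⟨div_nonneg (by linarith [hy.1]) hε.le,
        (div_le_one hε).mpr (by linarith [hy.2])⟩).1
      simp only [G₁]
      have e : l / 2 * ((ρ - 1) / ε) ^ 2 + l / 2 * ((μ - 1) / ε) ^ 2 =
          ((ρ - 1) ^ 2 + (μ - 1) ^ 2) / 2 := by
        rw [hl]; field_simp
      linarith)
  have b₃ := intervalIntegral_le_mul (show 1 - ε ≤ 1 by linarith) cG₃.continuousOn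
    (C := ((ρ + 1) ^ 2 + (μ + 1) ^ 2) / 2 + B) (fun y hy => by
      have := (hB ((1 - y) / ε) ⟨div_nonneg (by linarith [hy.2]) hε.le,
        (div_le_one hε).mpr (by linarith [hy.1])⟩).2
      simp only [G₃]
      have e : l / 2 * (-((ρ + 1) / ε)) ^ 2 + l / 2 * (-((μ + 1) / ε)) ^ 2 =
          ((ρ + 1) ^ 2 + (μ + 1) ^ 2) / 2 := by
        rw [hl]; field_simp
      linarith)
  rw [intervalIntegral.integral_const, smul_eq_mul]
  nlinarith

/-- Near the wall `y = 1`, at a distance of order `√l`, the potential of a minimiser takes values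
below any given level above its minimum. -/
theorem exists_potential_lt {c T : ℝ} (hc : 0 < c) (hT : ∃ Q M, potential c Q M < T) :
    ∃ K : ℝ, 0 < K ∧ ∀ l, 0 < l → (K + 1) * Real.sqrt l < 1 → ∀ Q M : ℝ → ℝ,
      IsORMinimiser l c Q M →
        ∃ y ∈ Ioo (1 - K * Real.sqrt l) 1, potential c (Q y) (M y) < T := by
  obtain ⟨ρ, μ, hmin⟩ := exists_potential_min hc
  have hTm : potential c ρ μ < T := by
    obtain ⟨Q, M, hQM⟩ := hT
    exact (hmin Q M).trans_lt hQM
  have hcont₁ : Continuous fun t => potential c (1 + (ρ - 1) * t) (1 + (μ - 1) * t) := by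
    simp only [potential]; fun_prop
  have hcont₂ : Continuous fun t => potential c (-1 + (ρ + 1) * t) (-1 + (μ + 1) * t) := by
    simp only [potential]; fun_prop
  obtain ⟨B₁, hB₁⟩ := isCompact_Icc.exists_bound_of_continuousOn
    (hcont₁.continuousOn (s := Icc (0 : ℝ) 1))
  obtain ⟨B₂, hB₂⟩ := isCompact_Icc.exists_bound_of_continuousOn
    (hcont₂.continuousOn (s := Icc (0 : ℝ) 1))
  set C := ((ρ - 1) ^ 2 + (μ - 1) ^ 2 + (ρ + 1) ^ 2 + (μ + 1) ^ 2) / 2 + 2 * max B₁ B₂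
        - 2 * potential c ρ μ with hC
  refine ⟨(|C| + 1) / (T - potential c ρ μ), div_pos (by positivity) (by linarith), ?_⟩
  intro l hl hKl Q M hQM
  -- Chosen so that an excess `T - potential c ρ μ` on a layer of width `K √l` costs `(|C| + 1) √l`,
  -- more than the competitor's `C √l`.
  set K := (|C| + 1) / (T - potential c ρ μ) with hK
  have hK0 : 0 < K := div_pos (by positivity) (by linarith)
  set ε := Real.sqrt l with hε
  have hε0 : 0 < ε := Real.sqrt_pos.mpr hl
  have hKε : 0 < K * ε := by positivity
  by_contra! hcon
  obtain ⟨P, N, hPN, hE⟩ := orEnergy_glue_le (c := c) (ρ := ρ) (μ := μ) (B := max B₁ B₂) hε0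
    (by nlinarith) (Real.sq_sqrt hl.le).symm (fun t ht =>
      ⟨((le_abs_self _).trans (hB₁ t ht)).trans (le_max_left _ _),
        ((le_abs_self _).trans (hB₂ t ht)).trans (le_max_right _ _)⟩)
  have hup := (hQM.2 P N hPN).trans hE
  have hlow : 2 * potential c ρ μ + (T - potential c ρ μ) * (K * ε) ≤ orEnergy l c Q M := by
    have hsub : Ioo (1 - K * ε) 1 ⊆ Ioo (-1 : ℝ) 1 := Ioo_subset_Ioo_left (by nlinarith)
    have e : ∫ y in Ioo (-1 : ℝ) 1, (potential c ρ μ +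
        (Ioo (1 - K * ε) 1).indicator (fun _ => T - potential c ρ μ) y) =
        2 * potential c ρ μ + (T - potential c ρ μ) * (K * ε) := by
      have hi : Integrable ((Ioo (1 - K * ε) 1).indicator (fun _ => T - potential c ρ μ))
          (volume.restrict (Ioo (-1 : ℝ) 1)) :=
        (integrable_const _).indicator measurableSet_Ioo
      rw [integral_add (integrable_const _) hi, setIntegral_const,
        integral_indicator measurableSet_Ioo, Measure.restrict_restrict measurableSet_Ioo,
        inter_eq_left.mpr hsub, setIntegral_const]
      simp only [measureReal_def, Real.volume_Ioo, smul_eq_mul]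
      rw [ENNReal.toReal_ofReal (by norm_num), ENNReal.toReal_ofReal (by linarith)]
      ring
    rw [← e, orEnergy_eq_integral_density₀]
    apply setIntegral_mono_on
    · exact (integrable_const _).add ((integrable_const _).indicator measurableSet_Ioo)
    · exact integrableOn_density₀ hQM.1.memQ hQM.1.memM
    · exact measurableSet_Ioo
    · intro y hy
      have h1 : potential c ρ μ + (Ioo (1 - K * ε) 1).indicator (fun _ => T - potential c ρ μ) y
          ≤ potential c (Q y) (M y) := by
        by_cases hy' : y ∈ Ioo (1 - K * ε) 1
        · rw [indicator_of_mem hy']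
          linarith [hcon y hy']
        · rw [indicator_of_notMem hy']
          linarith [hmin (Q y) (M y)]
      refine h1.trans ?_
      simp only [density₀, potential]
      have : 0 ≤ l / 2 * weakDeriv Q y ^ 2 + l / 2 * weakDeriv M y ^ 2 := by positivity
      linarith
  have hTK : (T - potential c ρ μ) * (K * ε) = (|C| + 1) * ε := by
    rw [hK]; field_simp [(sub_pos.mpr hTm).ne']
  rw [hTK] at hlow
  have : C * ε ≤ |C| * ε := mul_le_mul_of_nonneg_right (le_abs_self C) hε0.le
  nlinarith

/-! ### Instability -/

namespace LayerSolution

variable {c L : ℝ} {X X' Y Y' : ℝ → ℝ}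

theorem deriv_nonneg_of_first_hit (h : LayerSolution c L X X' Y Y') {S θ : ℝ} (hS : 0 < S)
    (hXS : X S = θ) (hlt : ∀ s ∈ Ico 0 S, X s < θ) : 0 ≤ X' S := by
  by_contra! hneg
  have hev : ∀ᶠ s in nhdsWithin S (Iio S), slope X S s < 0 :=
    ((hasDerivAt_iff_tendsto_slope.mp (h.hX S)).eventually (gt_mem_nhds hneg)).filter_mono
      (nhdsWithin_mono _ fun x hx => ne_of_lt hx)
  obtain ⟨s, hs1, hs2, hs3⟩ := (hev.and (Ioo_mem_nhdsLT hS)).exists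
  rw [slope_def_field, hXS] at hs1
  have h1 := hlt s ⟨hs2.le, hs3⟩
  have := div_pos_of_neg_of_neg (sub_neg.mpr h1) (sub_neg.mpr hs3)
  linarith

theorem exists_first_hit (h : LayerSolution c L X X' Y Y') {t θ : ℝ} (ht : 0 ≤ t)
    (hθ : -1 < θ) (hXt : θ < X t) :
    ∃ S ∈ Ioc 0 t, X S = θ ∧ ∀ s ∈ Ico 0 S, X s < θ := by
  have hcomp : IsCompact (Icc 0 t ∩ X ⁻¹' Ici θ) :=
    isCompact_Icc.inter_right (isClosed_Ici.preimage h.continuous_X)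
  obtain ⟨S, ⟨hS, hXS⟩, hmin⟩ := hcomp.exists_isLeast ⟨t, ⟨ht, le_rfl⟩, hXt.le⟩
  have hXS' : θ ≤ X S := hXS
  have hS0 : 0 < S := lt_of_le_of_ne hS.1 (by
    rintro rfl
    linarith [h.X_zero])
  have hlt : ∀ s ∈ Ico 0 S, X s < θ := by
    intro s hs
    by_contra! h1
    exact absurd (hmin ⟨⟨hs.1, hs.2.le.trans hS.2⟩, h1⟩) (not_le.mpr hs.2)
  refine ⟨S, ⟨hS0, hS.2⟩, le_antisymm ?_ hXS', hlt⟩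
  have hcw : ContinuousWithinAt X (Iio S) S := h.continuous_X.continuousWithinAt
  exact le_of_tendsto hcw (by
    filter_upwards [Ioo_mem_nhdsLT hS0] with q hq using (hlt q ⟨hq.1.le, hq.2⟩).le)

end LayerSolution

/-- A classical solution of the Euler–Lagrange equations, rescaled at the wall `y = 1`. -/
theorem layerSolution_of_classical {l c : ℝ} {U U' V V' : ℝ → ℝ} (hl : 0 < l)
    (hU : ∀ y, HasDerivAt U (U' y) y) (hV : ∀ y, HasDerivAt V (V' y) y)
    (hU' : ∀ y ∈ Icc (-1 : ℝ) 1, HasDerivAt U' ((4 * U y * (U y ^ 2 - 1) - c * V y ^ 2) / l) y)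
    (hV' : ∀ y ∈ Icc (-1 : ℝ) 1,
      HasDerivAt V' ((V y * (V y ^ 2 - 1) - 2 * c * U y * V y) / l) y)
    (hUl : U (-1) = 1) (hVl : V (-1) = 1) (hUr : U 1 = -1) (hVr : V 1 = -1) :
    LayerSolution c (2 / Real.sqrt l) (fun s => U (1 - Real.sqrt l * s))
      (fun s => -Real.sqrt l * U' (1 - Real.sqrt l * s)) (fun s => V (1 - Real.sqrt l * s))
      (fun s => -Real.sqrt l * V' (1 - Real.sqrt l * s)) := by
  set ε := Real.sqrt l with hε
  have hε0 : 0 < ε := Real.sqrt_pos.mpr hl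
  have hεl : ε * ε = l := Real.mul_self_sqrt hl.le
  have hlin : ∀ s, HasDerivAt (fun s => 1 - ε * s) (-ε) s := fun s => by
    simpa using ((hasDerivAt_id s).const_mul ε).const_sub 1
  have hmem : ∀ s ∈ Icc 0 (2 / ε), 1 - ε * s ∈ Icc (-1 : ℝ) 1 := by
    intro s hs
    have h1 : ε * s ≤ 2 := by
      have := (le_div_iff₀ hε0).mp hs.2
      linarith
    have h2 : 0 ≤ ε * s := mul_nonneg hε0.le hs.1
    constructor <;> linarith
  have hend : 1 - ε * (2 / ε) = -1 := by field_simp; norm_num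
  constructor
  · positivity
  · exact fun s => ((hU _).comp s (hlin s)).congr_deriv (by ring)
  · exact fun s => ((hV _).comp s (hlin s)).congr_deriv (by ring)
  · intro s hs
    refine (((hU' _ (hmem s hs)).comp s (hlin s)).const_mul (-ε)).congr_deriv ?_
    rw [← hεl]
    field_simp
  · intro s hs
    refine (((hV' _ (hmem s hs)).comp s (hlin s)).const_mul (-ε)).congr_deriv ?_
    rw [← hεl]
    field_simp
  · simp [hUr]
  · simp [hVr]
  · simp only [hend, hUl]
  · simp only [hend, hVl]

/-- Instability of the OR minimisers for small `l`, reduced to a negative upper bound for the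
layer integral at the wall. -/
theorem exists_threshold_of_layer_bound {c θ k T δ : ℝ} {b b' Λ Λ' : ℝ → ℝ} (hc : 0 < c)
    (hδ : 0 < δ) (hθ : -1 < θ) (hkθ : k * (1 + θ) = 2 * θ)
    (hT : ∃ Q M, potential c Q M < T)
    (hθT : ∀ Q M, -1 ≤ Q → potential c Q M < T → θ < Q)
    (hb : ∀ v, 0 ≤ v → HasDerivAt b (b' v) v) (hb'c : ContinuousOn b' (Ici 0))
    (hΛ : ∀ v, 0 ≤ v → HasDerivAt Λ (Λ' v) v)
    (hb0 : b 0 = 0) (hbθ : b (1 + θ) = 1) (hΛ0 : Λ 0 = 0)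
    (hslope : ∀ (L : ℝ) (X X' Y Y' : ℝ → ℝ), LayerSolution c L X X' Y Y' → ∀ s ∈ Icc 0 L,
      k ^ 2 + Y s ^ 2 * b' (1 + X s) ^ 2 ≤ Λ' (1 + X s))
    (hlayer : ∀ (L S r : ℝ) (X X' Y Y' : ℝ → ℝ), LayerSolution c L X X' Y Y' → 0 < S →
      S + 1 ≤ L → X S = θ → (∀ s ∈ Ico 0 S, X s < θ) → r ∈ Icc 0 L → potential c (X r) (Y r) < T →
      -((4 * θ - Λ (1 + θ)) * X' S) + (∫ s in (0 : ℝ)..S,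
        (-((1 - X s ^ 2) * (4 * k ^ 2 * (1 + X s) ^ 2 - 4 * X s * Λ (1 + X s)))
          + c * Y s ^ 2 * (Λ (1 + X s) + 4 * X s * b (1 + X s) ^ 2
            - 4 * k * (1 + X s) * b (1 + X s)))) ≤ -δ) :
    ∃ l₀ : ℝ, 0 < l₀ ∧ ∀ l : ℝ, 0 < l → l < l₀ → ∀ Q M : ℝ → ℝ, IsORMinimiser l c Q M →
      IsUnstableCriticalPoint l c (orProfile Q M) := by
  obtain ⟨K, hK, hKmin⟩ := exists_potential_lt hc hT
  set A := 4 * (1 + 18 / 25 * c) ^ 2 + (1 + 2 * c * (1 + 18 / 25 * c)) with hA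
  have hA0 : 0 < A := by positivity
  -- The first bound keeps the layer inside `(0, 1)` with room for a unit of stretched length beyond
  -- it; the second makes the ramp cost `A l` smaller than the gain `δ √l`.
  set ε₀ := min (1 / (K + 1)) (δ / A) with hε₀
  have hε₀0 : 0 < ε₀ := lt_min (by positivity) (by positivity)
  refine ⟨ε₀ ^ 2, by positivity, fun l hl hll Q M hQM => ⟨hQM.isCriticalPoint, ?_⟩⟩
  set ε := Real.sqrt l with hε
  have hε0 : 0 < ε := Real.sqrt_pos.mpr hl
  have hεl : ε * ε = l := Real.mul_self_sqrt hl.le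
  have hεε₀ : ε < ε₀ := (Real.sqrt_lt' hε₀0).mpr hll
  have hKε : (K + 1) * ε < 1 := by
    have := (lt_div_iff₀ (by positivity)).mp (hεε₀.trans_le (min_le_left _ _))
    linarith
  have hAε : A * ε < δ := by
    have := (lt_div_iff₀ hA0).mp (hεε₀.trans_le (min_le_right _ _))
    linarith
  obtain ⟨U, U', V, V', hQU, hMV, hU, hV, hU', hV', -, -, hU'c, hV'c⟩ := hQM.exists_classical hl
  have hm1 : (-1 : ℝ) ∈ Icc (-1 : ℝ) 1 := by constructor <;> norm_num
  have hp1 : (1 : ℝ) ∈ Icc (-1 : ℝ) 1 := by constructor <;> norm_num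
  have hUr : U 1 = -1 := (hQU hp1).symm.trans hQM.1.Q_right
  have hsol := layerSolution_of_classical hl hU hV hU' hV' ((hQU hm1).symm.trans hQM.1.Q_left)
    ((hMV hm1).symm.trans hQM.1.M_left) hUr ((hMV hp1).symm.trans hQM.1.M_right)
  rw [← hε] at hsol
  have hback : ∀ y ∈ Icc (-1 : ℝ) 1, (1 - y) / ε ∈ Icc 0 (2 / ε) ∧ 1 - ε * ((1 - y) / ε) = y := by
    intro y hy
    refine ⟨⟨div_nonneg (by linarith [hy.2]) hε0.le,
      div_le_div_of_nonneg_right (by linarith [hy.1]) hε0.le⟩, ?_⟩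
    field_simp
    ring
  have hUlow : ∀ y ∈ Icc (-1 : ℝ) 1, -1 ≤ U y := by
    intro y hy
    have := hsol.neg_one_le_X hc _ (hback y hy).1
    simpa only [(hback y hy).2] using this
  have hUhigh : ∀ y ∈ Icc (-1 : ℝ) 1, U y ≤ 1 + 18 / 25 * c := by
    intro y hy
    have := hsol.X_le hc _ (hback y hy).1
    simpa only [(hback y hy).2] using this
  have hVhigh : ∀ y ∈ Icc (-1 : ℝ) 1, V y ^ 2 ≤ 1 + 2 * c * (1 + 18 / 25 * c) := by
    intro y hy
    have := hsol.sq_Y_le hc _ (hback y hy).1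
    simpa only [(hback y hy).2] using this
  have hslope' : ∀ y ∈ Icc (-1 : ℝ) 1, k ^ 2 + V y ^ 2 * b' (1 + U y) ^ 2 ≤ Λ' (1 + U y) := by
    intro y hy
    have := hslope _ _ _ _ _ hsol _ (hback y hy).1
    simpa only [(hback y hy).2] using this
  obtain ⟨y₀, hy₀, hpot⟩ := hKmin l hl hKε Q M hQM
  have hy₀I : y₀ ∈ Icc (-1 : ℝ) 1 := ⟨by nlinarith [hy₀.1], hy₀.2.le⟩
  rw [hQU hy₀I, hMV hy₀I] at hpot
  have hUy₀ := hθT _ _ (hUlow y₀ hy₀I) hpot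
  obtain ⟨S, hS, hXS, hlt⟩ := hsol.exists_first_hit (t := (1 - y₀) / ε) (hback y₀ hy₀I).1.1 hθ
    (by simpa only [(hback y₀ hy₀I).2] using hUy₀)
  have hSK : S < K := by
    refine hS.2.trans_lt ?_
    rw [div_lt_iff₀ hε0]
    linarith [hy₀.1]
  have hSL : S + 1 ≤ 2 / ε := by
    rw [le_div_iff₀ hε0]
    nlinarith
  have hbound := hlayer _ S ((1 - y₀) / ε) _ _ _ _ hsol hS.1 hSL hXS hlt (hback y₀ hy₀I).1
    (by simpa only [(hback y₀ hy₀I).2] using hpot)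
  set ζ := 1 - ε * S with hζ
  have hζI : ζ ∈ Ioo (0 : ℝ) 1 := by
    have h1 : 0 < ε * S := mul_pos hε0 hS.1
    have h2 : ε * S < ε * K := mul_lt_mul_of_pos_left hSK hε0
    constructor <;> linarith
  have hUζ : U ζ = θ := hXS
  have hv0 : ∀ y ∈ Icc (-1 : ℝ) 1, 0 ≤ 1 + U y := fun y hy => by linarith [hUlow y hy]
  have hUc : Continuous U := continuous_iff_continuousAt.mpr fun y => (hU y).continuousAt
  have hVc : Continuous V := continuous_iff_continuousAt.mpr fun y => (hV y).continuousAt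
  have hvc : ContinuousOn (fun y => 1 + U y) (Icc (-1) 1) := (continuous_const.add hUc).continuousOn
  obtain ⟨η, hη, hle⟩ := exists_isPerturbation_secondVariation_le hl hQM.1.memQ hQM.1.memM hQU hMV
    hU hV hU' hV' hU'c hV'c hζI hUζ hUr hkθ
    (β := fun y => b (1 + U y)) (β' := fun y => b' (1 + U y) * U' y)
    (Λ := fun y => Λ (1 + U y)) (Λ' := fun y => Λ' (1 + U y) * U' y)
    (fun y hy => (hb _ (hv0 y hy)).comp y ((hU y).const_add 1))
    ((hb'c.comp hvc fun y hy => hv0 y hy).mul hU'c.continuousOn)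
    (fun y hy => (hΛ _ (hv0 y hy)).comp y ((hU y).const_add 1))
    (by simp [hUr, hb0]) (by simp only [hUζ, hbθ]) (by simp [hUr, hΛ0])
    (fun y hy => by
      have := mul_le_mul_of_nonneg_left
        (hslope' y (Icc_subset_Icc_left (by linarith [hζI.1]) hy)) (sq_nonneg (U' y))
      linarith)
  refine ⟨η, hη, hle.trans_lt ?_⟩
  have hint1 : ∫ y in (-1 : ℝ)..0, (4 * U y ^ 2 + V y ^ 2) ≤ A := by
    have := intervalIntegral_le_mul (a := -1) (b := 0) (by norm_num)
      (φ := fun y => 4 * U y ^ 2 + V y ^ 2) (by fun_prop) (C := A) (fun y hy => by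
        have hy' : y ∈ Icc (-1 : ℝ) 1 := ⟨hy.1, hy.2.trans (by norm_num)⟩
        have h1 := hUlow y hy'
        have h2 := hUhigh y hy'
        have h3 : U y ^ 2 ≤ (1 + 18 / 25 * c) ^ 2 := sq_le_sq' (by linarith) h2
        have h4 := hVhigh y hy'
        simp only [hA]
        linarith)
    linarith
  -- Back to `y = 1 - √l s`: the layer integral gains a factor `√l`, and so does the boundary term,
  -- since `X' S = -√l U' ζ`.
  have hint2 := intervalIntegral.integral_comp_sub_mul (a := 0) (b := S)
    (fun y => -((1 - U y ^ 2) * (4 * k ^ 2 * (1 + U y) ^ 2 - 4 * U y * Λ (1 + U y)))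
          + c * V y ^ 2 * (Λ (1 + U y) + 4 * U y * b (1 + U y) ^ 2
            - 4 * k * (1 + U y) * b (1 + U y))) hε0.ne' 1
  rw [mul_zero, sub_zero, ← hζ, smul_eq_mul] at hint2
  rw [hint2] at hbound
  set R := ∫ y in ζ..1, (-((1 - U y ^ 2) * (4 * k ^ 2 * (1 + U y) ^ 2 - 4 * U y * Λ (1 + U y)))
          + c * V y ^ 2 * (Λ (1 + U y) + 4 * U y * b (1 + U y) ^ 2
            - 4 * k * (1 + U y) * b (1 + U y))) with hR
  have hmul := mul_le_mul_of_nonneg_left hbound hε0.le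
  have e1 : ε * (-((4 * θ - Λ (1 + θ)) * (-ε * U' ζ)) + ε⁻¹ * R) =
      l * (4 * θ - Λ (1 + θ)) * U' ζ + R := by
    rw [← hεl]
    field_simp
  have e2 := mul_le_mul_of_nonneg_left hint1 hl.le
  have e3 : l * A < ε * δ := by
    rw [← hεl, mul_assoc]
    apply mul_lt_mul_of_pos_left _ hε0
    linarith
  simp only [hUζ]
  change ε * (-((4 * θ - Λ (1 + θ)) * (-ε * U' ζ)) + ε⁻¹ * R) ≤ ε * -δ at hmul
  rw [e1] at hmul
  linarith

/-! ### The three coupling regimes -/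

theorem potential_lt_neg_sub_sq {c : ℝ} (hc : 0 < c) : ∃ Q M, potential c Q M < -c - c ^ 2 := by
  set t := min 1 (c / 10) with ht
  have ht0 : 0 < t := lt_min one_pos (by positivity)
  have ht1 : t ≤ 1 := min_le_left _ _
  have htc : t ≤ c / 10 := min_le_right _ _
  refine ⟨1 + t, _, (potential_sqrt hc (by linarith)).trans_lt ?_⟩
  have h1 : (2 + t) ^ 2 ≤ 9 := by nlinarith
  have h2 : t ^ 2 * (2 + t) ^ 2 ≤ t ^ 2 * 9 := mul_le_mul_of_nonneg_left h1 (sq_nonneg t)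
  have h3 : t * t ≤ t * (c / 10) := mul_le_mul_of_nonneg_left htc ht0.le
  have h4 : 0 < t * c := by positivity
  have h5 : 0 ≤ c ^ 2 * (2 * t + t ^ 2) := by positivity
  simp only [reducedPotential]
  nlinarith

theorem one_lt_of_potential_lt {c : ℝ} (hc : 0 < c) (Q M : ℝ) (hQ : -1 ≤ Q)
    (h : potential c Q M < -c - c ^ 2) : 1 < Q := by
  by_contra! hQ1
  have h1 := reducedPotential_le_potential c Q M
  have h2 : Q ^ 2 ≤ 1 := by nlinarith
  simp only [reducedPotential] at h1
  nlinarith [sq_nonneg (Q ^ 2 - 1), mul_le_mul_of_nonneg_left h2 (sq_nonneg c),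
    mul_le_mul_of_nonneg_left hQ1 hc.le]

/-- Turns the layer bound, which still contains `X' 0`, into one that depends on `c` alone, as the
uniform threshold requires. -/
theorem LayerSolution.div_sqrt_le {c L : ℝ} {X X' Y Y' : ℝ → ℝ}
    (h : LayerSolution c L X X' Y Y') (hc : 0 < c) (hL : 1 ≤ L) :
    -(3 / 5) / Real.sqrt (X' 0 ^ 2 + 2) ≤
      -(3 / 5 / Real.sqrt ((2 + 18 / 25 * c + (4 * (1 + 18 / 25 * c) * (1 + (1 + 18 / 25 * c) ^ 2)
      + c * (1 + 2 * c * (1 + 18 / 25 * c)))) ^ 2 + 2)) := by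
  have h1 := h.abs_deriv_zero_le hc hL
  rw [neg_div, neg_le_neg_iff]
  apply div_le_div_of_nonneg_left (by norm_num) (Real.sqrt_pos.mpr (by positivity))
  apply Real.sqrt_le_sqrt
  have := sq_le_sq' (by linarith [(abs_le.mp h1).1]) (abs_le.mp h1).2
  linarith

theorem exists_threshold_of_le_quarter {c : ℝ} (hc : 0 < c) (hc4 : c ≤ 1 / 4) :
    ∃ l₀ : ℝ, 0 < l₀ ∧ ∀ l : ℝ, 0 < l → l < l₀ → ∀ Q M : ℝ → ℝ, IsORMinimiser l c Q M →
      IsUnstableCriticalPoint l c (orProfile Q M) := by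
  refine exists_threshold_of_layer_bound (θ := 1) (k := 1) (b := fun v => v / 2)
    (b' := fun _ => 1 / 2) (Λ := fun v => 7 / 5 * v) (Λ' := fun _ => 7 / 5)
    (δ := 3 / 5 / Real.sqrt ((2 + 18 / 25 * c + (4 * (1 + 18 / 25 * c) *
      (1 + (1 + 18 / 25 * c) ^ 2) + c * (1 + 2 * c * (1 + 18 / 25 * c)))) ^ 2 + 2)) hc
    (div_pos (by norm_num : (0 : ℝ) < 3 / 5) (Real.sqrt_pos.mpr (by positivity)))
    (by norm_num) (by norm_num) (potential_lt_neg_sub_sq hc) (one_lt_of_potential_lt hc)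
    (fun v _ => (hasDerivAt_id v).div_const 2) continuousOn_const
    (fun v _ => by simpa using (hasDerivAt_id v).const_mul (7 / 5 : ℝ))
    (by norm_num) (by norm_num) (by norm_num) ?_ ?_
  · intro L X X' Y Y' h s hs
    have h1 := h.sq_Y_le hc s hs
    nlinarith
  · intro L S r X X' Y Y' h hS hSL hXS hlt _ _
    have h1 := h.deriv_nonneg_of_first_hit hS hXS hlt
    have h2 := h.layer_integral_le_of_le_quarter hc hc4 hS (by linarith) hXS hlt
    have h3 := h.div_sqrt_le hc (by linarith)
    have e : ∀ s, -((1 - X s ^ 2) * (4 * 1 ^ 2 * (1 + X s) ^ 2 - 4 * X s * (7 / 5 * (1 + X s))))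
          + c * Y s ^ 2 * (7 / 5 * (1 + X s) + 4 * X s * ((1 + X s) / 2) ^ 2
            - 4 * 1 * (1 + X s) * ((1 + X s) / 2)) =
        -((1 + X s) ^ 2 * (2 - (1 + X s)) * (28 / 5 - 8 / 5 * (1 + X s)))
      + c * Y s ^ 2 * ((1 + X s) * (7 / 5 - 3 * (1 + X s) + (1 + X s) ^ 2)) := by
      intro s; ring
    simp only [e]
    refine le_trans ?_ (h2.trans h3)
    linarith

/-- The profile `b` has `b'` proportional to the inverse square of the barrier `1 + 3v/2`,
normalised by `b 2 = 1`. Then `Y² b'² ≤ 2 b'`, so `Λ = v + 2b` is admissible, and `Λ 2 = 4` removes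
the boundary term. -/
theorem exists_threshold_of_le_sixteen {c : ℝ} (hc : 1 / 4 ≤ c) (hc16 : c ≤ 16) :
    ∃ l₀ : ℝ, 0 < l₀ ∧ ∀ l : ℝ, 0 < l → l < l₀ → ∀ Q M : ℝ → ℝ, IsORMinimiser l c Q M →
      IsUnstableCriticalPoint l c (orProfile Q M) := by
  have hc0 : 0 < c := by linarith
  have hbd : ∀ v : ℝ, 0 ≤ v → HasDerivAt (fun v => 4 * v / (2 + 3 * v)) (8 / (2 + 3 * v) ^ 2) v := by
    intro v hv
    have h0 : 2 + 3 * v ≠ 0 := by positivity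
    refine (((hasDerivAt_id v).const_mul 4).div (((hasDerivAt_id v).const_mul 3).const_add 2)
      h0).congr_deriv ?_
    simp only [id]
    field_simp
    ring
  refine exists_threshold_of_layer_bound (θ := 1) (k := 1) (b := fun v => 4 * v / (2 + 3 * v))
    (b' := fun v => 8 / (2 + 3 * v) ^ 2) (Λ := fun v => v + 2 * (4 * v / (2 + 3 * v)))
    (Λ' := fun v => 1 + 2 * (8 / (2 + 3 * v) ^ 2))
    (δ := 3 / 5 / Real.sqrt ((2 + 18 / 25 * c + (4 * (1 + 18 / 25 * c) *
      (1 + (1 + 18 / 25 * c) ^ 2) + c * (1 + 2 * c * (1 + 18 / 25 * c)))) ^ 2 + 2)) hc0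
    (div_pos (by norm_num : (0 : ℝ) < 3 / 5) (Real.sqrt_pos.mpr (by positivity)))
    (by norm_num) (by norm_num) (potential_lt_neg_sub_sq hc0) (one_lt_of_potential_lt hc0)
    hbd (ContinuousOn.div (by fun_prop) (by fun_prop) fun v hv => by
      have : (0 : ℝ) ≤ v := hv
      positivity)
    (fun v hv => (hasDerivAt_id v).add ((hbd v hv).const_mul 2))
    (by norm_num) (by norm_num) (by norm_num) ?_ ?_
  · intro L X X' Y Y' h s hs
    have hv : 0 ≤ 1 + X s := by linarith [h.neg_one_le_X hc0 s hs]
    have h1 := h.barrier_three_halves hc hc16 s hs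
    have h2 : Y s ^ 2 ≤ (1 + 3 / 2 * (1 + X s)) ^ 2 := sq_le_sq' (abs_le.mp h1).1 (abs_le.mp h1).2
    have h3 : Y s ^ 2 * (8 / (2 + 3 * (1 + X s)) ^ 2) ^ 2 ≤
        (1 + 3 / 2 * (1 + X s)) ^ 2 * (8 / (2 + 3 * (1 + X s)) ^ 2) ^ 2 := by gcongr
    have e : (1 + 3 / 2 * (1 + X s)) ^ 2 * (8 / (2 + 3 * (1 + X s)) ^ 2) ^ 2 =
        2 * (8 / (2 + 3 * (1 + X s)) ^ 2) := by
      have : 2 + 3 * (1 + X s) ≠ 0 := by positivity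
      field_simp
      ring
    linarith
  · intro L S r X X' Y Y' h hS hSL hXS hlt _ _
    have h2 := h.layer_integral_le_of_le_sixteen hc hc16 hS (by linarith) hXS hlt
    have h3 := h.div_sqrt_le hc0 (by linarith)
    refine le_trans (le_of_eq ?_) (h2.trans h3)
    rw [show 4 * 1 - ((1 + 1 : ℝ) + 2 * (4 * (1 + 1) / (2 + 3 * (1 + 1)))) = 0 by norm_num,
      zero_mul, neg_zero, zero_add]
    apply intervalIntegral.integral_congr
    intro s hs
    rw [uIcc_of_le hS.le] at hs
    have hv : 0 ≤ 1 + X s := by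
      linarith [h.neg_one_le_X hc0 s ⟨hs.1, by linarith [hs.2]⟩]
    obtain ⟨v, hvX⟩ : ∃ v, v = 1 + X s := ⟨_, rfl⟩
    rw [← hvX] at hv
    have hXv : X s = v - 1 := by linarith
    simp only [← hvX]
    simp only [hXv]
    have : 2 + 3 * v ≠ 0 := by positivity
    field_simp
    ring

/-- Again `b'` is proportional to the inverse square of the barrier, now `1 + 17v/10` with `b(5/2) =
1`. Raising the level to `θ = 3/2` leaves a boundary coefficient `3/10`, which multiplies a speed of
order `c`. -/
theorem exists_threshold_of_sixteen_le {c : ℝ} (hc : 16 ≤ c) :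
    ∃ l₀ : ℝ, 0 < l₀ ∧ ∀ l : ℝ, 0 < l → l < l₀ → ∀ Q M : ℝ → ℝ, IsORMinimiser l c Q M →
      IsUnstableCriticalPoint l c (orProfile Q M) := by
  have hc0 : 0 < c := by linarith
  have hc2 : 16 * c ≤ c ^ 2 := by nlinarith
  have hc4 : 256 * c ^ 2 ≤ c ^ 4 := by nlinarith [sq_nonneg c]
  have hbd : ∀ v : ℝ, 0 ≤ v → HasDerivAt (fun v => 21 / 10 * v / (1 + 17 / 10 * v))
      (21 / 10 / (1 + 17 / 10 * v) ^ 2) v := by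
    intro v hv
    have h0 : 1 + 17 / 10 * v ≠ 0 := by positivity
    refine (((hasDerivAt_id v).const_mul (21 / 10)).div
      (((hasDerivAt_id v).const_mul (17 / 10)).const_add 1) h0).congr_deriv ?_
    simp only [id]
    field_simp
    ring
  refine exists_threshold_of_layer_bound (θ := 3 / 2) (k := 6 / 5)
    (T := -(2499 / 10000 * c ^ 4) - 42 / 25 * c ^ 2 + 2) (δ := 1 / 2)
    (b := fun v => 21 / 10 * v / (1 + 17 / 10 * v))
    (b' := fun v => 21 / 10 / (1 + 17 / 10 * v) ^ 2)
    (Λ := fun v => 36 / 25 * v + 21 / 10 * (21 / 10 * v / (1 + 17 / 10 * v)))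
    (Λ' := fun v => 36 / 25 + 21 / 10 * (21 / 10 / (1 + 17 / 10 * v) ^ 2)) hc0
    (by norm_num) (by norm_num) (by norm_num) ?_ ?_
    hbd (ContinuousOn.div (by fun_prop) (by fun_prop) fun v hv => by
      have : (0 : ℝ) ≤ v := hv
      positivity)
    (fun v hv => (((hasDerivAt_id v).const_mul (36 / 25 : ℝ)).add
      ((hbd v hv).const_mul (21 / 10))).congr_deriv (by simp))
    (by norm_num) (by norm_num) (by norm_num) ?_ ?_
  -- The reduced potential at `7c/10`, near its minimiser for large `c`, equals `T - 1`.
  · refine ⟨7 / 10 * c, _, (potential_sqrt hc0 (by positivity)).trans_lt ?_⟩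
    simp only [reducedPotential]
    nlinarith
  · intro Q M hQ h
    by_contra! hQ1
    have h1 := reducedPotential_le_potential c Q M
    have h2 : Q ^ 2 ≤ 9 / 4 := by nlinarith
    simp only [reducedPotential] at h1
    nlinarith [sq_nonneg (Q ^ 2 - 1), mul_le_mul_of_nonneg_left h2 (sq_nonneg c),
      mul_le_mul_of_nonneg_left hQ1 hc0.le]
  · intro L X X' Y Y' h s hs
    have hv : 0 ≤ 1 + X s := by linarith [h.neg_one_le_X hc0 s hs]
    have h1 := h.barrier_seventeen_tenths hc s hs
    have h2 : Y s ^ 2 ≤ (1 + 17 / 10 * (1 + X s)) ^ 2 :=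
      sq_le_sq' (abs_le.mp h1).1 (abs_le.mp h1).2
    have h3 : Y s ^ 2 * (21 / 10 / (1 + 17 / 10 * (1 + X s)) ^ 2) ^ 2 ≤
        (1 + 17 / 10 * (1 + X s)) ^ 2 * (21 / 10 / (1 + 17 / 10 * (1 + X s)) ^ 2) ^ 2 := by gcongr
    have e : (1 + 17 / 10 * (1 + X s)) ^ 2 * (21 / 10 / (1 + 17 / 10 * (1 + X s)) ^ 2) ^ 2 =
        21 / 10 * (21 / 10 / (1 + 17 / 10 * (1 + X s)) ^ 2) := by
      have : 1 + 17 / 10 * (1 + X s) ≠ 0 := by positivity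
      field_simp
    linarith
  · intro L S r X X' Y Y' h hS hSL hXS hlt hr hpot
    have h2 := h.layer_integral_le_of_sixteen_le hc hS hSL hXS hlt hr (by
      have : (X r ^ 2 - 1) ^ 2 + (Y r ^ 2 - 1) ^ 2 / 4 - c * X r * Y r ^ 2 =
          potential c (X r) (Y r) := by rw [potential]; ring
      rw [this]
      exact hpot.le)
    refine le_trans (le_of_eq ?_) h2
    rw [show 4 * (3 / 2) - (36 / 25 * (1 + 3 / 2 : ℝ) + 21 / 10 * (21 / 10 * (1 + 3 / 2) /
      (1 + 17 / 10 * (1 + 3 / 2)))) = 3 / 10 by norm_num]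
    congr 1
    apply intervalIntegral.integral_congr
    intro s hs
    rw [uIcc_of_le hS.le] at hs
    have hv : 0 ≤ 1 + X s := by
      linarith [h.neg_one_le_X hc0 s ⟨hs.1, by linarith [hs.2]⟩]
    obtain ⟨v, hvX⟩ : ∃ v, v = 1 + X s := ⟨_, rfl⟩
    rw [← hvX] at hv
    have hXv : X s = v - 1 := by linarith
    simp only [← hvX]
    simp only [hXv]
    have : 1 + 17 / 10 * v ≠ 0 := by positivity
    field_simp
    ring

end Ferronematic

theorem theorem3p3 (c : ℝ) (hc : 0 < c) :
    ∃ l₀ : ℝ, 0 < l₀ ∧ ∀ l : ℝ, 0 < l → l < l₀ →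
      ∀ Q M : ℝ → ℝ, Ferronematic.IsORMinimiser l c Q M →
        Ferronematic.IsUnstableCriticalPoint l c (Ferronematic.orProfile Q M) := by
  rcases le_total c (1 / 4) with h | h
  · exact Ferronematic.exists_threshold_of_le_quarter hc h
  rcases le_total c 16 with h' | h'
  · exact Ferronematic.exists_threshold_of_le_sixteen h h'
  · exact Ferronematic.exists_threshold_of_sixteen_le h'
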